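/- Let $k$ be a field and $r\ge 1$ an integer. Let $Q_r$ be the cyclic quiver with vertex set $\mathbb Z/r$ and exactly one arrow $j\to j+1$ for every vertex $j$, and let $\Lambda_r=kQ_r/I$, where $I$ is the two-sided ideal generated by all cycles of length $r$ (paths are multiplied from left to right). Modules are right modules. For a vertex $j$ with lazy path $e_j$ let $S_j$ be the one-dimensional simple $\Lambda_r$-module supported at $j$, and let $P_j=e_j\Lambda_r$ be its projective cover. Let $D^b(\Lambda_r)$ be the bounded derived category of finite-dimensional modules, realized as the full subcategory of $D(\Lambda_r)$ (the derived category of all $\Lambda_r$-modules) of the complexes with bounded and finite-dimensional cohomology. An object $S$ of $D^b(\Lambda_r)$ is a $\mathbb P^{\infty,2}$-object if there is a graded $k$-algebra isomorphism $\bigoplus_n\mathrm{Hom}(S,S[n])\cong k[\theta]$ with $\deg\theta=2$, and $\mathrm{hocolim}(S\xrightarrow{\theta}S[2]\xrightarrow{\theta[2]}S[4]\to\cdots)=0$ in $D(\Lambda_r)$. A sequence of objects (or of triangulated subcategories) is semiorthogonal if there are no nonzero morphisms of any degree from a later member to an earlier one; $\langle\ldots\rangle$ is the smallest strictly full triangulated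 subcategory that contains the given objects. A triangulated subcategory of $D^b(\Lambda_r)$ is admissible if its inclusion has a left and a right adjoint; it is proper if $\bigoplus_n\mathrm{Hom}(X,Y[n])$ is finite-dimensional for all its objects $X,Y$; it is smooth if it is generated, as a thick subcategory, by one object whose dg endomorphism algebra $E=\mathrm{RHom}(G,G)$ (computed on a K-projective resolution of the generator $G$) is smooth, i.e. perfect as a dg $E$-bimodule. Then for every vertex $i\in\mathbb Z/r$: (i) $(S_{i+1},S_{i+2},\ldots,S_{i-1})$ (the $r-1$ simple modules other than $S_i$, in this cyclic order; the empty sequence if $r=1$) is a semiorthogonal sequence of $\mathbb P^{\infty,2}$-objects in $D^b(\Lambda_r)$; (ii) with $\mathsf S_i=\langle S_{i+1},\ldots,S_{i-1}\rangle$ there is a semiorthogonal decomposition $D^b(\Lambda_r)=\langle \mathsf S_i,\langle P_i\rangle\rangle$: the subcategories $\mathsf S_i$, $\langle P_i\rangle$ are semiorthogonal and together generate $D^b(\Lambda_r)$ as a triangulated category; (iii) $\mathsf S_i$ absorbs the singularities of $\Lambda_r$: it is admissible in $D^b(\Lambda_r)$, and both orthogonal complements $\mathsf S_i^{\perp}$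 and ${}^{\perp}\mathsf S_i$ are smooth and proper. -/

import Mathlib

open CategoryTheory Limits Pretriangulated Triangulated
open scoped DirectSum

universe u v w

noncomputable section

section PathAlgebra

open Quiver

/-- The path algebra `kQ` of a quiver `Q` with finitely many vertices, with its decomposition
`kQ = ⨁ a b, e_a kQ e_b`, where `e_a kQ e_b` has the paths from `a` to `b` as a basis.
The product `p * q` of two paths is "first `p`, then `q`" (and is zero if this makes no sense). -/
def PathAlgebra (k : Type u) (V : Type) [Quiver.{0} V] [CommRing k] : Type u :=
  ∀ a b : V, Path a b →₀ k

namespace PathAlgebra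

variable {k : Type u} {V : Type} [Quiver.{0} V] [CommRing k]

instance : AddCommGroup (PathAlgebra k V) :=
  inferInstanceAs (AddCommGroup (∀ a b : V, Path a b →₀ k))

instance : Module k (PathAlgebra k V) :=
  inferInstanceAs (Module k (∀ a b : V, Path a b →₀ k))

@[ext]
theorem ext {x y : PathAlgebra k V} (h : ∀ a b, x a b = y a b) : x = y :=
  funext fun a => funext fun b => h a b

theorem add_apply (x y : PathAlgebra k V) (a b : V) : (x + y) a b = x a b + y a b := rfl

theorem smul_apply (s : k) (x : PathAlgebra k V) (a b : V) : (s • x) a b = s • x a b := rfl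

theorem zero_apply (a b : V) : (0 : PathAlgebra k V) a b = 0 := rfl

/-- Bilinear extension of the concatenation of paths. -/
def concat {a b c : V} : (Path a b →₀ k) →ₗ[k] (Path b c →₀ k) →ₗ[k] (Path a c →₀ k) :=
  Finsupp.lsum k fun p => LinearMap.toSpanSingleton k _ (Finsupp.lmapDomain k k p.comp)

theorem concat_single {a b c : V} (p : Path a b) (q : Path b c) (s t : k) :
    concat (Finsupp.single p s) (Finsupp.single q t) = Finsupp.single (p.comp q) (s * t) := by
  simp [concat]

theorem concat_assoc {a b c d : V} (x : Path a b →₀ k) (y : Path b c →₀ k) (z : Path c d →₀ k) :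
    concat (concat x y) z = concat x (concat y z) := by
  induction x using Finsupp.induction_linear with
  | zero => simp
  | add x x' hx hx' => simp [hx, hx']
  | single p s =>
    induction y using Finsupp.induction_linear with
    | zero => simp
    | add y y' hy hy' => simp [hy, hy']
    | single q t =>
      induction z using Finsupp.induction_linear with
      | zero => simp
      | add z z' hz hz' => simp [hz, hz']
      | single r v => simp only [concat_single, Path.comp_assoc, mul_assoc]

theorem nil_concat {a b : V} (x : Path a b →₀ k) :
    concat (Finsupp.single Path.nil 1) x = x := by
  induction x using Finsupp.induction_linear with
  | zero => simp
  | add x x' hx hx' => simp [hx, hx']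
  | single p s => simp [concat_single]

theorem concat_nil {a b : V} (x : Path a b →₀ k) :
    concat x (Finsupp.single Path.nil 1) = x := by
  induction x using Finsupp.induction_linear with
  | zero => simp
  | add x x' hx hx' => simp [hx, hx']
  | single p s => simp [concat_single]

/-- The element of the path algebra given by a path. -/
def ofPath [DecidableEq V] {a b : V} (p : Path a b) : PathAlgebra k V :=
  Pi.single a (Pi.single b (Finsupp.single p 1))

section Mul

variable [Fintype V]

instance : Mul (PathAlgebra k V) where
  mul x y := fun a c => ∑ b : V, concat (x a b) (y b c)

theorem mul_apply (x y : PathAlgebra k V) (a c : V) :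
    (x * y) a c = ∑ b : V, concat (x a b) (y b c) := rfl

end Mul

section One

variable [DecidableEq V]

/-- The unit is the sum of the lazy paths. -/
instance : One (PathAlgebra k V) where
  one := fun a b => if h : a = b then Finsupp.single (h ▸ Path.nil) 1 else 0

theorem one_apply (a b : V) : (1 : PathAlgebra k V) a b =
    if h : a = b then Finsupp.single (h ▸ Path.nil) 1 else 0 := rfl

theorem one_apply_self (a : V) : (1 : PathAlgebra k V) a a = Finsupp.single Path.nil 1 := by
  rw [one_apply, dif_pos rfl]

theorem one_apply_ne {a b : V} (h : a ≠ b) : (1 : PathAlgebra k V) a b = 0 := by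
  rw [one_apply, dif_neg h]

end One

variable [Fintype V] [DecidableEq V]

instance : Ring (PathAlgebra k V) :=
  { (inferInstance : AddCommGroup (PathAlgebra k V)),
    (inferInstance : Mul (PathAlgebra k V)),
    (inferInstance : One (PathAlgebra k V)) with
    left_distrib := fun x y z => by
      ext1 a c
      simp only [mul_apply, add_apply, map_add, Finset.sum_add_distrib]
    right_distrib := fun x y z => by
      ext1 a c
      simp only [mul_apply, add_apply, map_add, LinearMap.add_apply, Finset.sum_add_distrib]
    zero_mul := fun x => by
      ext1 a c
      simp only [mul_apply, zero_apply, map_zero, LinearMap.zero_apply, Finset.sum_const_zero]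
    mul_zero := fun x => by
      ext1 a c
      simp only [mul_apply, zero_apply, map_zero, Finset.sum_const_zero]
    mul_assoc := fun x y z => by
      ext1 a d
      simp only [mul_apply, map_sum, LinearMap.sum_apply, concat_assoc]
      exact Finset.sum_comm
    one_mul := fun x => by
      ext1 a c
      rw [mul_apply, Finset.sum_eq_single a]
      · rw [one_apply_self, nil_concat]
      · intro b _ hb
        rw [one_apply_ne hb.symm, map_zero, LinearMap.zero_apply]
      · simp
    mul_one := fun x => by
      ext1 a c
      rw [mul_apply, Finset.sum_eq_single c]
      · rw [one_apply_self, concat_nil]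
      · intro b _ hb
        rw [one_apply_ne hb, map_zero]
      · simp }

instance : Algebra k (PathAlgebra k V) :=
  Algebra.ofModule
    (fun s x y => by
      ext1 a c
      simp only [mul_apply, smul_apply, map_smul, LinearMap.smul_apply, Finset.smul_sum])
    (fun s x y => by
      ext1 a c
      simp only [mul_apply, smul_apply, map_smul, Finset.smul_sum])

theorem ofPath_mul_ofPath {a b c : V} (p : Path a b) (q : Path b c) :
    (ofPath p * ofPath q : PathAlgebra k V) = ofPath (p.comp q) := by
  ext1 a' c'
  rw [mul_apply, Finset.sum_eq_single b]
  · by_cases ha : a' = a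
    · subst ha
      by_cases hc : c' = c
      · subst hc
        simp [ofPath, concat_single]
      · simp [ofPath, Pi.single_eq_of_ne hc]
    · simp [ofPath, Pi.single_eq_of_ne ha]
  · intro b' _ hb
    simp [ofPath, Pi.single_eq_of_ne hb]
  · simp

theorem span_ofPath : Submodule.span k
    {x : PathAlgebra k V | ∃ (a b : V) (p : Path a b), x = ofPath p} = ⊤ := by
  rw [eq_top_iff]
  intro x _
  let ev : ∀ a b : V, PathAlgebra k V →ₗ[k] (Path a b →₀ k) := fun a b =>
    { toFun := fun x => x a b, map_add' := fun _ _ => rfl, map_smul' := fun _ _ => rfl }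
  let inc : ∀ a b : V, (Path a b →₀ k) →ₗ[k] PathAlgebra k V := fun a b =>
    (LinearMap.single k (fun a : V => ∀ b : V, Path a b →₀ k) a).comp
      (LinearMap.single k (fun b : V => Path a b →₀ k) b)
  have hx : x = ∑ a : V, ∑ b : V, inc a b (x a b) := by
    ext1 a b
    suffices h : ev a b x = ev a b (∑ a : V, ∑ b : V, inc a b (x a b)) from h
    rw [map_sum, Finset.sum_eq_single a, map_sum, Finset.sum_eq_single b]
    · change x a b = (Pi.single a (Pi.single b (x a b)) : ∀ a b : V, Path a b →₀ k) a b
      simp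
    · intro b' _ hb
      change (Pi.single a (Pi.single b' (x a b')) : ∀ a b : V, Path a b →₀ k) a b = 0
      simp [Pi.single_eq_of_ne hb.symm]
    · simp
    · intro a' _ ha
      rw [map_sum, Finset.sum_eq_zero]
      intro b' _
      change (Pi.single a' (Pi.single b' (x a' b')) : ∀ a b : V, Path a b →₀ k) a b = 0
      simp [Pi.single_eq_of_ne ha.symm]
    · simp
  rw [hx]
  refine Submodule.sum_mem _ fun a _ => Submodule.sum_mem _ fun b _ => ?_
  induction x a b using Finsupp.induction_linear with
  | zero => simp
  | add f g hf hg => rw [map_add]; exact Submodule.add_mem _ hf hg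
  | single p s =>
    have h : Finsupp.single p s = s • Finsupp.single p (1 : k) := by simp
    rw [h, map_smul]
    exact Submodule.smul_mem _ _ (Submodule.subset_span ⟨a, b, p, rfl⟩)

/-- The coefficient of the lazy path `e_i`: a character of the path algebra. -/
def lazyCoeff (i : V) : PathAlgebra k V →ₐ[k] k :=
  AlgHom.ofLinearMap
    { toFun := fun x => x i i Path.nil
      map_add' := fun _ _ => rfl
      map_smul' := fun _ _ => rfl }
    (by
      change (1 : PathAlgebra k V) i i Path.nil = 1
      rw [one_apply_self, Finsupp.single_eq_same])
    (fun x y => by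
      have key : ∀ (b : V) (f : Path i b →₀ k) (g : Path b i →₀ k),
          concat f g Path.nil =
            if h : i = b then f (h ▸ Path.nil) * g (h ▸ Path.nil) else 0 := by
        intro b f g
        induction f using Finsupp.induction_linear with
        | zero => simp
        | add f f' hf hf' =>
          rw [map_add, LinearMap.add_apply, Finsupp.add_apply, hf, hf']
          split_ifs <;> simp [add_mul]
        | single p s =>
          induction g using Finsupp.induction_linear with
          | zero => simp
          | add g g' hg hg' =>
            rw [map_add, Finsupp.add_apply, hg, hg']
            split_ifs <;> simp [mul_add]
          | single q t =>
            rw [concat_single]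
            cases q with
            | nil =>
              cases p with
              | nil => simp
              | cons p e =>
                simp
            | cons q e =>
              have h1 : p.comp (q.cons e) ≠ Path.nil := by
                rw [Path.comp_cons]; exact Path.cons_ne_nil _ _
              rw [Finsupp.single_eq_of_ne h1.symm]
              split_ifs with h
              · subst h
                simp
              · rfl
      change (x * y) i i Path.nil = x i i Path.nil * y i i Path.nil
      rw [mul_apply, Finsupp.finsetSum_apply, Finset.sum_eq_single i]
      · rw [key]; simp
      · intro b _ hb
        rw [key, dif_neg hb.symm]
      · simp)

end PathAlgebra

/-- The cyclic quiver: its vertices are the residues modulo `r`, and there is exactly one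
arrow `i ⟶ i + 1` for every vertex `i`, and no other arrow. -/
def CyclicQuiver (r : ℕ) : Type := ZMod r

namespace CyclicQuiver

instance (r : ℕ) : CommRing (CyclicQuiver r) := inferInstanceAs (CommRing (ZMod r))

instance (r : ℕ) : DecidableEq (CyclicQuiver r) := inferInstanceAs (DecidableEq (ZMod r))

instance (r : ℕ) [NeZero r] : Fintype (CyclicQuiver r) := inferInstanceAs (Fintype (ZMod r))

instance (r : ℕ) : Quiver.{0} (CyclicQuiver r) where
  Hom i j := PLift (j = i + 1)

theorem natCast_self (r : ℕ) : (r : CyclicQuiver r) = 0 := ZMod.natCast_self r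

/-- The path of length `n` that starts at `a`. -/
def pathFrom {r : ℕ} (a : CyclicQuiver r) : ℕ → Σ b : CyclicQuiver r, Path a b
  | 0 => ⟨a, Path.nil⟩
  | n + 1 => ⟨(pathFrom a n).1 + 1, (pathFrom a n).2.cons ⟨rfl⟩⟩

theorem pathFrom_fst {r : ℕ} (a : CyclicQuiver r) (n : ℕ) : (pathFrom a n).1 = a + n := by
  induction n with
  | zero => simp [pathFrom]
  | succ n ih => simp [pathFrom, ih, add_assoc]

theorem length_pathFrom {r : ℕ} (a : CyclicQuiver r) (n : ℕ) : (pathFrom a n).2.length = n := by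
  induction n with
  | zero => simp [pathFrom]
  | succ n ih => simp [pathFrom, ih]

theorem eq_pathFrom {r : ℕ} {a b : CyclicQuiver r} (p : Path a b) :
    (⟨b, p⟩ : Σ b : CyclicQuiver r, Path a b) = pathFrom a p.length := by
  induction p with
  | nil => rfl
  | cons p e ih =>
    obtain ⟨rfl⟩ := e
    have h : ∀ q : Σ b : CyclicQuiver r, Path a b, (⟨_, p⟩ : Σ b : CyclicQuiver r, Path a b) = q →
        (⟨_, p.cons ⟨rfl⟩⟩ : Σ b : CyclicQuiver r, Path a b) = ⟨q.1 + 1, q.2.cons ⟨rfl⟩⟩ := by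
      rintro _ rfl
      rfl
    exact h _ ih

end CyclicQuiver

/-- The ideal of the path algebra of the cyclic quiver with `r` vertices that is generated by
the paths of length `r` (each of them is the shortest cycle of positive length at its vertex). -/
def cycleIdeal (k : Type u) [CommRing k] (r : ℕ) [NeZero r] :
    TwoSidedIdeal (PathAlgebra k (CyclicQuiver r)) :=
  TwoSidedIdeal.span {x | ∃ (i : CyclicQuiver r) (p : Path i i),
    p.length = r ∧ x = PathAlgebra.ofPath p}

/-- The algebra `Λ_r`: the path algebra of the cyclic quiver modulo all cycles of length `r`. -/
abbrev CyclicAlgebra (k : Type u) [CommRing k] (r : ℕ) [NeZero r] : Type u :=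
  (cycleIdeal k r).ringCon.Quotient

namespace CyclicAlgebra

variable (k : Type u) [CommRing k] (r : ℕ) [NeZero r]

/-- The quotient map from the path algebra. -/
def mk : PathAlgebra k (CyclicQuiver r) →ₐ[k] CyclicAlgebra k r :=
  { (cycleIdeal k r).ringCon.mk' with
    commutes' := fun _ => rfl }

theorem mk_surjective : Function.Surjective (mk k r) := Quotient.mk''_surjective

theorem mk_eq_zero_iff (x : PathAlgebra k (CyclicQuiver r)) :
    mk k r x = 0 ↔ x ∈ cycleIdeal k r :=
  RingCon.eq _

theorem mk_pathFrom_eq_zero (a : CyclicQuiver r) (n : ℕ) (hn : r ≤ n) :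
    mk k r (PathAlgebra.ofPath (CyclicQuiver.pathFrom a n).2) = 0 := by
  induction n, hn using Nat.le_induction with
  | base =>
    rw [mk_eq_zero_iff]
    have h1 : (CyclicQuiver.pathFrom a r).1 = a := by
      rw [CyclicQuiver.pathFrom_fst, CyclicQuiver.natCast_self, add_zero]
    have h2 := CyclicQuiver.length_pathFrom a r
    generalize CyclicQuiver.pathFrom a r = q at h1 h2
    obtain ⟨b, p⟩ := q
    dsimp only at h1 h2
    subst h1
    exact TwoSidedIdeal.subset_span ⟨_, p, h2, rfl⟩
  | succ n hn ih =>
    let e : (CyclicQuiver.pathFrom a n).1 ⟶ (CyclicQuiver.pathFrom a n).1 + 1 := ⟨rfl⟩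
    suffices h : mk k r (PathAlgebra.ofPath ((CyclicQuiver.pathFrom a n).2.comp e.toPath)) = 0
      from h
    rw [← PathAlgebra.ofPath_mul_ofPath, map_mul, ih, zero_mul]

instance : Module.Finite k (CyclicAlgebra k r) := by
  let f : CyclicQuiver r × Fin r → CyclicAlgebra k r := fun x =>
    mk k r (PathAlgebra.ofPath (CyclicQuiver.pathFrom x.1 x.2).2)
  refine ⟨(Submodule.fg_def).2 ⟨Set.range f, Set.finite_range f, ?_⟩⟩
  have hr : LinearMap.range (mk k r).toLinearMap = ⊤ :=
    LinearMap.range_eq_top.2 (mk_surjective k r)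
  rw [eq_top_iff, ← hr, LinearMap.range_eq_map, ← PathAlgebra.span_ofPath, Submodule.map_span,
    Submodule.span_le]
  rintro _ ⟨_, ⟨a, b, p, rfl⟩, rfl⟩
  have h : mk k r (PathAlgebra.ofPath p) =
      mk k r (PathAlgebra.ofPath (CyclicQuiver.pathFrom a p.length).2) :=
    congrArg (fun q : Σ b : CyclicQuiver r, Path a b => mk k r (PathAlgebra.ofPath q.2))
      (CyclicQuiver.eq_pathFrom p)
  change mk k r (PathAlgebra.ofPath p) ∈ Submodule.span k (Set.range f)
  rw [h]
  by_cases hp : p.length < r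
  · exact Submodule.subset_span ⟨(a, ⟨p.length, hp⟩), rfl⟩
  · rw [mk_pathFrom_eq_zero k r a _ (not_lt.1 hp)]
    exact Submodule.zero_mem _

/-- The class of the lazy path at the vertex `i`. -/
def idem (i : CyclicQuiver r) : CyclicAlgebra k r := mk k r (PathAlgebra.ofPath (Path.nil : Path i i))

theorem cycleIdeal_le_ker (i : CyclicQuiver r) :
    cycleIdeal k r ≤ TwoSidedIdeal.ker (PathAlgebra.lazyCoeff (k := k) i) := by
  rw [cycleIdeal, TwoSidedIdeal.span_le]
  rintro _ ⟨j, p, hp, rfl⟩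
  rw [SetLike.mem_coe, TwoSidedIdeal.mem_ker]
  change (PathAlgebra.ofPath p : PathAlgebra k (CyclicQuiver r)) i i Path.nil = 0
  by_cases h : i = j
  · subst h
    have hne : p ≠ Path.nil := by
      rintro rfl
      exact NeZero.ne r hp.symm
    simp [PathAlgebra.ofPath, hne]
  · simp [PathAlgebra.ofPath, Pi.single_eq_of_ne h]

/-- The character of `Λ_r` given by the coefficient of the lazy path at `i`. -/
def character (i : CyclicQuiver r) : CyclicAlgebra k r →ₐ[k] k :=
  (cycleIdeal k r).ringCon.liftₐ (PathAlgebra.lazyCoeff i)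
    fun _ _ h => TwoSidedIdeal.ringCon_le_iff.1 (cycleIdeal_le_ker k r i) h

/-- The simple right `Λ_r`-module `S_i`: it is `k`, concentrated at the vertex `i`. -/
def simple (k : Type u) [Field k] (r : ℕ) [NeZero r] (i : CyclicQuiver r) :
    ModuleCat.{u} (CyclicAlgebra k r)ᵐᵒᵖ :=
  (ModuleCat.restrictScalars
    ((character k r i).toRingHom.fromOpposite fun _ _ => mul_comm _ _)).obj (ModuleCat.of k k)

/-- The indecomposable projective right `Λ_r`-module `P_i = e_i Λ_r`, the projective cover
of `S_i`. -/
def proj (k : Type u) [Field k] (r : ℕ) [NeZero r] (i : CyclicQuiver r) :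
    ModuleCat.{u} (CyclicAlgebra k r)ᵐᵒᵖ :=
  ModuleCat.of _ (Submodule.span (CyclicAlgebra k r)ᵐᵒᵖ {idem k r i})

end CyclicAlgebra

end PathAlgebra

section BoundedDerived

variable (k : Type u) [Field k] (R : Type u) [Ring R] [Algebra k R]

/-- The `R`-modules that are finite dimensional over `k`. -/
def isFinDim : ObjectProperty (ModuleCat.{u} R) := fun M =>
  Module.Finite k ((ModuleCat.restrictScalars (algebraMap k R)).obj M)

instance : (isFinDim k R).IsSerreClass where
  exists_zero := ⟨ModuleCat.of R PUnit, ModuleCat.isZero_of_subsingleton _, by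
    change Module.Finite k ((ModuleCat.restrictScalars (algebraMap k R)).obj (ModuleCat.of R PUnit))
    have : Finite ((ModuleCat.restrictScalars (algebraMap k R)).obj (ModuleCat.of R PUnit)) :=
      inferInstanceAs (Finite PUnit)
    infer_instance⟩
  prop_of_mono {X Y} f hf hY := by
    have hY' : Module.Finite k ((ModuleCat.restrictScalars (algebraMap k R)).obj Y) := hY
    exact Module.Finite.of_injective ((ModuleCat.restrictScalars (algebraMap k R)).map f).hom
      ((ModuleCat.mono_iff_injective f).1 hf)
  prop_of_epi {X Y} f hf hX := by
    have hX' : Module.Finite k ((ModuleCat.restrictScalars (algebraMap k R)).obj X) := hX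
    exact Module.Finite.of_surjective ((ModuleCat.restrictScalars (algebraMap k R)).map f).hom
      ((ModuleCat.epi_iff_surjective f).1 hf)
  prop_X₂_of_shortExact {S} hS h1 h3 := by
    have h1' : Module.Finite k ((ModuleCat.restrictScalars (algebraMap k R)).obj S.X₁) := h1
    have h3' : Module.Finite k ((ModuleCat.restrictScalars (algebraMap k R)).obj S.X₃) := h3
    let f := ((ModuleCat.restrictScalars (algebraMap k R)).map S.f).hom
    let g := ((ModuleCat.restrictScalars (algebraMap k R)).map S.g).hom
    have hfg : Function.Exact f g :=
      (ShortComplex.ShortExact.moduleCat_exact_iff_function_exact S).1 hS.exact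
    exact Module.Finite.of_exact hfg hS.moduleCat_surjective_g

variable [HasDerivedCategory.{w} (ModuleCat.{u} R)]

/-- The objects of the derived category with finite dimensional cohomology in all degrees. -/
def hasFinDimHomology : ObjectProperty (DerivedCategory (ModuleCat.{u} R)) := fun X =>
  ∀ n : ℤ, isFinDim k R ((DerivedCategory.homologyFunctor _ n).obj X)

instance : (hasFinDimHomology k R).IsClosedUnderIsomorphisms where
  of_iso e h n := (isFinDim k R).prop_of_iso ((DerivedCategory.homologyFunctor _ n).mapIso e) (h n)

open ZeroObject in
instance : (hasFinDimHomology k R).IsTriangulated where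
  exists_zero := ⟨0, isZero_zero _, fun n => (isFinDim k R).prop_of_isZero
    ((DerivedCategory.homologyFunctor _ n).map_isZero (isZero_zero _))⟩
  isStableUnderShiftBy a := ⟨fun X h n => (isFinDim k R).prop_of_iso
    (((DerivedCategory.homologyFunctor (ModuleCat.{u} R) 0).shiftIso a n (a + n) rfl).app X).symm
      (h (a + n))⟩
  ext₂' T hT h1 h3 := ObjectProperty.le_isoClosure _ _ fun n =>
    (isFinDim k R).prop_X₂_of_exact
      ((DerivedCategory.homologyFunctor (ModuleCat.{u} R) n).map_distinguished_exact T hT)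
      (h1 n) (h3 n)

/-- The objects of the derived category with bounded cohomology that is finite dimensional
in all degrees. -/
def isBoundedFinDim : ObjectProperty (DerivedCategory (ModuleCat.{u} R)) :=
  DerivedCategory.TStructure.t.bounded ⊓ hasFinDimHomology k R

instance : (isBoundedFinDim k R).IsClosedUnderIsomorphisms := by
  dsimp only [isBoundedFinDim]
  infer_instance

instance : (isBoundedFinDim k R).IsTriangulated := by
  dsimp only [isBoundedFinDim]
  infer_instance

/-- The bounded derived category of finite dimensional modules over a `k`-algebra `R`, as the
full triangulated subcategory of the derived category of all modules. -/
abbrev BoundedDerived : Type _ := (isBoundedFinDim k R).FullSubcategory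

instance (n : ℤ) : (shiftFunctor (BoundedDerived k R) n).Linear k where
  map_smul f s := by
    apply (isBoundedFinDim k R).ι.map_injective
    rw [← cancel_mono (((isBoundedFinDim k R).ι.commShiftIso n).hom.app _)]
    have h {X Y : BoundedDerived k R} (g : X ⟶ Y) :=
      ((isBoundedFinDim k R).ι.commShiftIso n).hom.naturality g
    dsimp only [Functor.comp_map] at h
    rw [h, Functor.map_smul, Functor.map_smul, Functor.map_smul, Linear.comp_smul,
      Linear.smul_comp, h]

variable {R}

theorem isBoundedFinDim_single {M : ModuleCat.{u} R} (hM : isFinDim k R M) :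
    isBoundedFinDim k R ((DerivedCategory.singleFunctor _ 0).obj M) := by
  refine ⟨⟨⟨0, inferInstance⟩, ⟨0, inferInstance⟩⟩, fun n => ?_⟩
  by_cases hn : n = 0
  · subst hn
    exact (isFinDim k R).prop_of_iso
      ((DerivedCategory.singleFunctorCompHomologyFunctorIso (ModuleCat.{u} R) 0).app M).symm hM
  · refine (isFinDim k R).prop_of_isZero ?_
    rcases lt_or_gt_of_ne hn with h | h
    · exact DerivedCategory.isZero_of_isGE _ 0 n h
    · exact DerivedCategory.isZero_of_isLE _ 0 n h

/-- A finite dimensional module as an object of the bounded derived category. -/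
def BoundedDerived.of (M : ModuleCat.{u} R) (hM : isFinDim k R M) : BoundedDerived k R :=
  ⟨(DerivedCategory.singleFunctor _ 0).obj M, isBoundedFinDim_single k hM⟩

end BoundedDerived

section ExtAlgebra

section
variable {C : Type w} [Category.{v} C] [HasShift C ℤ]

theorem shiftedHom_comp_heq {X Y Z : C} {a b c c' : ℤ} (f : ShiftedHom X Y a)
    (g : ShiftedHom Y Z b) (h : b + a = c) (h' : b + a = c') :
    HEq (f.comp g h) (f.comp g h') := by
  subst h h'
  rfl

instance (X : C) : GradedMonoid.GMul (fun n : ℤ => ShiftedHom X X n) where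
  mul f g := ShiftedHom.comp g f rfl

instance (X : C) : GradedMonoid.GOne (fun n : ℤ => ShiftedHom X X n) where
  one := ShiftedHom.mk₀ 0 rfl (𝟙 X)

theorem shiftedHom_mul_def {X : C} {i j : ℤ} (f : ShiftedHom X X i) (g : ShiftedHom X X j) :
    (GradedMonoid.GMul.mul (A := fun n : ℤ => ShiftedHom X X n) f g : ShiftedHom X X (i + j)) =
      ShiftedHom.comp g f rfl := rfl

end

variable {C : Type w} [Category.{v} C] [Preadditive C] [HasShift C ℤ]
  [∀ n : ℤ, (shiftFunctor C n).Additive]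

instance (X : C) : DirectSum.GRing (fun n : ℤ => ShiftedHom X X n) where
  mul_zero f := ShiftedHom.zero_comp _ _ _ _
  zero_mul g := ShiftedHom.comp_zero _ _ _
  mul_add f g g' := ShiftedHom.add_comp _ _ _ _
  add_mul f f' g := ShiftedHom.comp_add _ _ _ _
  one_mul := by
    rintro ⟨i, f⟩
    refine Sigma.ext (zero_add i) ?_
    refine HEq.trans (shiftedHom_comp_heq _ _ _ (zero_add i)) (heq_of_eq ?_)
    exact ShiftedHom.comp_mk₀_id _ _ _
  mul_one := by
    rintro ⟨i, f⟩
    refine Sigma.ext (add_zero i) ?_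
    refine HEq.trans (shiftedHom_comp_heq _ _ _ (add_zero i)) (heq_of_eq ?_)
    exact ShiftedHom.mk₀_id_comp _ _ _
  mul_assoc := by
    rintro ⟨i, f⟩ ⟨j, g⟩ ⟨l, h⟩
    refine Sigma.ext (add_assoc i j l) ?_
    refine HEq.trans (shiftedHom_comp_heq _ _ _ (add_assoc i j l)) (heq_of_eq ?_)
    exact (ShiftedHom.comp_assoc h g f rfl rfl (add_assoc i j l)).symm
  natCast n := n • ShiftedHom.mk₀ 0 rfl (𝟙 X)
  natCast_zero := zero_nsmul _
  natCast_succ n := succ_nsmul _ n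
  intCast n := n • ShiftedHom.mk₀ 0 rfl (𝟙 X)
  intCast_ofNat n := natCast_zsmul _ n
  intCast_negSucc_ofNat n := negSucc_zsmul _ n

/-- The graded algebra `Ext^•(X, X) = ⨁ n, Hom(X, X[n])`, with the composition as product. -/
abbrev ExtAlgebra (X : C) : Type _ := ⨁ n : ℤ, ShiftedHom X X n

variable (k : Type u) [Field k] [Linear k C] [∀ n : ℤ, (shiftFunctor C n).Linear k]

instance (X : C) : Algebra k (ExtAlgebra X) :=
  Algebra.ofModule
    (fun s x y => by
      induction x using DirectSum.induction_on with
      | zero => simp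
      | add x x' hx hx' => simp only [smul_add, add_mul, hx, hx']
      | of i f =>
        induction y using DirectSum.induction_on with
        | zero => simp
        | add y y' hy hy' => simp only [smul_add, mul_add, hy, hy']
        | of j g =>
          rw [← DirectSum.of_smul, DirectSum.of_mul_of, DirectSum.of_mul_of, ← DirectSum.of_smul,
            shiftedHom_mul_def, shiftedHom_mul_def, ShiftedHom.comp_smul])
    (fun s x y => by
      induction x using DirectSum.induction_on with
      | zero => simp
      | add x x' hx hx' => simp only [smul_add, add_mul, hx, hx']
      | of i f =>
        induction y using DirectSum.induction_on with
        | zero => simp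
        | add y y' hy hy' => simp only [smul_add, mul_add, hy, hy']
        | of j g =>
          rw [← DirectSum.of_smul, DirectSum.of_mul_of, DirectSum.of_mul_of, ← DirectSum.of_smul,
            shiftedHom_mul_def, shiftedHom_mul_def, ShiftedHom.smul_comp])

end ExtAlgebra

section DG

/-- A dg algebra over `k`, as a `k`-algebra with an internal grading and a differential. -/
structure DGAlgebra (k : Type u) [Field k] where
  carrier : Type v
  [ring : Ring carrier]
  [algebra : Algebra k carrier]
  deg : ℤ → Submodule k carrier
  isInternal : DirectSum.IsInternal deg
  one_mem : 1 ∈ deg 0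
  mul_mem : ∀ {i j : ℤ} {x y : carrier}, x ∈ deg i → y ∈ deg j → x * y ∈ deg (i + j)
  d : carrier →ₗ[k] carrier
  d_mem : ∀ {i : ℤ} {x : carrier}, x ∈ deg i → d x ∈ deg (i + 1)
  d_d : ∀ x, d (d x) = 0
  d_mul : ∀ {i : ℤ} {x : carrier} (y : carrier), x ∈ deg i →
    d (x * y) = d x * y + i.negOnePow • (x * d y)

attribute [instance] DGAlgebra.ring DGAlgebra.algebra

/-- A dg bimodule over a dg algebra (with `k` acting centrally). -/
structure DGBimodule {k : Type u} [Field k] (E : DGAlgebra.{u, v} k) where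
  carrier : Type v
  [addCommGroup : AddCommGroup carrier]
  [module : Module k carrier]
  [leftModule : Module E.carrier carrier]
  [rightModule : Module E.carrierᵐᵒᵖ carrier]
  [leftTower : IsScalarTower k E.carrier carrier]
  [rightTower : IsScalarTower k E.carrierᵐᵒᵖ carrier]
  [smulComm : SMulCommClass E.carrier E.carrierᵐᵒᵖ carrier]
  deg : ℤ → Submodule k carrier
  isInternal : DirectSum.IsInternal deg
  smul_mem : ∀ {i j : ℤ} {a : E.carrier} {m : carrier}, a ∈ E.deg i → m ∈ deg j →
    a • m ∈ deg (i + j)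
  op_smul_mem : ∀ {i j : ℤ} {a : E.carrier} {m : carrier}, a ∈ E.deg i → m ∈ deg j →
    MulOpposite.op a • m ∈ deg (j + i)
  d : carrier →ₗ[k] carrier
  d_mem : ∀ {i : ℤ} {m : carrier}, m ∈ deg i → d m ∈ deg (i + 1)
  d_d : ∀ m, d (d m) = 0
  d_smul : ∀ {i : ℤ} {a : E.carrier} (m : carrier), a ∈ E.deg i →
    d (a • m) = E.d a • m + i.negOnePow • (a • d m)
  d_op_smul : ∀ {i : ℤ} (a : E.carrier) {m : carrier}, m ∈ deg i →
    d (MulOpposite.op a • m) =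
      MulOpposite.op a • d m + i.negOnePow • (MulOpposite.op (E.d a) • m)

attribute [instance] DGBimodule.addCommGroup DGBimodule.module DGBimodule.leftModule
  DGBimodule.rightModule DGBimodule.leftTower DGBimodule.rightTower DGBimodule.smulComm

namespace DGBimodule

variable {k : Type u} [Field k] {E : DGAlgebra.{u, v} k}

/-- Morphisms of dg bimodules: closed, of degree zero. -/
structure Hom (M N : DGBimodule E) where
  toLin : M.carrier →ₗ[k] N.carrier
  map_smul : ∀ (a : E.carrier) (m : M.carrier), toLin (a • m) = a • toLin m
  map_op_smul : ∀ (a : E.carrier) (m : M.carrier),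
    toLin (MulOpposite.op a • m) = MulOpposite.op a • toLin m
  map_mem : ∀ {i : ℤ} {m : M.carrier}, m ∈ M.deg i → toLin m ∈ N.deg i
  map_d : ∀ m : M.carrier, toLin (M.d m) = N.d (toLin m)

/-- A quasi-isomorphism: the induced map on `ker d / im d` is injective and surjective. -/
def Hom.IsQuasiIso {M N : DGBimodule E} (f : Hom M N) : Prop :=
  (∀ m : M.carrier, M.d m = 0 → (∃ n : N.carrier, f.toLin m = N.d n) → ∃ m' , m = M.d m') ∧
  (∀ n : N.carrier, N.d n = 0 → ∃ m : M.carrier, M.d m = 0 ∧ ∃ n', f.toLin m - n = N.d n')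

/-- A dg bimodule is free of rank one if it has a closed homogeneous element `x` such that
`E ⊗ E ⟶ F`, `a ⊗ b ↦ a x b` is bijective. Up to isomorphism these are the shifts of `E ⊗ E`. -/
def IsFreeOfRankOne (F : DGBimodule E) : Prop :=
  ∃ (n : ℤ) (x : F.carrier), x ∈ F.deg n ∧ F.d x = 0 ∧
    Function.Bijective (TensorProduct.lift (LinearMap.mk₂ k
      (fun a b : E.carrier => a • (MulOpposite.op b • x))
      (fun a a' b => by rw [add_smul]) (fun s a b => by rw [smul_assoc])
      (fun a b b' => by rw [MulOpposite.op_add, add_smul, smul_add])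
      (fun s a b => by rw [MulOpposite.op_smul, smul_assoc, smul_comm])))

/-- Short exact sequences of dg bimodules. -/
structure IsShortExact {L M N : DGBimodule E} (f : Hom L M) (g : Hom M N) : Prop where
  injective : Function.Injective f.toLin
  exact : Function.Exact f.toLin g.toLin
  surjective : Function.Surjective g.toLin

/-- Perfect dg bimodules: the smallest class of dg bimodules that contains the free ones of rank
one and is closed under quasi-isomorphisms, under the two-out-of-three rule in short exact
sequences, and under direct summands. This is the thick subcategory of the derived category of
dg bimodules that is generated by `E ⊗ E`. -/
inductive IsPerfect : DGBimodule E → Prop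
  | free {F : DGBimodule E} : F.IsFreeOfRankOne → IsPerfect F
  | of_quasiIso {M N : DGBimodule E} (f : Hom M N) : f.IsQuasiIso → IsPerfect M → IsPerfect N
  | of_quasiIso' {M N : DGBimodule E} (f : Hom M N) : f.IsQuasiIso → IsPerfect N → IsPerfect M
  | ext₁ {L M N : DGBimodule E} (f : Hom L M) (g : Hom M N) : IsShortExact f g →
      IsPerfect M → IsPerfect N → IsPerfect L
  | ext₂ {L M N : DGBimodule E} (f : Hom L M) (g : Hom M N) : IsShortExact f g →
      IsPerfect L → IsPerfect N → IsPerfect M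
  | ext₃ {L M N : DGBimodule E} (f : Hom L M) (g : Hom M N) : IsShortExact f g →
      IsPerfect L → IsPerfect M → IsPerfect N
  | retract {M N : DGBimodule E} (i : Hom N M) (p : Hom M N) :
      (∀ n : N.carrier, p.toLin (i.toLin n) = n) → IsPerfect M → IsPerfect N

/-- The diagonal bimodule: the dg algebra as a bimodule over itself. -/
def diagonal (E : DGAlgebra.{u, v} k) : DGBimodule E where
  carrier := E.carrier
  deg := E.deg
  isInternal := E.isInternal
  smul_mem ha hm := E.mul_mem ha hm
  op_smul_mem ha hm := E.mul_mem hm ha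
  d := E.d
  d_mem := E.d_mem
  d_d := E.d_d
  d_smul m ha := E.d_mul m ha
  d_op_smul a _ hm := E.d_mul a hm

end DGBimodule

/-- A dg algebra is smooth if it is perfect as a dg bimodule over itself. -/
def DGAlgebra.IsSmooth {k : Type u} [Field k] (E : DGAlgebra.{u, v} k) : Prop :=
  (DGBimodule.diagonal E).IsPerfect

end DG

section DGEnd

open CochainComplex.HomComplex

variable {C : Type w} [Category.{v} C] [Preadditive C]

theorem cochain_comp_heq {F G K : CochainComplex C ℤ} {a b c c' : ℤ} (f : Cochain F G a)
    (g : Cochain G K b) (h : a + b = c) (h' : a + b = c') :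
    HEq (f.comp g h) (f.comp g h') := by
  subst h h'
  rfl

instance (K : CochainComplex C ℤ) : GradedMonoid.GMul (fun n : ℤ => Cochain K K n) where
  mul {i j} f g := Cochain.comp g f (add_comm j i)

instance (K : CochainComplex C ℤ) : GradedMonoid.GOne (fun n : ℤ => Cochain K K n) where
  one := Cochain.ofHom (𝟙 K)

theorem cochain_mul_def {K : CochainComplex C ℤ} {i j : ℤ} (f : Cochain K K i)
    (g : Cochain K K j) :
    (GradedMonoid.GMul.mul (A := fun n : ℤ => Cochain K K n) f g : Cochain K K (i + j)) =
      Cochain.comp g f (add_comm j i) := rfl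

instance (K : CochainComplex C ℤ) : DirectSum.GRing (fun n : ℤ => Cochain K K n) where
  mul_zero f := Cochain.zero_comp _ _
  zero_mul g := Cochain.comp_zero _ _
  mul_add f g g' := Cochain.add_comp _ _ _ _
  add_mul f f' g := Cochain.comp_add _ _ _ _
  one_mul := by
    rintro ⟨i, f⟩
    refine Sigma.ext (zero_add i) ?_
    exact HEq.trans (cochain_comp_heq f (Cochain.ofHom (𝟙 K)) (add_comm i 0) (add_zero i))
      (heq_of_eq (Cochain.comp_id f))
  mul_one := by
    rintro ⟨i, f⟩
    refine Sigma.ext (add_zero i) ?_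
    exact HEq.trans (cochain_comp_heq (Cochain.ofHom (𝟙 K)) f (add_comm 0 i) (zero_add i))
      (heq_of_eq (Cochain.id_comp f))
  mul_assoc := by
    rintro ⟨i, f⟩ ⟨j, g⟩ ⟨l, h⟩
    refine Sigma.ext (add_assoc i j l) ?_
    have e : l + j + i = i + (j + l) := by omega
    exact HEq.trans
      (cochain_comp_heq h (g.comp f (add_comm j i)) (add_comm l (i + j))
        (show l + (i + j) = i + (j + l) by omega))
      (heq_of_eq (Cochain.comp_assoc h g f (add_comm l j) (add_comm j i) e).symm)
  natCast n := n • Cochain.ofHom (𝟙 K)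
  natCast_zero := zero_nsmul _
  natCast_succ n := succ_nsmul _ n
  intCast n := n • Cochain.ofHom (𝟙 K)
  intCast_ofNat n := natCast_zsmul _ n
  intCast_negSucc_ofNat n := negSucc_zsmul _ n

variable (k : Type u) [Field k] [Linear k C]

instance (K : CochainComplex C ℤ) : Algebra k (⨁ n : ℤ, Cochain K K n) :=
  Algebra.ofModule
    (fun s x y => by
      induction x using DirectSum.induction_on with
      | zero => simp
      | add x x' hx hx' => simp only [smul_add, add_mul, hx, hx']
      | of i f =>
        induction y using DirectSum.induction_on with
        | zero => simp
        | add y y' hy hy' => simp only [smul_add, mul_add, hy, hy']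
        | of j g =>
          rw [← DirectSum.of_smul, DirectSum.of_mul_of, DirectSum.of_mul_of, ← DirectSum.of_smul,
            cochain_mul_def, cochain_mul_def, Cochain.comp_smul])
    (fun s x y => by
      induction x using DirectSum.induction_on with
      | zero => simp
      | add x x' hx hx' => simp only [smul_add, add_mul, hx, hx']
      | of i f =>
        induction y using DirectSum.induction_on with
        | zero => simp
        | add y y' hy hy' => simp only [smul_add, mul_add, hy, hy']
        | of j g =>
          rw [← DirectSum.of_smul, DirectSum.of_mul_of, DirectSum.of_mul_of, ← DirectSum.of_smul,
            cochain_mul_def, cochain_mul_def, Cochain.smul_comp])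

theorem isInternal_range_lof {M : ℤ → Type w} [∀ n, AddCommGroup (M n)] [∀ n, Module k (M n)] :
    DirectSum.IsInternal fun n : ℤ => LinearMap.range (DirectSum.lof k ℤ M n) := by
  let N : ℤ → Submodule k (⨁ n, M n) := fun n => LinearMap.range (DirectSum.lof k ℤ M n)
  let φ : (⨁ n, M n) →ₗ[k] ⨁ n, N n := DirectSum.toModule k ℤ _ fun n =>
    (DirectSum.lof k ℤ (fun n => N n) n).comp (DirectSum.lof k ℤ M n).rangeRestrict
  have h1 : (DirectSum.coeLinearMap N).comp φ = LinearMap.id := by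
    refine DirectSum.linearMap_ext k fun n => LinearMap.ext fun m => ?_
    simp [φ, DirectSum.toModule_lof, DirectSum.coeLinearMap_lof]
  have h2 : φ.comp (DirectSum.coeLinearMap N) = LinearMap.id := by
    refine DirectSum.linearMap_ext k fun n => LinearMap.ext ?_
    rintro ⟨_, m, rfl⟩
    simp only [LinearMap.comp_apply, DirectSum.coeLinearMap_lof, LinearMap.id_apply]
    rw [DirectSum.toModule_lof]
    rfl
  exact Function.bijective_iff_has_inverse.2
    ⟨φ, fun x => LinearMap.congr_fun h2 x, fun x => LinearMap.congr_fun h1 x⟩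

/-- The dg endomorphism algebra of a complex `K`: in degree `n` it consists of the families of
morphisms `K^p ⟶ K^(p+n)`, the product is the composition, the differential is the
differential of the complex of homomorphisms. -/
def dgEnd (K : CochainComplex C ℤ) : DGAlgebra.{u, v} k where
  carrier := ⨁ n : ℤ, Cochain K K n
  deg n := LinearMap.range (DirectSum.lof k ℤ (fun n : ℤ => Cochain K K n) n)
  isInternal := isInternal_range_lof k
  one_mem := ⟨Cochain.ofHom (𝟙 K), rfl⟩
  mul_mem := by
    rintro i j _ _ ⟨f, rfl⟩ ⟨g, rfl⟩
    exact ⟨_, (DirectSum.of_mul_of f g).symm⟩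
  d := DirectSum.toModule k ℤ _ fun n =>
    (DirectSum.lof k ℤ (fun n : ℤ => Cochain K K n) (n + 1)).comp (δ_hom k K K n (n + 1))
  d_mem := by
    rintro i _ ⟨f, rfl⟩
    rw [DirectSum.toModule_lof]
    exact ⟨_, rfl⟩
  d_d := fun x => by
    induction x using DirectSum.induction_on with
    | zero => simp only [map_zero]
    | add x y hx hy => simp only [map_add, hx, hy, add_zero]
    | of n f =>
      rw [← DirectSum.lof_eq_of k, DirectSum.toModule_lof, LinearMap.comp_apply,
        DirectSum.toModule_lof, LinearMap.comp_apply]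
      change DirectSum.lof k ℤ _ _ (δ (n + 1) (n + 1 + 1) (δ n (n + 1) f)) = 0
      rw [δ_δ, map_zero]
  d_mul := by
    rintro i _ y ⟨f, rfl⟩
    induction y using DirectSum.induction_on with
    | zero => simp only [mul_zero, map_zero, smul_zero, add_zero]
    | add y y' hy hy' =>
      simp only [mul_add, map_add, hy, hy', smul_add]
      abel
    | of j g =>
      have key : ∀ (a b c c' : ℤ) (z : Cochain K K a) (z' : Cochain K K b) (h : a + b = c)
          (h' : a + b = c'), DirectSum.of (fun n : ℤ => Cochain K K n) c (z.comp z' h) =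
            DirectSum.of (fun n : ℤ => Cochain K K n) c' (z.comp z' h') := by
        rintro a b c c' z z' rfl rfl
        rfl
      rw [← DirectSum.lof_eq_of k, DirectSum.toModule_lof, DirectSum.toModule_lof,
        DirectSum.lof_eq_of, DirectSum.lof_eq_of, DirectSum.of_mul_of, cochain_mul_def,
        ← DirectSum.lof_eq_of k, DirectSum.toModule_lof]
      simp only [LinearMap.comp_apply, DirectSum.lof_eq_of, DirectSum.of_mul_of, cochain_mul_def]
      change DirectSum.of (fun n : ℤ => Cochain K K n) _ (δ (i + j) (i + j + 1) _) =
        DirectSum.of (fun n : ℤ => Cochain K K n) _ (g.comp (δ i (i + 1) f) _) +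
          i.negOnePow • DirectSum.of (fun n : ℤ => Cochain K K n) _ ((δ j (j + 1) g).comp f _)
      rw [δ_comp g f (add_comm j i) (j + 1) (i + 1) (i + j + 1) rfl rfl rfl, map_add,
        Units.smul_def, Units.smul_def, map_zsmul]
      congr 1
      · exact key _ _ _ _ _ _ _ _
      · congr 1
        exact key _ _ _ _ _ _ _ _

end DGEnd

section Triangulated

variable {T : Type w} [Category.{v} T] [HasZeroObject T] [HasShift T ℤ] [Preadditive T]
  [∀ n : ℤ, (shiftFunctor T n).Additive] [Pretriangulated T]

/-- The triangulated subcategory generated by a class of objects: the smallest strictly full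
triangulated subcategory that contains it. -/
def generatedBy (P : ObjectProperty T) : ObjectProperty T := fun X =>
  ∀ Q : ObjectProperty T, Q.IsTriangulated → Q.IsClosedUnderIsomorphisms → P ≤ Q → Q X

/-- A finite sequence of objects is semiorthogonal if there are no morphisms
of any degree from a later object to an earlier one. -/
def IsSemiorthogonal {m : ℕ} (E : Fin m → T) : Prop :=
  ∀ a b : Fin m, a < b → ∀ (n : ℤ) (f : E b ⟶ (E a)⟦n⟧), f = 0

/-- Semiorthogonal decompositions: triangulated subcategories `𝒜 0, …, 𝒜 (m - 1)` without
nonzero morphisms from a later to an earlier one, which together generate. -/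
structure IsSemiorthogonalDecomposition {m : ℕ} (𝒜 : Fin m → ObjectProperty T) : Prop where
  isTriangulated : ∀ a, (𝒜 a).IsTriangulated
  isClosedUnderIsomorphisms : ∀ a, (𝒜 a).IsClosedUnderIsomorphisms
  semiorthogonal : ∀ a b : Fin m, a < b → 𝒜 a ≤ (𝒜 b).rightOrthogonal
  generate : generatedBy (⨆ a, 𝒜 a) = ⊤

/-- A triangulated subcategory is admissible if its inclusion functor has both a right and a
left adjoint. -/
structure IsAdmissible (P : ObjectProperty T) : Prop where
  isTriangulated : P.IsTriangulated
  rightAdmissible : P.ι.IsLeftAdjoint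
  leftAdmissible : P.ι.IsRightAdjoint

/-- `Y` is a homotopy colimit of the sequence `X 0 ⟶ X 1 ⟶ ⋯`: the third vertex of a
distinguished triangle on `1 - shift : ⨁ X n ⟶ ⨁ X n`. -/
def IsHocolim (X : ℕ → T) (f : ∀ n, X n ⟶ X (n + 1)) (Y : T) : Prop :=
  ∃ (c : Cofan X) (hc : IsColimit c) (g : c.pt ⟶ Y) (h : Y ⟶ c.pt⟦(1 : ℤ)⟧),
    Triangle.mk (𝟙 c.pt - Cofan.IsColimit.desc hc fun n => f n ≫ c.inj (n + 1)) g h ∈ distTriang T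

/-- The maps of the sequence `S ⟶ S[q] ⟶ S[2q] ⟶ ⋯` defined by `θ : S ⟶ S[q]`. -/
def shiftSequenceMap {S : T} {q : ℤ} (θ : ShiftedHom S S q) (n : ℕ) :
    S⟦q * (n : ℤ)⟧ ⟶ S⟦q * ((n + 1 : ℕ) : ℤ)⟧ :=
  θ⟦q * (n : ℤ)⟧' ≫ (shiftFunctorAdd' T q (q * n) (q * ((n + 1 : ℕ) : ℤ))
    (by push_cast; ring)).inv.app S

/-- `ℙ^{∞,q}`-objects of a `k`-linear triangulated category `T'` that is embedded by `F` into
a triangulated category `T` in which the homotopy colimit is taken: the graded algebra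
`Ext^•(S, S)` is a polynomial algebra on a generator `θ` of degree `q`, and
`hocolim (S ⟶ S[q] ⟶ S[2q] ⟶ ⋯) = 0`. -/
def IsPInftyObject (k : Type u) [Field k] {T' : Type*} [Category* T'] [Preadditive T']
    [HasShift T' ℤ] [∀ n : ℤ, (shiftFunctor T' n).Additive] [Linear k T']
    [∀ n : ℤ, (shiftFunctor T' n).Linear k] (F : T' ⥤ T) [F.CommShift ℤ] (q : ℤ) (S : T') : Prop :=
  ∃ (φ : Polynomial k ≃ₐ[k] ExtAlgebra S) (θ : ShiftedHom S S q),
    φ Polynomial.X = DirectSum.of (fun n : ℤ => ShiftedHom S S n) q θ ∧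
    ∃ Y : T, IsHocolim (fun n : ℕ => (F.obj S)⟦q * (n : ℤ)⟧)
      (fun n => shiftSequenceMap (θ.map F) n) Y ∧ IsZero Y

/-- A `k`-linear triangulated (sub)category is proper if the total Hom spaces
`⨁ n, Hom(X, Y[n])` are finite dimensional. -/
def IsProperSubcategory (k : Type u) [Field k] [Linear k T] (P : ObjectProperty T) : Prop :=
  ∀ X Y : T, P X → P Y → Module.Finite k (⨁ n : ℤ, ShiftedHom X Y n)

end Triangulated

section Absorption

variable (k : Type u) [Field k] {R : Type u} [Ring R] [Algebra k R]
  [HasDerivedCategory.{w} (ModuleCat.{u} R)]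

/-- Smoothness of a triangulated subcategory `P` of the bounded derived category, for the
dg enhancement by K-projective complexes: `P` has a classical generator `G` (the smallest thick
subcategory that contains `G` is `P`) such that the dg endomorphism algebra of a K-projective
resolution `K` of `G` is a smooth dg algebra. So `P` is the category of perfect dg modules over a
smooth dg algebra. -/
def IsSmoothSubcategory (P : ObjectProperty (BoundedDerived k R)) : Prop :=
  ∃ (K : CochainComplex (ModuleCat.{u} R) ℤ) (G : BoundedDerived k R),
    K.IsKProjective ∧ Nonempty (G.obj ≅ DerivedCategory.Q.obj K) ∧
    P = (ObjectProperty.singleton G).triangEnvelope ∧ (dgEnd k K).IsSmooth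

/-- A triangulated subcategory absorbs singularities if it is admissible and both of its
orthogonal complements are smooth and proper. -/
structure AbsorbsSingularities (P : ObjectProperty (BoundedDerived k R)) : Prop where
  isAdmissible : IsAdmissible P
  smooth_right : IsSmoothSubcategory k P.rightOrthogonal
  proper_right : IsProperSubcategory k P.rightOrthogonal
  smooth_left : IsSmoothSubcategory k P.leftOrthogonal
  proper_left : IsProperSubcategory k P.leftOrthogonal

end Absorption

namespace CyclicAlgebra

variable (k : Type u) [Field k] (r : ℕ) [NeZero r]

theorem isFinDim_simple (i : CyclicQuiver r) :
    isFinDim k (CyclicAlgebra k r)ᵐᵒᵖ (simple k r i) := by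
  let M := (ModuleCat.restrictScalars (algebraMap k (CyclicAlgebra k r)ᵐᵒᵖ)).obj (simple k r i)
  let f : k →ₗ[k] M :=
    { toFun := fun x => x
      map_add' := fun _ _ => rfl
      map_smul' := fun s x => by
        change s * x = character k r i (algebraMap k (CyclicAlgebra k r) s) * x
        rw [AlgHom.commutes]
        rfl }
  exact Module.Finite.of_surjective f fun x => ⟨x, rfl⟩

theorem isFinDim_proj (i : CyclicQuiver r) :
    isFinDim k (CyclicAlgebra k r)ᵐᵒᵖ (proj k r i) := by
  let M := (ModuleCat.restrictScalars (algebraMap k (CyclicAlgebra k r)ᵐᵒᵖ)).obj (proj k r i)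
  let f : CyclicAlgebra k r →ₗ[k] M :=
    { toFun := fun x => (⟨MulOpposite.op x • idem k r i,
        Submodule.smul_mem _ _ (Submodule.mem_span_singleton_self _)⟩ :
          Submodule.span (CyclicAlgebra k r)ᵐᵒᵖ {idem k r i})
      map_add' := fun x y => Subtype.ext (mul_add _ x y)
      map_smul' := fun s x => Subtype.ext <| by
        change idem k r i * (s • x) = (idem k r i * x) * algebraMap k (CyclicAlgebra k r) s
        rw [mul_smul_comm, ← Algebra.commutes, Algebra.smul_def] }
  refine Module.Finite.of_surjective f ?_
  rintro ⟨x, hx⟩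
  obtain ⟨y, rfl⟩ := Submodule.mem_span_singleton.1 hx
  exact ⟨y.unop, rfl⟩

variable [HasDerivedCategory.{w} (ModuleCat.{u} (CyclicAlgebra k r)ᵐᵒᵖ)]

/-- The simple module `S_i` as an object of the bounded derived category. -/
def simpleObj (i : CyclicQuiver r) : BoundedDerived k (CyclicAlgebra k r)ᵐᵒᵖ :=
  BoundedDerived.of k (simple k r i) (isFinDim_simple k r i)

/-- The projective module `P_i` as an object of the bounded derived category. -/
def projObj (i : CyclicQuiver r) : BoundedDerived k (CyclicAlgebra k r)ᵐᵒᵖ :=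
  BoundedDerived.of k (proj k r i) (isFinDim_proj k r i)

/-- The sequence `(S_{i+1}, …, S_{i-1})` of length `r - 1`. -/
def simpleSeq (i : CyclicQuiver r) (a : Fin (r - 1)) : BoundedDerived k (CyclicAlgebra k r)ᵐᵒᵖ :=
  simpleObj k r (i + 1 + ((a : ℕ) : CyclicQuiver r))

/-- The triangulated subcategory generated by `S_{i+1}, …, S_{i-1}`. -/
def absorbing (i : CyclicQuiver r) : ObjectProperty (BoundedDerived k (CyclicAlgebra k r)ᵐᵒᵖ) :=
  generatedBy (ObjectProperty.ofObj (simpleSeq k r i))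

end CyclicAlgebra

end

/-!
Every simple module has a two-periodic resolution `⋯ ⟶ P_{i+1} ⟶ P_i ⟶ P_{i+1} ⟶ P_i ⟶ S_i`, glued
from `0 ⟶ rad P_i ⟶ P_i ⟶ S_i ⟶ 0` and `0 ⟶ S_i ⟶ P_{i+1} ⟶ rad P_i ⟶ 0`. The class `θ` of the
period in `Ext²(S_i, S_i)` generates the Ext algebra freely as soon as `P_i ≠ P_{i+1}`, and the
homotopy colimit along `θ` vanishes because `θ` is zero on cohomology.

The radical of `P_i` is filtered by the simple modules other than `S_i`, so the two sequences show
that these together with `P_i`, or with `P_{i+1}`, generate everything. Hence there are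
semiorthogonal decompositions `⟨𝖲_i, ⟨P_i⟩⟩` and `⟨⟨P_{i+1}⟩, 𝖲_i⟩`. They make `𝖲_i` admissible and
identify its left and right orthogonal with `⟨P_i⟩` and `⟨P_{i+1}⟩`; these are smooth and proper
because a projective `P_j` has no self-extensions and only scalar endomorphisms.
-/

noncomputable section

instance leftOrthogonal_isStableUnderRetracts {T : Type w} [Category.{v} T] [HasZeroMorphisms T]
    (P : ObjectProperty T) : P.leftOrthogonal.IsStableUnderRetracts where
  of_retract r hY Z f hZ := by
    rw [← Category.id_comp f, ← r.retract, Category.assoc, hY (r.r ≫ f) hZ, comp_zero]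

section Generation

variable {T : Type w} [Category.{v} T] [HasShift T ℤ] [Preadditive T]
  [∀ n : ℤ, (shiftFunctor T n).Additive]

theorem shiftClosure_le_leftOrthogonal {P Q : ObjectProperty T}
    (h : ∀ X Y, P X → Q Y → ∀ (n : ℤ) (f : X ⟶ Y⟦n⟧), f = 0) :
    P.shiftClosure ℤ ≤ Q.leftOrthogonal := by
  rintro X ⟨X', n, e, hX'⟩ Y f hY
  obtain ⟨g, hg⟩ := ((shiftEquiv T n).toAdjunction.homEquiv _ _).symm.surjective (e.inv ≫ f)
  obtain rfl : g = 0 := h X' Y hX' hY _ g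
  have hf : e.inv ≫ f = 0 := hg.symm.trans <| (Adjunction.homEquiv_counit _ _ _ _).trans <|
    (congrArg (· ≫ _) ((shiftFunctor T n).map_zero _ _)).trans zero_comp
  rw [← cancel_epi e.inv, hf, comp_zero]

variable [HasZeroObject T] [Pretriangulated T]

instance generatedBy_isClosedUnderIsomorphisms (P : ObjectProperty T) :
    (generatedBy P).IsClosedUnderIsomorphisms where
  of_iso e h Q hQ hQ' hP := Q.prop_of_iso e (h Q hQ hQ' hP)

instance generatedBy_isTriangulated (P : ObjectProperty T) : (generatedBy P).IsTriangulated where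
  exists_zero := ⟨_, isZero_zero T, fun Q _ _ _ => Q.prop_of_isZero (isZero_zero T)⟩
  isStableUnderShiftBy a := ⟨fun _ h Q hQ hQ' hP => Q.le_shift a _ (h Q hQ hQ' hP)⟩
  ext₂' T hT h₁ h₃ := ObjectProperty.le_isoClosure _ _ fun Q hQ hQ' hP =>
    Q.ext_of_isTriangulatedClosed₂ T hT (h₁ Q hQ hQ' hP) (h₃ Q hQ hQ' hP)

theorem le_generatedBy (P : ObjectProperty T) : P ≤ generatedBy P :=
  fun _ hX _ _ _ hP => hP _ hX

theorem generatedBy_le {P Q : ObjectProperty T} [hQ : Q.IsTriangulated]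
    [hQ' : Q.IsClosedUnderIsomorphisms] (h : P ≤ Q) : generatedBy P ≤ Q :=
  fun _ hX => hX Q hQ hQ' h

theorem generatedBy_eq_triangEnvelope [IsTriangulated T] (P : ObjectProperty T) [P.Nonempty]
    [(generatedBy P).IsStableUnderRetracts] : generatedBy P = P.triangEnvelope :=
  le_antisymm (generatedBy_le P.le_triangEnvelope)
    (P.triangEnvelope_le_iff.2 (le_generatedBy P))

theorem generatedBy_le_rightOrthogonal_generatedBy {P Q : ObjectProperty T}
    (h : ∀ X Y, P X → Q Y → ∀ (n : ℤ) (f : X ⟶ Y⟦n⟧), f = 0) :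
    generatedBy Q ≤ (generatedBy P).rightOrthogonal := by
  have hQ : generatedBy Q ≤ (P.shiftClosure ℤ).rightOrthogonal :=
    generatedBy_le fun Y hY X f hX => shiftClosure_le_leftOrthogonal h X hX f hY
  have hP : generatedBy P ≤ (generatedBy Q).leftOrthogonal :=
    generatedBy_le fun X hX Y f hY => hQ Y hY f (P.le_shiftClosure X hX)
  exact fun Y hY X f hX => hP X hX f hY

end Generation

section Decomposition

variable {T : Type w} [Category.{v} T] [HasZeroObject T] [HasShift T ℤ] [Preadditive T]
  [∀ n : ℤ, (shiftFunctor T n).Additive] [Pretriangulated T] {P Q : ObjectProperty T}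

/-- A triangle whose connecting morphism vanishes by semiorthogonality splits, so its outer terms
may be exchanged. -/
theorem extensionProduct_le_extensionProduct_of_le_rightOrthogonal [Q.IsStableUnderShift ℤ]
    (hPQ : Q ≤ P.rightOrthogonal) :
    Q.extensionProduct P ≤ P.extensionProduct Q := by
  rintro X ⟨B, A, f, g, δ, hT, hB, hA⟩
  have hδ : δ = 0 := hPQ _ (Q.le_shift (1 : ℤ) _ hB) δ hA
  obtain ⟨e, -, -⟩ := exists_iso_binaryBiproduct_of_distTriang _ hT hδ
  exact ObjectProperty.prop_of_iso _ (biprod.braiding A B ≪≫ e.symm)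
    ⟨A, B, _, _, _, binaryBiproductTriangle_distinguished A B, hA, hB⟩

theorem extensionProduct_isTriangulated [IsTriangulated T] [P.IsTriangulated]
    [P.IsClosedUnderIsomorphisms] [Q.IsTriangulated] [Q.IsClosedUnderIsomorphisms]
    (hPQ : Q ≤ P.rightOrthogonal) : (P.extensionProduct Q).IsTriangulated where
  exists_zero := ⟨_, isZero_zero T, ObjectProperty.le_extensionProduct_left (Q := Q) _
    (P.prop_of_isZero (isZero_zero T))⟩
  ext₂' S hS h₁ h₃ := by
    have hP : P.extensionProduct P ≤ P :=
      ObjectProperty.extensionProduct_le_of_isTriangulatedClosed₂ le_rfl le_rfl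
    have hQ : Q.extensionProduct Q ≤ Q :=
      ObjectProperty.extensionProduct_le_of_isTriangulatedClosed₂ le_rfl le_rfl
    suffices h : (P.extensionProduct Q).extensionProduct (P.extensionProduct Q) ≤
        P.extensionProduct Q from
      ObjectProperty.le_isoClosure _ _ (h _ ⟨_, _, _, _, _, hS, h₁, h₃⟩)
    calc (P.extensionProduct Q).extensionProduct (P.extensionProduct Q)
        = P.extensionProduct ((Q.extensionProduct P).extensionProduct Q) := by
          simp only [ObjectProperty.extensionProduct_assoc]
      _ ≤ P.extensionProduct ((P.extensionProduct Q).extensionProduct Q) :=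
          ObjectProperty.monotone_extensionProduct_right _
            (ObjectProperty.monotone_extensionProduct_left _
              (extensionProduct_le_extensionProduct_of_le_rightOrthogonal hPQ))
      _ = (P.extensionProduct P).extensionProduct (Q.extensionProduct Q) := by
          simp only [ObjectProperty.extensionProduct_assoc]
      _ ≤ P.extensionProduct (Q.extensionProduct Q) :=
          ObjectProperty.monotone_extensionProduct_left _ hP
      _ ≤ P.extensionProduct Q := ObjectProperty.monotone_extensionProduct_right _ hQ

namespace IsSemiorthogonalDecomposition

theorem of_generators (h : ∀ X Y, P X → Q Y → ∀ (n : ℤ) (f : X ⟶ Y⟦n⟧), f = 0)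
    (hgen : generatedBy (P ⊔ Q) = ⊤) :
    IsSemiorthogonalDecomposition ![generatedBy Q, generatedBy P] where
  isTriangulated := Fin.forall_fin_two.2
    ⟨generatedBy_isTriangulated Q, generatedBy_isTriangulated P⟩
  isClosedUnderIsomorphisms := Fin.forall_fin_two.2
    ⟨generatedBy_isClosedUnderIsomorphisms Q, generatedBy_isClosedUnderIsomorphisms P⟩
  semiorthogonal a b hab := by
    obtain ⟨rfl, rfl⟩ : a = 0 ∧ b = 1 := by decide +revert
    exact generatedBy_le_rightOrthogonal_generatedBy h
  generate := by
    rw [eq_top_iff, ← hgen]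
    exact generatedBy_le (sup_le
      ((le_generatedBy P).trans ((le_iSup (![generatedBy Q, generatedBy P]) 1).trans
        (le_generatedBy _)))
      ((le_generatedBy Q).trans ((le_iSup (![generatedBy Q, generatedBy P]) 0).trans
        (le_generatedBy _))))

variable (h : IsSemiorthogonalDecomposition ![Q, P])

include h

theorem le_rightOrthogonal : Q ≤ P.rightOrthogonal := h.semiorthogonal 0 1 Fin.zero_lt_one

theorem isTriangulated_left : Q.IsTriangulated := h.isTriangulated 0

theorem isTriangulated_right : P.IsTriangulated := h.isTriangulated 1

variable [IsTriangulated T]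

theorem extensionProduct_eq_top : P.extensionProduct Q = ⊤ := by
  have := h.isTriangulated_left
  have := h.isTriangulated_right
  have : Q.IsClosedUnderIsomorphisms := h.isClosedUnderIsomorphisms 0
  have : P.IsClosedUnderIsomorphisms := h.isClosedUnderIsomorphisms 1
  have := extensionProduct_isTriangulated h.le_rightOrthogonal
  rw [eq_top_iff, ← h.generate]
  exact generatedBy_le (iSup_le (Fin.forall_fin_two.2
    ⟨ObjectProperty.le_extensionProduct_right P, ObjectProperty.le_extensionProduct_left Q⟩))

theorem exists_distTriang (X : T) : ∃ (A B : T) (f : A ⟶ X) (g : X ⟶ B) (δ : B ⟶ A⟦(1 : ℤ)⟧),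
    Triangle.mk f g δ ∈ distTriang T ∧ P A ∧ Q B := by
  have hX : P.extensionProduct Q X := h.extensionProduct_eq_top ▸ trivial
  exact hX

theorem leftOrthogonal_eq : Q.leftOrthogonal = P := by
  have := h.isTriangulated_left
  have := h.isTriangulated_right
  have : P.IsClosedUnderIsomorphisms := h.isClosedUnderIsomorphisms 1
  refine le_antisymm (fun X hX => ?_) fun X hX Y f hY => h.le_rightOrthogonal _ hY f hX
  obtain ⟨A, B, f, g, δ, hT, hA, hB⟩ := h.exists_distTriang X
  -- `B` is left orthogonal to itself, being the cone of a morphism of objects that are.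
  have hB' : Q.leftOrthogonal B := Q.leftOrthogonal.ext_of_isTriangulatedClosed₃ _ hT
    (fun _ f hY => h.le_rightOrthogonal _ hY f hA) hX
  exact P.ext_of_isTriangulatedClosed₂ _ hT hA
    (P.prop_of_isZero ((IsZero.iff_id_eq_zero _).2 (hB' _ hB)))

theorem rightOrthogonal_eq : P.rightOrthogonal = Q := by
  have := h.isTriangulated_left
  have := h.isTriangulated_right
  have : Q.IsClosedUnderIsomorphisms := h.isClosedUnderIsomorphisms 0
  refine le_antisymm (fun X hX => ?_) h.le_rightOrthogonal
  obtain ⟨A, B, f, g, δ, hT, hA, hB⟩ := h.exists_distTriang X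
  have hA' : P.rightOrthogonal A := P.rightOrthogonal.ext_of_isTriangulatedClosed₁ _ hT hX
    (h.le_rightOrthogonal _ hB)
  exact Q.ext_of_isTriangulatedClosed₂ _ hT
    (Q.prop_of_isZero ((IsZero.iff_id_eq_zero _).2 (hA' _ hA))) hB

theorem isRightAdjoint_ι : Q.ι.IsRightAdjoint := by
  have := h.isTriangulated_right
  choose A B f g δ hT hA hB using h.exists_distTriang
  have hg (X : T) : P.trW (g X) := ObjectProperty.trW.mk' P (hT X) (hA X)
  have hQ (Y : Q.FullSubcategory) : P.trW.isLocal Y.obj :=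
    P.isLocal_trW ▸ h.le_rightOrthogonal _ Y.property
  exact ⟨_, ⟨Adjunction.adjunctionOfEquivLeft (G := Q.ι) (F_obj := fun X => ⟨B X, hB X⟩)
    (fun X Y => Q.fullyFaithfulι.homEquiv.trans (Equiv.ofBijective _ (hQ Y _ (hg X))))
    (fun _ _ _ _ _ => (Category.assoc _ _ _).symm)⟩⟩

theorem isLeftAdjoint_ι : P.ι.IsLeftAdjoint := by
  have := h.isTriangulated_left
  choose A B f g δ hT hA hB using h.exists_distTriang
  have hf (X : T) : Q.trW (f X) := ObjectProperty.trW.mk Q (hT X) (hB X)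
  have hP (Y : P.FullSubcategory) : Q.trW.isColocal Y.obj :=
    Q.isColocal_trW ▸ fun _ f hZ => h.le_rightOrthogonal _ hZ f Y.property
  let e (Y : P.FullSubcategory) (X : T) : (Y ⟶ ⟨A X, hA X⟩) ≃ (Y.obj ⟶ X) :=
    P.fullyFaithfulι.homEquiv.trans (Equiv.ofBijective _ (hP Y _ (hf X)))
  exact ⟨_, ⟨Adjunction.adjunctionOfEquivRight (F := P.ι) (fun Y X => (e Y X).symm)
    fun Y' Y X φ ψ => (e Y' X).symm_apply_eq.2 <|
      (congrArg (φ.hom ≫ ·) ((e Y X).apply_symm_apply ψ).symm).trans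
        (Category.assoc _ _ _).symm⟩⟩

end IsSemiorthogonalDecomposition

end Decomposition

section PeriodicResolution

variable {T : Type w} [Category.{v} T] [HasZeroObject T] [HasShift T ℤ] [Preadditive T]
  [∀ n : ℤ, (shiftFunctor T n).Additive] [Pretriangulated T]

section

variable {X Y Z W : T} {f : X ⟶ Y} {g : Y ⟶ Z} {h : ShiftedHom Z X (1 : ℤ)}

theorem exists_eq_mor₃_comp_shiftedHom (hT : Triangle.mk f g h ∈ distTriang T) {m n : ℤ}
    (hmn : m + 1 = n) (φ : ShiftedHom Z W n) (hφ : g ≫ φ = 0) :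
    ∃ ψ : ShiftedHom X W m, φ = h.comp ψ hmn := by
  obtain ⟨ψ, hψ⟩ : ∃ ψ : X⟦(1 : ℤ)⟧ ⟶ W⟦n⟧, φ = h ≫ ψ := Triangle.yoneda_exact₃ _ hT φ hφ
  obtain ⟨χ, hχ⟩ := (shiftFunctor T (1 : ℤ)).map_surjective
    (ψ ≫ (shiftFunctorAdd' T m 1 n hmn).hom.app W)
  refine ⟨χ, ?_⟩
  rw [ShiftedHom.comp, hχ, Category.assoc, Iso.hom_inv_id_app, Category.comp_id, hψ]

theorem exists_eq_mor₁_comp_of_mor₃_comp_eq_zero (hT : Triangle.mk f g h ∈ distTriang T)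
    {m n : ℤ} (hmn : m + 1 = n) (φ : ShiftedHom X W m) (hφ : h.comp φ hmn = 0) :
    ∃ ψ : ShiftedHom Y W m, φ = f ≫ ψ := by
  have hφ' : h ≫ φ⟦(1 : ℤ)⟧' = 0 := by
    rw [ShiftedHom.comp, ← Category.assoc] at hφ
    rw [← cancel_mono ((shiftFunctorAdd' T m 1 n hmn).inv.app W), hφ, zero_comp]
  obtain ⟨ψ, hψ⟩ : ∃ ψ : Y⟦(1 : ℤ)⟧ ⟶ (W⟦m⟧)⟦(1 : ℤ)⟧, φ⟦(1 : ℤ)⟧' = (-f⟦(1 : ℤ)⟧') ≫ ψ :=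
    Triangle.yoneda_exact₃ _ (rot_of_distTriang _ hT) _ hφ'
  obtain ⟨χ, rfl⟩ := (shiftFunctor T (1 : ℤ)).map_surjective ψ
  refine ⟨-χ, (shiftFunctor T (1 : ℤ)).map_injective (hψ.trans ?_)⟩
  rw [Functor.map_comp, Functor.map_neg, Preadditive.comp_neg, Preadditive.neg_comp]

theorem mor₃_comp_mor₁_comp (hT : Triangle.mk f g h ∈ distTriang T) {m n : ℤ} (hmn : m + 1 = n)
    (ψ : ShiftedHom Y W m) : h.comp (show ShiftedHom X W m from f ≫ ψ) hmn = 0 := by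
  have hf : h ≫ f⟦(1 : ℤ)⟧' = 0 := comp_distTriang_mor_zero₃₁ _ hT
  rw [ShiftedHom.comp, Functor.map_comp, Category.assoc, reassoc_of% hf, zero_comp]

end

/-- A two-periodic resolution `⋯ ⟶ P' ⟶ P ⟶ P' ⟶ P ⟶ S`, given by distinguished triangles
`M ⟶ P ⟶ S ⟶ M⟦1⟧` and `S ⟶ P' ⟶ M ⟶ S⟦1⟧` through the first syzygy `M`. -/
structure PeriodicResolution (S P P' : T) where
  /-- The first syzygy. -/
  M : T
  i : M ⟶ P
  p : P ⟶ S
  α : ShiftedHom S M (1 : ℤ)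
  j : S ⟶ P'
  q : P' ⟶ M
  β : ShiftedHom M S (1 : ℤ)
  distinguished : Triangle.mk i p α ∈ distTriang T
  distinguished' : Triangle.mk j q β ∈ distTriang T

namespace PeriodicResolution

variable {S P P' : T} (R : PeriodicResolution S P P')

/-- The degree two self-extension of `S` which shifts the resolution by a period. -/
def θ : ShiftedHom S S (2 : ℤ) := R.α.comp R.β rfl

/-- A dimension shift by the period lowers the degree by two, until it is negative. -/
theorem hom_eq_zero {N : T} (hN : ∀ n : ℤ, Function.Bijective fun φ : P ⟶ N⟦n⟧ => (R.q ≫ R.i) ≫ φ)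
    (hneg : ∀ n : ℤ, n < 0 → ∀ φ : S ⟶ N⟦n⟧, φ = 0) (n : ℤ) (φ : S ⟶ N⟦n⟧) : φ = 0 := by
  suffices H : ∀ (m : ℕ) (n : ℤ), n < m → ∀ φ : S ⟶ N⟦n⟧, φ = 0 from
    H (n.toNat + 1) n (by push_cast; omega) φ
  clear φ n
  intro m
  induction m with
  | zero => exact fun n hn => hneg n (by exact_mod_cast hn)
  | succ m ih =>
    intro n hn φ
    have hip : R.i ≫ R.p = 0 := comp_distTriang_mor_zero₁₂ _ R.distinguished
    have hpφ : R.p ≫ φ = 0 := (hN n).1 (by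
      simp only [Category.assoc, comp_zero, reassoc_of% hip, zero_comp])
    obtain ⟨g, rfl⟩ := exists_eq_mor₃_comp_shiftedHom R.distinguished (sub_add_cancel n 1) φ hpφ
    obtain ⟨χ, hχ⟩ := (hN (n - 1)).2 (R.q ≫ g)
    have hq : R.q ≫ (g - R.i ≫ χ) = 0 := by
      rw [Preadditive.comp_sub, ← Category.assoc, sub_eq_zero]
      exact hχ.symm
    obtain ⟨ψ, hψ⟩ :=
      exists_eq_mor₃_comp_shiftedHom R.distinguished' (sub_add_cancel (n - 1) 1) _ hq
    rw [ih (n - 1 - 1) (by push_cast at hn; omega) ψ, ShiftedHom.comp_zero, sub_eq_zero] at hψ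
    rw [hψ]
    exact mor₃_comp_mor₁_comp R.distinguished _ χ

theorem θ_comp {m n : ℤ} (hmn : m + 2 = n) (φ : ShiftedHom S S m) :
    R.θ.comp φ hmn = R.α.comp (R.β.comp φ rfl) (by omega) :=
  ShiftedHom.comp_assoc _ _ _ _ _ (by omega)

section

variable (hP' : ∀ (n : ℤ) (φ : P' ⟶ S⟦n⟧), φ = 0)
  (hP : ∀ n : ℤ, n ≠ 0 → ∀ φ : P ⟶ S⟦n⟧, φ = 0)

include hP' hP

theorem eq_zero_of_θ_comp_eq_zero {m n : ℤ} (hmn : m + 2 = n) (hm : 0 ≤ m)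
    (φ : ShiftedHom S S m) (hφ : R.θ.comp φ hmn = 0) : φ = 0 := by
  rw [θ_comp] at hφ
  obtain ⟨ψ, hψ⟩ := exists_eq_mor₁_comp_of_mor₃_comp_eq_zero R.distinguished _ _ hφ
  rw [hP _ (by omega) ψ, comp_zero] at hψ
  obtain ⟨χ, hχ⟩ := exists_eq_mor₁_comp_of_mor₃_comp_eq_zero R.distinguished' _ _ hψ
  rw [hχ, hP' _ χ, comp_zero]

theorem exists_eq_θ_comp {m n : ℤ} (hmn : m + 2 = n) (hn : n ≠ 0)
    (φ : ShiftedHom S S n) : ∃ χ : ShiftedHom S S m, φ = R.θ.comp χ hmn := by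
  obtain ⟨ψ, rfl⟩ := exists_eq_mor₃_comp_shiftedHom R.distinguished (m := m + 1) (by omega) φ
    (hP _ hn _)
  obtain ⟨χ, rfl⟩ := exists_eq_mor₃_comp_shiftedHom R.distinguished' (m := m) rfl ψ (hP' _ _)
  exact ⟨χ, (R.θ_comp hmn χ).symm⟩

end

end PeriodicResolution

end PeriodicResolution

section PolynomialExt

variable {C : Type w} [Category.{v} C] [Preadditive C] [HasShift C ℤ]
  [∀ n : ℤ, (shiftFunctor C n).Additive]

namespace ExtAlgebra

variable {S : C} {q : ℤ} (θ : ShiftedHom S S q)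

theorem of_comp_eq_mul {m n : ℤ} (hmn : m + q = n) (φ : ShiftedHom S S m) :
    DirectSum.of (fun n : ℤ => ShiftedHom S S n) n (θ.comp φ hmn) =
      (DirectSum.of (fun n : ℤ => ShiftedHom S S n) m φ : ExtAlgebra S) *
        DirectSum.of (fun n : ℤ => ShiftedHom S S n) q θ := by
  subst hmn
  rw [DirectSum.of_mul_of, shiftedHom_mul_def]

theorem mul_of_apply (x : ExtAlgebra S) (m n : ℤ) (hmn : m + q = n) :
    (x * DirectSum.of (fun n : ℤ => ShiftedHom S S n) q θ) n = θ.comp (x m) hmn := by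
  induction x using DirectSum.induction_on with
  | zero => rw [zero_mul, DirectSum.zero_apply, DirectSum.zero_apply, ShiftedHom.comp_zero]
  | add x y hx hy =>
    rw [add_mul, DirectSum.add_apply, DirectSum.add_apply, ShiftedHom.comp_add, hx, hy]
  | of l f =>
    rw [← of_comp_eq_mul θ rfl]
    by_cases hl : l = m
    · subst hl hmn
      rw [DirectSum.of_eq_same, DirectSum.of_eq_same]
    · rw [DirectSum.of_eq_of_ne _ _ _ (by omega), DirectSum.of_eq_of_ne _ _ _ (Ne.symm hl),
        ShiftedHom.comp_zero]

section Injective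

variable {θ} (hneg : ∀ n : ℤ, n < 0 → ∀ φ : ShiftedHom S S n, φ = 0)

include hneg

theorem eq_zero_of_mul_of_eq_zero
    (hθ : ∀ (m n : ℤ) (hmn : m + q = n), 0 ≤ m → ∀ φ : ShiftedHom S S m,
      θ.comp φ hmn = 0 → φ = 0)
    {x : ExtAlgebra S} (hx : x * DirectSum.of (fun n : ℤ => ShiftedHom S S n) q θ = 0) :
    x = 0 := by
  refine DFinsupp.ext fun n => ?_
  obtain hn | hn := lt_or_ge n 0
  · exact hneg n hn _
  · refine hθ n _ rfl hn _ ?_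
    rw [← mul_of_apply, hx, DirectSum.zero_apply]

variable (k : Type u) [Field k] [Linear k C] [∀ n : ℤ, (shiftFunctor C n).Linear k]

theorem coeff_zero_eq_zero_of_aeval_eq_zero (hS : 𝟙 S ≠ 0) (hq : 0 < q) {p : Polynomial k}
    (hp : Polynomial.aeval
      (DirectSum.of (fun n : ℤ => ShiftedHom S S n) q θ : ExtAlgebra S) p = 0) :
    p.coeff 0 = 0 := by
  rw [← Polynomial.divX_mul_X_add p, map_add, map_mul, Polynomial.aeval_X,
    Polynomial.aeval_C, Algebra.algebraMap_eq_smul_one] at hp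
  have hp₀ := congrArg (fun x : ExtAlgebra S => x 0) hp
  dsimp only at hp₀
  rw [DirectSum.add_apply, mul_of_apply θ _ (-q) 0 (neg_add_cancel q),
    hneg _ (neg_neg_of_pos hq) (DFunLike.coe _ _),
    ShiftedHom.comp_zero, zero_add, DirectSum.smul_apply,
    show (1 : ExtAlgebra S) = DirectSum.of _ 0 (ShiftedHom.mk₀ 0 rfl (𝟙 S)) from rfl,
    DirectSum.of_eq_same, DirectSum.zero_apply, smul_eq_zero] at hp₀
  exact hp₀.resolve_right fun h =>
    hS ((ShiftedHom.homEquiv (0 : ℤ) rfl).injective (h.trans (ShiftedHom.mk₀_zero _ _ _ _).symm))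

theorem aeval_injective (hS : 𝟙 S ≠ 0) (hq : 0 < q)
    (hθ : ∀ (m n : ℤ) (hmn : m + q = n), 0 ≤ m → ∀ φ : ShiftedHom S S m,
      θ.comp φ hmn = 0 → φ = 0) :
    Function.Injective (Polynomial.aeval (R := k)
      (DirectSum.of (fun n : ℤ => ShiftedHom S S n) q θ : ExtAlgebra S)) := by
  rw [injective_iff_map_eq_zero]
  suffices H : ∀ (n : ℕ) (p : Polynomial k), Polynomial.aeval
      (DirectSum.of (fun n : ℤ => ShiftedHom S S n) q θ : ExtAlgebra S) p = 0 → p.coeff n = 0 from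
    fun p hp => Polynomial.ext fun n => (H n p hp).trans (Polynomial.coeff_zero n).symm
  intro n
  induction n with
  | zero => exact fun p hp => coeff_zero_eq_zero_of_aeval_eq_zero hneg k hS hq hp
  | succ n ih =>
    intro p hp
    have h₀ := coeff_zero_eq_zero_of_aeval_eq_zero hneg k hS hq hp
    rw [← Polynomial.divX_mul_X_add p, h₀, map_zero, add_zero, map_mul, Polynomial.aeval_X] at hp
    rw [← Polynomial.coeff_divX]
    exact ih _ (eq_zero_of_mul_of_eq_zero hneg hθ hp)

end Injective

theorem aeval_surjective (k : Type u) [Field k] [Linear k C] [∀ n : ℤ, (shiftFunctor C n).Linear k]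
    {θ : ShiftedHom S S q} (hq : 0 < q)
    (hlow : ∀ n : ℤ, n < q → n ≠ 0 → ∀ φ : ShiftedHom S S n, φ = 0)
    (hzero : ∀ φ : S ⟶ S, ∃ c : k, φ = c • 𝟙 S)
    (hθ : ∀ (m n : ℤ) (hmn : m + q = n), 0 ≤ m → ∀ φ : ShiftedHom S S n,
      ∃ ψ, φ = θ.comp ψ hmn) :
    Function.Surjective (Polynomial.aeval (R := k)
      (DirectSum.of (fun n : ℤ => ShiftedHom S S n) q θ : ExtAlgebra S)) := by
  set A := (Polynomial.aeval (R := k)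
    (DirectSum.of (fun n : ℤ => ShiftedHom S S n) q θ : ExtAlgebra S)).range
  suffices H : ∀ (m : ℕ) (n : ℤ), n < m → ∀ φ : ShiftedHom S S n,
      DirectSum.of (fun n : ℤ => ShiftedHom S S n) n φ ∈ A by
    intro x
    change x ∈ A
    induction x using DirectSum.induction_on with
    | zero => exact zero_mem _
    | add x y hx hy => exact add_mem hx hy
    | of n φ => exact H (n.toNat + 1) n (by push_cast; omega) φ
  intro m
  induction m with
  | zero =>
    intro n hn φ
    rw [hlow n (by push_cast at hn; omega) (by push_cast at hn; omega) φ, map_zero]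
    exact zero_mem _
  | succ m ih =>
    intro n hn φ
    obtain hn' | hn' := lt_or_ge n q
    · obtain rfl | hn₀ := eq_or_ne n 0
      · obtain ⟨f, rfl⟩ := (ShiftedHom.homEquiv (0 : ℤ) rfl).surjective φ
        obtain ⟨c, rfl⟩ := hzero f
        rw [ShiftedHom.homEquiv_apply, ShiftedHom.mk₀_smul, DirectSum.of_smul]
        exact Subalgebra.smul_mem _ (one_mem _) c
      · rw [hlow n hn' hn₀ φ, map_zero]
        exact zero_mem _
    · obtain ⟨ψ, rfl⟩ := hθ (n - q) n (by omega) (by omega) φ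
      rw [of_comp_eq_mul]
      exact mul_mem (ih (n - q) (by push_cast at hn; omega) ψ)
        ⟨Polynomial.X, Polynomial.aeval_X _⟩

end ExtAlgebra

end PolynomialExt

section Proper

theorem moduleFinite_of_exact {k V₁ V₂ V₃ : Type*} [Ring k] [IsNoetherianRing k] [AddCommGroup V₁]
    [AddCommGroup V₂] [AddCommGroup V₃] [Module k V₁] [Module k V₂] [Module k V₃]
    [Module.Finite k V₁] [Module.Finite k V₃] {f : V₁ →ₗ[k] V₂} {g : V₂ →ₗ[k] V₃}
    (h : Function.Exact f g) : Module.Finite k V₂ := by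
  refine Module.Finite.of_exact (f := f) (g := g.rangeRestrict) (fun x => ?_)
    g.surjective_rangeRestrict
  rw [← h x, Subtype.ext_iff]
  rfl

variable {T : Type w} [Category.{v} T] [HasShift T ℤ] [Preadditive T] (k : Type u) [Field k]
  [Linear k T]

/-- The total space of morphisms from `X` to the shifts of `Y` is finite dimensional. -/
def HasFiniteTotalHom (X Y : T) : Prop :=
  (∀ n : ℤ, Module.Finite k (X ⟶ Y⟦n⟧)) ∧ ∃ N : ℕ, ∀ n : ℤ, N < n.natAbs → ∀ f : X ⟶ Y⟦n⟧, f = 0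

namespace HasFiniteTotalHom

variable {k}

theorem finite {X Y : T} (h : HasFiniteTotalHom k X Y) :
    Module.Finite k (⨁ n : ℤ, ShiftedHom X Y n) := by
  obtain ⟨h, N, hN⟩ := h
  have : ∀ n : ℤ, Module.Finite k (ShiftedHom X Y n) := h
  let s : Finset ℤ := Finset.Icc (-N) N
  let φ : (∀ n : s, ShiftedHom X Y n.1) →ₗ[k] ⨁ n : ℤ, ShiftedHom X Y n :=
    ∑ n : s, (DirectSum.lof k ℤ (fun n => ShiftedHom X Y n) n.1).comp (LinearMap.proj n)
  refine Module.Finite.of_surjective φ fun x => ?_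
  change x ∈ LinearMap.range φ
  induction x using DirectSum.induction_on with
  | zero => exact zero_mem _
  | add x y hx hy => exact add_mem hx hy
  | of n f =>
    by_cases hn : N < n.natAbs
    · rw [hN n hn f, map_zero]
      exact zero_mem _
    · have hs : n ∈ s := by
        rw [Finset.mem_Icc]
        omega
      refine ⟨Pi.single ⟨n, hs⟩ f, ?_⟩
      rw [LinearMap.sum_apply, Finset.sum_eq_single ⟨n, hs⟩]
      · simp [DirectSum.lof_eq_of]
      · intro b _ hb
        simp [Pi.single_eq_of_ne hb]
      · simp

theorem of_surjective {X Y X' Y' : T} (a : ℤ) (h : HasFiniteTotalHom k X Y)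
    (H : ∀ m n : ℤ, m = n + a → ∃ φ : (X ⟶ Y⟦m⟧) →ₗ[k] (X' ⟶ Y'⟦n⟧), Function.Surjective φ) :
    HasFiniteTotalHom k X' Y' := by
  obtain ⟨h, N, hN⟩ := h
  choose φ hφ using fun n => H (n + a) n rfl
  refine ⟨fun n => ?_, N + a.natAbs, fun n hn f => ?_⟩
  · have := h (n + a)
    exact Module.Finite.of_surjective (φ n) (hφ n)
  · obtain ⟨g, rfl⟩ := hφ n f
    rw [hN (n + a) (by omega) g, map_zero]

theorem of_exact {X₁ Y₁ X₂ Y₂ X₃ Y₃ : T}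
    (h₁ : HasFiniteTotalHom k X₁ Y₁) (h₃ : HasFiniteTotalHom k X₃ Y₃)
    (H : ∀ n : ℤ, ∃ (f : (X₁ ⟶ Y₁⟦n⟧) →ₗ[k] (X₂ ⟶ Y₂⟦n⟧))
      (g : (X₂ ⟶ Y₂⟦n⟧) →ₗ[k] (X₃ ⟶ Y₃⟦n⟧)), Function.Exact f g) :
    HasFiniteTotalHom k X₂ Y₂ := by
  obtain ⟨h₁, N, hN⟩ := h₁
  obtain ⟨h₃, N', hN'⟩ := h₃
  choose f g hfg using H
  refine ⟨fun n => ?_, max N N', fun n hn φ => ?_⟩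
  · have := h₁ n
    have := h₃ n
    exact moduleFinite_of_exact (hfg n)
  · obtain ⟨ψ, rfl⟩ := (hfg n φ).1 (hN' n (by omega) _)
    rw [hN n (by omega) ψ, map_zero]

theorem of_isZero_left {X Y : T} (hX : IsZero X) : HasFiniteTotalHom k X Y :=
  ⟨fun n => have : Subsingleton (X ⟶ Y⟦n⟧) := ⟨hX.eq_of_src⟩; inferInstance,
    0, fun _ _ f => hX.eq_of_src f 0⟩

theorem of_iso_left {X X' Y : T} (h : HasFiniteTotalHom k X Y) (e : X ≅ X') :
    HasFiniteTotalHom k X' Y :=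
  h.of_surjective 0 fun m n hmn => by
    obtain rfl : m = n := by omega
    exact ⟨Linear.leftComp k (Y⟦m⟧) e.inv, fun f => ⟨e.hom ≫ f, e.inv_hom_id_assoc f⟩⟩

theorem of_iso_right {X Y Y' : T} (h : HasFiniteTotalHom k X Y) (e : Y ≅ Y') :
    HasFiniteTotalHom k X Y' :=
  h.of_surjective 0 fun m n hmn => by
    obtain rfl : m = n := by omega
    let e' := (shiftFunctor T m).mapIso e
    exact ⟨Linear.rightComp k X e'.hom, fun f =>
      ⟨f ≫ e'.inv, (Category.assoc _ _ _).trans (by rw [e'.inv_hom_id, Category.comp_id])⟩⟩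

theorem shift_right {X Y : T} (h : HasFiniteTotalHom k X Y) (a : ℤ) :
    HasFiniteTotalHom k X (Y⟦a⟧) :=
  h.of_surjective a fun m n hmn => by
    let e : Y⟦m⟧ ≅ (Y⟦a⟧)⟦n⟧ := (shiftFunctorAdd' T a n m (by omega)).app Y
    exact ⟨Linear.rightComp k X e.hom, fun f =>
      ⟨f ≫ e.inv, (Category.assoc _ _ _).trans (by rw [e.inv_hom_id, Category.comp_id])⟩⟩

variable [∀ n : ℤ, (shiftFunctor T n).Additive]

theorem shift_left [∀ n : ℤ, (shiftFunctor T n).Linear k] {X Y : T}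
    (h : HasFiniteTotalHom k X Y) (a : ℤ) : HasFiniteTotalHom k (X⟦a⟧) Y :=
  h.of_surjective (-a) fun m n hmn => by
    let e := (shiftFunctorAdd' T m a n (by omega)).app Y
    refine ⟨(Linear.rightComp k (X⟦a⟧) e.inv).comp ((shiftFunctor T a).mapLinearMap k),
      fun f => ?_⟩
    obtain ⟨g, hg⟩ := (shiftFunctor T a).map_surjective (f ≫ e.hom)
    refine ⟨g, ?_⟩
    change (shiftFunctor T a).map g ≫ e.inv = f
    rw [hg, Category.assoc, e.hom_inv_id, Category.comp_id]

theorem of_isZero_right {X Y : T} (hY : IsZero Y) : HasFiniteTotalHom k X Y :=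
  have hY (n : ℤ) : IsZero (Y⟦n⟧) := (shiftFunctor T n).map_isZero hY
  ⟨fun n => have : Subsingleton (X ⟶ Y⟦n⟧) := ⟨(hY n).eq_of_tgt⟩; inferInstance,
    0, fun n _ f => (hY n).eq_of_tgt f 0⟩

variable [HasZeroObject T] [Pretriangulated T]

theorem of_distTriang_left {Y : T} {S : Triangle T} (hS : S ∈ distTriang T)
    (h₁ : HasFiniteTotalHom k S.obj₁ Y) (h₃ : HasFiniteTotalHom k S.obj₃ Y) :
    HasFiniteTotalHom k S.obj₂ Y := by
  refine of_exact h₃ h₁ fun n =>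
    ⟨Linear.leftComp k (Y⟦n⟧) S.mor₂, Linear.leftComp k (Y⟦n⟧) S.mor₁, fun φ => ⟨fun hφ => ?_, ?_⟩⟩
  · obtain ⟨ψ, rfl⟩ := Triangle.yoneda_exact₂ S hS φ hφ
    exact ⟨ψ, rfl⟩
  · rintro ⟨ψ, rfl⟩
    change S.mor₁ ≫ S.mor₂ ≫ ψ = 0
    rw [comp_distTriang_mor_zero₁₂_assoc _ hS, zero_comp]

theorem of_distTriang_right {X : T} {S : Triangle T} (hS : S ∈ distTriang T)
    (h₁ : HasFiniteTotalHom k X S.obj₁) (h₃ : HasFiniteTotalHom k X S.obj₃) :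
    HasFiniteTotalHom k X S.obj₂ := by
  refine of_exact h₁ h₃ fun n => ⟨Linear.rightComp k X (S.mor₁⟦n⟧'),
    Linear.rightComp k X (S.mor₂⟦n⟧'), fun φ => ⟨fun hφ => ?_, ?_⟩⟩
  · have hφ : φ ≫ S.mor₂⟦n⟧' = 0 := hφ
    obtain ⟨ψ, hψ⟩ : ∃ ψ : X ⟶ S.obj₁⟦n⟧, φ = ψ ≫ (n.negOnePow • S.mor₁⟦n⟧') :=
      Triangle.coyoneda_exact₂ _ (Triangle.shift_distinguished S hS n) φ
        (show φ ≫ (n.negOnePow • S.mor₂⟦n⟧') = 0 by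
          rw [Linear.comp_units_smul, hφ, smul_zero])
    exact ⟨n.negOnePow • ψ, by
      rw [hψ, Linear.comp_units_smul]
      exact Linear.units_smul_comp _ _ _⟩
  · rintro ⟨ψ, rfl⟩
    change (ψ ≫ S.mor₁⟦n⟧') ≫ S.mor₂⟦n⟧' = 0
    rw [Category.assoc, ← Functor.map_comp, comp_distTriang_mor_zero₁₂ _ hS,
      Functor.map_zero, comp_zero]

theorem generatedBy_left [∀ n : ℤ, (shiftFunctor T n).Linear k] {P : ObjectProperty T} {Y : T}
    (h : ∀ X, P X → HasFiniteTotalHom k X Y) (X : T) (hX : generatedBy P X) :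
    HasFiniteTotalHom k X Y := by
  let Q : ObjectProperty T := fun X => HasFiniteTotalHom k X Y
  have hQ : Q.IsClosedUnderIsomorphisms := ⟨fun e h => h.of_iso_left e⟩
  have hQ' : Q.IsTriangulated :=
    { exists_zero := ⟨_, isZero_zero T, of_isZero_left (isZero_zero T)⟩
      isStableUnderShiftBy := fun a => ⟨fun _ h => h.shift_left a⟩
      ext₂' := fun _ hS h₁ h₃ => ObjectProperty.le_isoClosure _ _ (of_distTriang_left hS h₁ h₃) }
  exact generatedBy_le (Q := Q) h X hX

theorem generatedBy_right {P : ObjectProperty T} {X : T}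
    (h : ∀ Y, P Y → HasFiniteTotalHom k X Y) (Y : T) (hY : generatedBy P Y) :
    HasFiniteTotalHom k X Y := by
  let Q : ObjectProperty T := fun Y => HasFiniteTotalHom k X Y
  have hQ : Q.IsClosedUnderIsomorphisms := ⟨fun e h => h.of_iso_right e⟩
  have hQ' : Q.IsTriangulated :=
    { exists_zero := ⟨_, isZero_zero T, of_isZero_right (isZero_zero T)⟩
      isStableUnderShiftBy := fun a => ⟨fun _ h => h.shift_right a⟩
      ext₂' := fun _ hS h₁ h₃ => ObjectProperty.le_isoClosure _ _ (of_distTriang_right hS h₁ h₃) }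
  exact generatedBy_le (Q := Q) h Y hY

theorem isProperSubcategory_generatedBy [∀ n : ℤ, (shiftFunctor T n).Linear k]
    {P : ObjectProperty T} (h : ∀ X Y, P X → P Y → HasFiniteTotalHom k X Y) :
    IsProperSubcategory k (generatedBy P) := fun X Y hX hY =>
  (generatedBy_right (fun Y' hY' => generatedBy_left (fun X' hX' => h X' Y' hX' hY') X hX) Y
    hY).finite

end HasFiniteTotalHom

end Proper

namespace PathAlgebra

open Quiver

variable {k : Type u} [CommRing k] {V : Type} [Quiver.{0} V]

/-- A linear combination of paths is sent to the polynomial that records their lengths. -/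
def lengthPolynomial {a b : V} : (Path a b →₀ k) →ₗ[k] Polynomial k :=
  Finsupp.linearCombination k fun p => Polynomial.X ^ p.length

theorem lengthPolynomial_single {a b : V} (p : Path a b) (s : k) :
    lengthPolynomial (Finsupp.single p s) = s • Polynomial.X ^ p.length := by
  simp [lengthPolynomial]

theorem lengthPolynomial_concat {a b c : V} (x : Path a b →₀ k) (y : Path b c →₀ k) :
    lengthPolynomial (concat x y) = lengthPolynomial x * lengthPolynomial y := by
  induction x using Finsupp.induction_linear with
  | zero => simp
  | add x x' hx hx' => simp [hx, hx', add_mul]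
  | single p s =>
    induction y using Finsupp.induction_linear with
    | zero => simp
    | add y y' hy hy' => simp [hy, hy', mul_add]
    | single q t =>
      simp only [concat_single, lengthPolynomial_single, Path.length_comp, pow_add,
        smul_mul_smul_comm]

variable [DecidableEq V]

theorem ofPath_apply_nil_of_length_ne_zero {a b : V} (p : Path a b) (hp : p.length ≠ 0) (i : V) :
    (ofPath p : PathAlgebra k V) i i Path.nil = 0 := by
  by_cases ha : i = a
  · subst ha
    by_cases hb : i = b
    · subst hb
      have hp' : p ≠ Path.nil := fun h => hp (h ▸ rfl)
      simp [ofPath, hp']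
    · simp [ofPath, Pi.single_eq_of_ne hb]
  · simp [ofPath, Pi.single_eq_of_ne ha]

variable [Fintype V]

/-- The length polynomials of the components are the entries of a matrix that depends
multiplicatively on the element of the path algebra. -/
def lengthMatrix : PathAlgebra k V →+* Matrix V V (Polynomial k) where
  toFun x := Matrix.of fun a b => lengthPolynomial (x a b)
  map_one' := by
    ext1 a b
    by_cases h : a = b
    · subst h
      simp [one_apply_self, lengthPolynomial_single]
    · simp [one_apply_ne h, Matrix.one_apply_ne h]
  map_mul' x y := by
    ext1 a c
    simp [mul_apply, Matrix.mul_apply, map_sum, lengthPolynomial_concat]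
  map_zero' := by
    ext1 a b
    simp [zero_apply]
  map_add' x y := by
    ext1 a b
    simp [add_apply]

theorem lengthMatrix_apply (x : PathAlgebra k V) (a b : V) :
    lengthMatrix x a b = lengthPolynomial (x a b) := rfl

theorem lengthMatrix_smul (s : k) (x : PathAlgebra k V) (a b : V) :
    lengthMatrix (s • x) a b = s • lengthMatrix x a b := by
  simp [lengthMatrix_apply, smul_apply]

theorem lengthMatrix_ofPath {a b : V} (p : Path a b) (a' b' : V) :
    lengthMatrix (ofPath p : PathAlgebra k V) a' b' =
      if a' = a ∧ b' = b then Polynomial.X ^ p.length else 0 := by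
  rw [lengthMatrix_apply]
  by_cases ha : a' = a
  · subst ha
    by_cases hb : b' = b
    · subst hb
      simp [ofPath, lengthPolynomial_single]
    · simp [ofPath, hb]
  · simp [ofPath, ha]

theorem ofPath_mul_ofPath_of_ne {a b c d : V} (p : Path a b) (q : Path c d) (h : b ≠ c) :
    (ofPath p * ofPath q : PathAlgebra k V) = 0 := by
  ext1 a' d'
  rw [mul_apply, zero_apply]
  refine Finset.sum_eq_zero fun b' _ => ?_
  by_cases hb : b' = b
  · subst hb
    simp [ofPath, Pi.single_eq_of_ne h]
  · by_cases ha : a' = a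
    · subst ha
      simp [ofPath, Pi.single_eq_of_ne hb]
    · simp [ofPath, Pi.single_eq_of_ne ha]

theorem sum_apply {ι : Type*} (s : Finset ι) (f : ι → PathAlgebra k V) (a b : V) :
    (∑ i ∈ s, f i) a b = ∑ i ∈ s, f i a b :=
  map_sum (AddMonoidHom.mk' (fun x : PathAlgebra k V => x a b) fun _ _ => rfl) f s

theorem sum_ofPath_nil : ∑ a : V, (ofPath (Path.nil : Path a a) : PathAlgebra k V) = 1 := by
  ext1 a b
  rw [sum_apply, Finset.sum_eq_single a]
  · by_cases hab : b = a
    · subst hab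
      rw [one_apply_self]
      simp [ofPath]
    · rw [one_apply_ne (Ne.symm hab)]
      simp [ofPath, Pi.single_eq_of_ne hab]
  · intro c _ hc
    simp [ofPath, Pi.single_eq_of_ne hc.symm]
  · simp

end PathAlgebra

theorem CyclicQuiver.natCast_injective_of_lt {r n m : ℕ} (hn : n < r) (hm : m < r)
    (h : (n : CyclicQuiver r) = m) : n = m := by
  have h' : ((n : ℕ) : ZMod r) = (m : ℕ) := h
  rw [ZMod.natCast_eq_natCast_iff'] at h'
  rwa [Nat.mod_eq_of_lt hn, Nat.mod_eq_of_lt hm] at h'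

theorem CyclicQuiver.add_natCast_ne {r : ℕ} (i : CyclicQuiver r) (a : Fin (r - 1)) :
    i + 1 + ((a : ℕ) : CyclicQuiver r) ≠ i := by
  intro h
  have ha : (a : ℕ) + 1 < r := by have := a.2; omega
  have h₀ : (((a : ℕ) + 1 : ℕ) : CyclicQuiver r) = ((0 : ℕ) : CyclicQuiver r) := by
    rw [Nat.cast_add, Nat.cast_one, Nat.cast_zero]
    linear_combination h
  exact Nat.succ_ne_zero _ (CyclicQuiver.natCast_injective_of_lt ha (by omega) h₀)

theorem CyclicQuiver.add_one_add_natCast_pred {r : ℕ} [NeZero r] (i : CyclicQuiver r) :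
    i + 1 + ((r - 1 : ℕ) : CyclicQuiver r) = i := by
  rw [Nat.cast_sub NeZero.one_le, CyclicQuiver.natCast_self]
  ring

namespace CyclicAlgebra

open PathAlgebra CyclicQuiver Quiver

section Basis

variable (k : Type u) [CommRing k] (r : ℕ) [NeZero r]

theorem coeff_lengthMatrix_eq_zero {x : PathAlgebra k (CyclicQuiver r)} (hx : x ∈ cycleIdeal k r)
    (a b : CyclicQuiver r) {n : ℕ} (hn : n < r) : (lengthMatrix x a b).coeff n = 0 := by
  let I : Ideal (Polynomial k) := Ideal.span {Polynomial.X ^ r}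
  have h : cycleIdeal k r ≤
      TwoSidedIdeal.ker ((Ideal.Quotient.mk I).mapMatrix.comp lengthMatrix) := by
    rw [cycleIdeal, TwoSidedIdeal.span_le]
    rintro _ ⟨j, p, hp, rfl⟩
    rw [SetLike.mem_coe, TwoSidedIdeal.mem_ker]
    ext1 a b
    rw [RingHom.comp_apply, RingHom.mapMatrix_apply, Matrix.map_apply, lengthMatrix_ofPath, hp,
      Matrix.zero_apply, Ideal.Quotient.eq_zero_iff_mem]
    split_ifs
    · exact Ideal.subset_span rfl
    · exact I.zero_mem
  have hmap := (TwoSidedIdeal.mem_ker _).1 (h hx)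
  have hentry : Ideal.Quotient.mk I (lengthMatrix x a b) = 0 := congrFun (congrFun hmap a) b
  rw [Ideal.Quotient.eq_zero_iff_mem, Ideal.mem_span_singleton, Polynomial.X_pow_dvd_iff] at hentry
  exact hentry n hn

/-- The class of the path of length `n` that starts at `a`. -/
def path (a : CyclicQuiver r) (n : ℕ) : CyclicAlgebra k r := mk k r (ofPath (pathFrom a n).2)

theorem mk_ofPath {a b : CyclicQuiver r} (p : Path a b) :
    mk k r (ofPath p) = path k r a p.length :=
  congrArg (fun q : Σ b : CyclicQuiver r, Path a b => mk k r (ofPath q.2)) (eq_pathFrom p)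

theorem idem_eq_path (a : CyclicQuiver r) : idem k r a = path k r a 0 := rfl

variable {k r} in
theorem path_eq_zero (a : CyclicQuiver r) {n : ℕ} (hn : r ≤ n) : path k r a n = 0 :=
  mk_pathFrom_eq_zero k r a n hn

theorem path_mul_path (a : CyclicQuiver r) (n m : ℕ) :
    path k r a n * path k r (a + n) m = path k r a (n + m) := by
  have h : ∀ (p : Σ b : CyclicQuiver r, Path a b) (b : CyclicQuiver r), p.1 = b →
      mk k r (ofPath p.2) * path k r b m = path k r a (p.2.length + m) := by
    rintro ⟨b, p⟩ _ rfl
    rw [path, ← map_mul, ofPath_mul_ofPath, mk_ofPath, Path.length_comp, length_pathFrom]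
  rw [path, h _ _ (pathFrom_fst a n), length_pathFrom]

theorem path_mul_path_of_ne {a b : CyclicQuiver r} {n : ℕ} (m : ℕ) (h : a + n ≠ b) :
    path k r a n * path k r b m = 0 := by
  rw [path, path, ← map_mul, ofPath_mul_ofPath_of_ne _ _ (by rwa [pathFrom_fst]), map_zero]

theorem idem_mul_path (a : CyclicQuiver r) (n : ℕ) :
    idem k r a * path k r a n = path k r a n := by
  have := path_mul_path k r a 0 n
  rwa [Nat.cast_zero, add_zero, zero_add] at this

theorem idem_mul_path_of_ne {a b : CyclicQuiver r} (n : ℕ) (h : a ≠ b) :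
    idem k r a * path k r b n = 0 :=
  path_mul_path_of_ne k r (n := 0) n (by simpa using h)

theorem path_mul_idem {a b : CyclicQuiver r} {n : ℕ} (h : a + n = b) :
    path k r a n * idem k r b = path k r a n := by
  subst h
  exact path_mul_path k r a n 0

theorem path_mul_idem_of_ne {a b : CyclicQuiver r} {n : ℕ} (h : a + n ≠ b) :
    path k r a n * idem k r b = 0 :=
  path_mul_path_of_ne k r 0 h

theorem idem_mul_idem (a : CyclicQuiver r) : idem k r a * idem k r a = idem k r a :=
  idem_mul_path k r a 0

theorem sum_idem : ∑ a, idem k r a = 1 := by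
  rw [← map_one (mk k r), ← sum_ofPath_nil, map_sum]
  rfl

theorem linearIndependent_path : LinearIndependent k
    fun x : CyclicQuiver r × Fin r => path k r x.1 x.2 := by
  rw [Fintype.linearIndependent_iff]
  rintro g hg ⟨a, n⟩
  have h : mk k r (∑ x : CyclicQuiver r × Fin r, g x • ofPath (pathFrom x.1 x.2).2) = 0 := by
    rw [map_sum, ← hg]
    simp only [map_smul]
    rfl
  rw [mk_eq_zero_iff] at h
  have hcoeff := coeff_lengthMatrix_eq_zero k r h a (a + (n : ℕ)) n.2
  rw [map_sum, Matrix.sum_apply, Polynomial.finsetSum_coeff, Finset.sum_eq_single (a, n)] at hcoeff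
  · rw [lengthMatrix_smul, lengthMatrix_ofPath, if_pos ⟨rfl, (pathFrom_fst _ _).symm⟩,
      length_pathFrom, Polynomial.coeff_smul, Polynomial.coeff_X_pow_self] at hcoeff
    simpa using hcoeff
  · rintro ⟨b, m⟩ _ hbm
    rw [lengthMatrix_smul, lengthMatrix_ofPath, length_pathFrom]
    split_ifs with hc
    · rw [Polynomial.coeff_smul, Polynomial.coeff_X_pow, if_neg, smul_zero]
      intro hnm
      exact hbm (Prod.ext hc.1.symm (Fin.ext hnm.symm))
    · simp
  · simp

theorem span_path : Submodule.span k
    (Set.range fun x : CyclicQuiver r × Fin r => path k r x.1 x.2) = ⊤ := by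
  have hr : LinearMap.range (mk k r).toLinearMap = ⊤ :=
    LinearMap.range_eq_top.2 (mk_surjective k r)
  rw [eq_top_iff, ← hr, LinearMap.range_eq_map, ← PathAlgebra.span_ofPath, Submodule.map_span,
    Submodule.span_le]
  rintro _ ⟨_, ⟨a, b, p, rfl⟩, rfl⟩
  change mk k r (ofPath p) ∈ Submodule.span k _
  rw [mk_ofPath]
  by_cases hp : p.length < r
  · exact Submodule.subset_span ⟨(a, ⟨p.length, hp⟩), rfl⟩
  · rw [path_eq_zero a (not_lt.1 hp)]
    exact Submodule.zero_mem _

/-- The paths of length less than `r` are a basis. -/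
def pathBasis : Module.Basis (CyclicQuiver r × Fin r) k (CyclicAlgebra k r) :=
  Module.Basis.mk (linearIndependent_path k r) (span_path k r).ge

theorem pathBasis_apply (x : CyclicQuiver r × Fin r) :
    pathBasis k r x = path k r x.1 x.2 :=
  Module.Basis.mk_apply _ _ _

/-- The coefficient of the path of length `n` that starts at `a`. -/
def coeff (a : CyclicQuiver r) (n : Fin r) : CyclicAlgebra k r →ₗ[k] k :=
  (pathBasis k r).coord (a, n)

theorem coeff_path (a b : CyclicQuiver r) (n : Fin r) (m : ℕ) :
    coeff k r a n (path k r b m) = if b = a ∧ m = n then 1 else 0 := by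
  by_cases hm : m < r
  · have := pathBasis_apply k r (b, ⟨m, hm⟩)
    dsimp only at this
    rw [← this, coeff, Module.Basis.coord_apply, Module.Basis.repr_self, Finsupp.single_apply]
    simp [Prod.ext_iff, Fin.ext_iff]
  · rw [path_eq_zero b (not_lt.1 hm), map_zero, if_neg]
    rintro ⟨-, h⟩
    omega

variable {k r}

theorem linearMap_ext {V : Type*} [AddCommGroup V] [Module k V]
    {f g : CyclicAlgebra k r →ₗ[k] V} (h : ∀ a n, f (path k r a n) = g (path k r a n)) : f = g :=
  (pathBasis k r).ext fun x => by
    rw [pathBasis_apply]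
    exact h _ _

theorem character_path (i a : CyclicQuiver r) (n : ℕ) :
    character k r i (path k r a n) = if a = i ∧ n = 0 then 1 else 0 := by
  change (ofPath (pathFrom a n).2 : PathAlgebra k (CyclicQuiver r)) i i Path.nil = _
  obtain rfl | hn := eq_or_ne n 0
  · by_cases h : a = i
    · subst h
      simp [ofPath, pathFrom]
    · simp [ofPath, h]
  · rw [if_neg fun h => hn h.2, ofPath_apply_nil_of_length_ne_zero _ (by rwa [length_pathFrom])]

theorem character_eq_coeff (i : CyclicQuiver r) (x : CyclicAlgebra k r) :
    character k r i x = coeff k r i 0 x := by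
  suffices h : (character k r i).toLinearMap = coeff k r i 0 from LinearMap.congr_fun h x
  refine linearMap_ext fun a n => ?_
  rw [AlgHom.toLinearMap_apply, character_path, coeff_path, Fin.val_zero]

theorem character_idem (i : CyclicQuiver r) : character k r i (idem k r i) = 1 := by
  rw [idem_eq_path, character_path, if_pos ⟨rfl, rfl⟩]

theorem character_idem_of_ne {i j : CyclicQuiver r} (h : j ≠ i) :
    character k r i (idem k r j) = 0 := by
  rw [idem_eq_path, character_path, if_neg fun heq => h heq.1]

theorem idem_mul_eq_sum (i : CyclicQuiver r) (x : CyclicAlgebra k r) :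
    idem k r i * x = ∑ n : Fin r, coeff k r i n x • path k r i n := by
  conv_lhs => rw [← (pathBasis k r).sum_repr x, Finset.mul_sum, Fintype.sum_prod_type]
  rw [Finset.sum_eq_single i]
  · refine Finset.sum_congr rfl fun n _ => ?_
    rw [pathBasis_apply, mul_smul_comm, idem_mul_path, coeff, Module.Basis.coord_apply]
  · refine fun a _ ha => Finset.sum_eq_zero fun n _ => ?_
    rw [pathBasis_apply, mul_smul_comm, idem_mul_path_of_ne k r _ ha.symm, smul_zero]
  · exact fun h => absurd (Finset.mem_univ i) h

theorem path_one_mul_path (i : CyclicQuiver r) (n : ℕ) :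
    path k r i 1 * path k r (i + 1) n = path k r i (n + 1) := by
  rw [add_comm n 1, ← path_mul_path, Nat.cast_one]

theorem exists_idem_mul_eq (i : CyclicQuiver r) (x : CyclicAlgebra k r) :
    ∃ y, idem k r i * x = character k r i x • idem k r i + path k r i 1 * y := by
  refine ⟨∑ n ∈ Finset.univ.erase (0 : Fin r), coeff k r i n x • path k r (i + 1) (n - 1), ?_⟩
  rw [idem_mul_eq_sum, ← Finset.add_sum_erase _ _ (Finset.mem_univ (0 : Fin r)),
    character_eq_coeff, Fin.val_zero, idem_eq_path, Finset.mul_sum]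
  congr 1
  refine Finset.sum_congr rfl fun n hn => ?_
  have hn : (n : ℕ) ≠ 0 := fun h => Finset.ne_of_mem_erase hn (Fin.ext h)
  rw [mul_smul_comm, path_one_mul_path, Nat.sub_add_cancel (Nat.one_le_iff_ne_zero.2 hn)]

theorem coeff_path_one_mul (i : CyclicQuiver r) {n : ℕ} (hn : n + 1 < r)
    (x : CyclicAlgebra k r) :
    coeff k r i ⟨n + 1, hn⟩ (path k r i 1 * x) = coeff k r (i + 1) ⟨n, by omega⟩ x := by
  suffices h : (coeff k r i ⟨n + 1, hn⟩).comp (LinearMap.mulLeft k (path k r i 1)) =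
      coeff k r (i + 1) ⟨n, by omega⟩ from LinearMap.congr_fun h x
  refine linearMap_ext fun a m => ?_
  rw [LinearMap.comp_apply, LinearMap.mulLeft_apply, coeff_path]
  by_cases ha : i + 1 = a
  · subst ha
    rw [path_one_mul_path, coeff_path]
    simp only [true_and, Nat.add_right_cancel_iff]
  · rw [path_mul_path_of_ne k r _ (by rwa [Nat.cast_one]), map_zero, if_neg fun h => ha h.1.symm]

theorem idem_mul_eq_of_path_mul_eq_zero {i : CyclicQuiver r} {x : CyclicAlgebra k r}
    (hx : path k r i 1 * x = 0) : ∃ c : k, idem k r (i + 1) * x = c • path k r (i + 1) (r - 1) := by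
  have hr : r - 1 < r := Nat.sub_lt (NeZero.pos r) one_pos
  refine ⟨coeff k r (i + 1) ⟨r - 1, hr⟩ x, ?_⟩
  rw [idem_mul_eq_sum, Finset.sum_eq_single ⟨r - 1, hr⟩]
  · intro n _ hn
    have hn : (n : ℕ) + 1 < r := by
      have : (n : ℕ) ≠ r - 1 := fun h => hn (Fin.ext h)
      omega
    rw [← coeff_path_one_mul i hn, hx, map_zero, zero_smul]
  · exact fun h => absurd (Finset.mem_univ _) h

theorem path_ne_zero [Nontrivial k] (a : CyclicQuiver r) {n : ℕ} (hn : n < r) :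
    path k r a n ≠ 0 := by
  intro h
  have := coeff_path k r a a ⟨n, hn⟩ n
  rw [h, map_zero, if_pos ⟨rfl, rfl⟩] at this
  exact zero_ne_one this

theorem idem_mul_mul_idem (a : CyclicQuiver r) {n : ℕ} (hn : n < r) (x : CyclicAlgebra k r) :
    idem k r a * x * idem k r (a + n) = coeff k r a ⟨n, hn⟩ x • path k r a n := by
  suffices h : (LinearMap.mulRight k (idem k r (a + n))).comp (LinearMap.mulLeft k (idem k r a)) =
      (coeff k r a ⟨n, hn⟩).smulRight (path k r a n) from LinearMap.congr_fun h x
  refine linearMap_ext fun b m => ?_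
  rw [LinearMap.comp_apply, LinearMap.mulLeft_apply, LinearMap.mulRight_apply,
    LinearMap.smulRight_apply, coeff_path]
  by_cases hb : b = a
  · subst hb
    rw [idem_mul_path]
    by_cases hm : m < r
    · by_cases hnm : m = n
      · subst hnm
        rw [path_mul_idem k r rfl]
        simp
      · rw [path_mul_idem_of_ne, if_neg fun h => hnm h.2, zero_smul]
        intro h
        exact hnm (natCast_injective_of_lt hm hn (add_left_cancel h))
    · rw [path_eq_zero _ (not_lt.1 hm), zero_mul, if_neg, zero_smul]
      rintro ⟨-, h⟩
      dsimp only at h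
      omega
  · rw [idem_mul_path_of_ne k r _ (Ne.symm hb), zero_mul, if_neg fun h => hb h.1, zero_smul]

end Basis

end CyclicAlgebra

namespace CyclicAlgebra

open MulOpposite

variable {k : Type u} [Field k] {r : ℕ} [NeZero r]

section Projective

/-- The generator `e_i` of `P_i`. -/
def projGen (i : CyclicQuiver r) : proj k r i :=
  (⟨idem k r i, Submodule.mem_span_singleton_self _⟩ :
    Submodule.span (CyclicAlgebra k r)ᵐᵒᵖ {idem k r i})

theorem mem_proj_iff {i : CyclicQuiver r} {x : CyclicAlgebra k r} :
    x ∈ Submodule.span (CyclicAlgebra k r)ᵐᵒᵖ {idem k r i} ↔ idem k r i * x = x := by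
  rw [Submodule.mem_span_singleton]
  constructor
  · rintro ⟨a, rfl⟩
    change idem k r i * (idem k r i * a.unop) = idem k r i * a.unop
    rw [← mul_assoc, idem_mul_idem]
  · exact fun h => ⟨op x, h⟩

/-- The elements of `P_i` as elements of the algebra. -/
def projVal {i : CyclicQuiver r} (x : proj k r i) : CyclicAlgebra k r :=
  (show Submodule.span (CyclicAlgebra k r)ᵐᵒᵖ {idem k r i} from x).1

/-- The element of `P_i` given by an element of the algebra. -/
def projMk (i : CyclicQuiver r) (x : CyclicAlgebra k r) (hx : idem k r i * x = x) : proj k r i :=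
  (⟨x, mem_proj_iff.2 hx⟩ : Submodule.span (CyclicAlgebra k r)ᵐᵒᵖ {idem k r i})

theorem projVal_projMk (i : CyclicQuiver r) (x : CyclicAlgebra k r) (hx : idem k r i * x = x) :
    projVal (projMk i x hx) = x := rfl

theorem projVal_projGen (i : CyclicQuiver r) : projVal (projGen (k := k) i) = idem k r i := rfl

theorem projVal_injective (i : CyclicQuiver r) : Function.Injective (projVal (k := k) (i := i)) :=
  Subtype.val_injective

theorem projVal_smul {i : CyclicQuiver r} (a : CyclicAlgebra k r) (x : proj k r i) :
    projVal (op a • x) = projVal x * a := rfl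

theorem idem_mul_projVal {i : CyclicQuiver r} (x : proj k r i) :
    idem k r i * projVal x = projVal x :=
  mem_proj_iff.1 (show Submodule.span (CyclicAlgebra k r)ᵐᵒᵖ {idem k r i} from x).2

/-- The underlying vector space of `S_i` is the ground field. -/
def simpleEquiv (i : CyclicQuiver r) : simple k r i ≃+ k := AddEquiv.refl k

theorem simpleEquiv_smul {i : CyclicQuiver r} (a : CyclicAlgebra k r) (x : simple k r i) :
    simpleEquiv i (op a • x) = character k r i a * simpleEquiv i x := rfl

/-- The morphism from `S_i` to a module that is given by an element on which the algebra acts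
by the character at `i`. -/
def simpleDesc (i : CyclicQuiver r) {N : ModuleCat.{u} (CyclicAlgebra k r)ᵐᵒᵖ} (z : N)
    (hz : ∀ x : CyclicAlgebra k r,
      op x • z = op (algebraMap k (CyclicAlgebra k r) (character k r i x)) • z) :
    simple k r i ⟶ N :=
  ModuleCat.ofHom (X := simple k r i)
    { toFun := fun c => op (algebraMap k (CyclicAlgebra k r) (simpleEquiv i c)) • z
      map_add' := fun c c' => by
        rw [map_add, map_add, MulOpposite.op_add, add_smul]
      map_smul' := fun x c => by
        have hs : simpleEquiv i (x • c) = character k r i x.unop * simpleEquiv i c := rfl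
        have hx : x • z = op (algebraMap k (CyclicAlgebra k r) (character k r i x.unop)) • z :=
          hz x.unop
        have hc : op (algebraMap k (CyclicAlgebra k r) (simpleEquiv i c)) * x =
            x * op (algebraMap k (CyclicAlgebra k r) (simpleEquiv i c)) :=
          unop_injective (Algebra.commutes (simpleEquiv i c) x.unop).symm
        refine (congrArg (fun t => op (algebraMap k (CyclicAlgebra k r) t) • z) hs).trans ?_
        rw [RingHom.id_apply, ← mul_smul x, ← hc, mul_smul, hx, ← mul_smul, ← op_mul,
          ← map_mul] }

theorem simpleDesc_apply (i : CyclicQuiver r) {N : ModuleCat.{u} (CyclicAlgebra k r)ᵐᵒᵖ} (z : N)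
    (hz : ∀ x : CyclicAlgebra k r,
      op x • z = op (algebraMap k (CyclicAlgebra k r) (character k r i x)) • z)
    (c : simple k r i) :
    (simpleDesc i z hz).hom c = op (algebraMap k (CyclicAlgebra k r) (simpleEquiv i c)) • z := rfl

theorem mono_simpleDesc (i : CyclicQuiver r) {N : ModuleCat.{u} (CyclicAlgebra k r)ᵐᵒᵖ} {z : N}
    (hz : ∀ x : CyclicAlgebra k r,
      op x • z = op (algebraMap k (CyclicAlgebra k r) (character k r i x)) • z) (hz₀ : z ≠ 0) :
    Mono (simpleDesc i z hz) := by
  refine (ModuleCat.mono_iff_injective _).2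
    ((injective_iff_map_eq_zero (simpleDesc i z hz).hom).2 ?_)
  intro c hc
  rw [simpleDesc_apply] at hc
  by_contra hc0
  have hcc : simpleEquiv i c * (simpleEquiv i c)⁻¹ = 1 :=
    mul_inv_cancel₀ ((map_ne_zero_iff _ (simpleEquiv i).injective).2 hc0)
  apply hz₀
  rw [← one_smul (CyclicAlgebra k r)ᵐᵒᵖ z, ← op_one, ← map_one (algebraMap k (CyclicAlgebra k r)),
    ← hcc, map_mul, op_mul, mul_smul, hc, smul_zero]

/-- The morphism from `P_i` to a module that is given by an element of the module. -/
def projDesc (i : CyclicQuiver r) {N : ModuleCat.{u} (CyclicAlgebra k r)ᵐᵒᵖ} (y : N) :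
    proj k r i ⟶ N :=
  ModuleCat.ofHom (X := Submodule.span (CyclicAlgebra k r)ᵐᵒᵖ {idem k r i})
    { toFun := fun x => op x.1 • y
      map_add' := fun x x' => by
        rw [← add_smul]
        rfl
      map_smul' := fun a x => by
        rw [RingHom.id_apply, ← mul_smul]
        rfl }

theorem projDesc_apply (i : CyclicQuiver r) {N : ModuleCat.{u} (CyclicAlgebra k r)ᵐᵒᵖ} (y : N)
    (x : proj k r i) : (projDesc i y).hom x = op (projVal x) • y := rfl

theorem proj_hom_apply {i : CyclicQuiver r} {N : ModuleCat.{u} (CyclicAlgebra k r)ᵐᵒᵖ}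
    (f : proj k r i ⟶ N) (x : proj k r i) :
    f.hom x = op (projVal x) • f.hom (projGen i) := by
  rw [← map_smul]
  congr 1
  exact projVal_injective i (idem_mul_projVal x).symm

theorem proj_hom_ext {i : CyclicQuiver r} {N : ModuleCat.{u} (CyclicAlgebra k r)ᵐᵒᵖ}
    {f g : proj k r i ⟶ N} (h : f.hom (projGen i) = g.hom (projGen i)) : f = g := by
  ext x
  rw [proj_hom_apply f, proj_hom_apply g, h]

theorem idem_smul_proj_hom {i : CyclicQuiver r} {N : ModuleCat.{u} (CyclicAlgebra k r)ᵐᵒᵖ}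
    (f : proj k r i ⟶ N) : op (idem k r i) • f.hom (projGen i) = f.hom (projGen i) :=
  (proj_hom_apply f (projGen i)).symm

instance (i : CyclicQuiver r) : Projective (proj k r i) where
  factors {E X} f e he := by
    obtain ⟨z, hz⟩ := (ModuleCat.epi_iff_surjective e).1 he (f.hom (projGen i))
    refine ⟨projDesc i z, proj_hom_ext ?_⟩
    change e.hom (op (idem k r i) • z) = _
    rw [map_smul]
    exact (congrArg _ hz).trans (idem_smul_proj_hom f)

theorem smul_hom_apply {M N : ModuleCat.{u} (CyclicAlgebra k r)ᵐᵒᵖ} (c : k) (f : M ⟶ N) (x : M) :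
    (c • f).hom x = op (algebraMap k (CyclicAlgebra k r) c) • f.hom x := rfl

theorem exists_projVal_hom_projGen_eq_smul {i j : CyclicQuiver r} {n : ℕ} (hn : n < r)
    (hj : i + n = j) (f : proj k r j ⟶ proj k r i) :
    ∃ c : k, projVal (f.hom (projGen j)) = c • path k r i n := by
  subst hj
  have hf := congrArg projVal (idem_smul_proj_hom f)
  rw [projVal_smul] at hf
  have h := idem_mul_mul_idem i hn (projVal (f.hom (projGen _)))
  rw [idem_mul_projVal, hf] at h
  exact ⟨_, h⟩

theorem exists_proj_hom_eq_smul {i : CyclicQuiver r} (f : proj k r i ⟶ proj k r i) :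
    ∃ c : k, f = c • 𝟙 (proj k r i) := by
  obtain ⟨c, hc⟩ := exists_projVal_hom_projGen_eq_smul (NeZero.pos r)
    (by rw [Nat.cast_zero, add_zero]) f
  refine ⟨c, proj_hom_ext (projVal_injective i (hc.trans ?_))⟩
  rw [smul_hom_apply, projVal_smul, ← Algebra.commutes, ← Algebra.smul_def]
  rfl

theorem proj_hom_simple_eq_zero {i j : CyclicQuiver r} (h : i ≠ j)
    (f : proj k r i ⟶ simple k r j) : f = 0 := by
  apply proj_hom_ext
  apply (simpleEquiv j).injective
  rw [← idem_smul_proj_hom f, simpleEquiv_smul, character_idem_of_ne h, zero_mul]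
  rfl

theorem exists_simple_hom_eq_smul {i : CyclicQuiver r} (f : simple k r i ⟶ simple k r i) :
    ∃ c : k, f = c • 𝟙 (simple k r i) := by
  let one : simple k r i := (simpleEquiv i).symm 1
  refine ⟨simpleEquiv i (f.hom one), ?_⟩
  ext x
  apply (simpleEquiv i).injective
  have hx : x = op (algebraMap k (CyclicAlgebra k r) (simpleEquiv i x)) • one := by
    apply (simpleEquiv i).injective
    rw [simpleEquiv_smul, AlgHom.commutes, AddEquiv.apply_symm_apply, mul_one]
    rfl
  rw [smul_hom_apply, simpleEquiv_smul, AlgHom.commutes]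
  conv_lhs => rw [hx]
  rw [map_smul, simpleEquiv_smul, AlgHom.commutes]
  exact mul_comm _ _

theorem simple_id_ne_zero (i : CyclicQuiver r) : 𝟙 (simple k r i) ≠ 0 := fun h =>
  one_ne_zero (α := k) (congrArg (fun f : simple k r i ⟶ simple k r i =>
    simpleEquiv i (f.hom ((simpleEquiv i).symm 1))) h)

theorem proj_id_ne_zero (i : CyclicQuiver r) : 𝟙 (proj k r i) ≠ 0 := fun h =>
  path_ne_zero (k := k) i (NeZero.pos r)
    (congrArg (fun f : proj k r i ⟶ proj k r i => projVal (f.hom (projGen i))) h)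

theorem smul_eq_character_smul {i : CyclicQuiver r} {N : ModuleCat.{u} (CyclicAlgebra k r)ᵐᵒᵖ}
    {z : N} (hz : op (idem k r i) • z = z) (hz' : op (path k r i 1) • z = 0)
    (x : CyclicAlgebra k r) :
    op x • z = op (algebraMap k (CyclicAlgebra k r) (character k r i x)) • z := by
  obtain ⟨y, hy⟩ := exists_idem_mul_eq i x
  calc op x • z = op (idem k r i * x) • z := by rw [op_mul, mul_smul, hz]
    _ = op (algebraMap k (CyclicAlgebra k r) (character k r i x)) • z := by
      rw [hy, MulOpposite.op_add, add_smul, op_mul, mul_smul, hz', smul_zero, add_zero,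
        Algebra.smul_def, Algebra.commutes, op_mul, mul_smul, hz]

end Projective

section Radical

variable (k r) in
/-- The radical of `P_i`: the right ideal generated by the arrow at `i`. -/
def radical (i : CyclicQuiver r) : ModuleCat.{u} (CyclicAlgebra k r)ᵐᵒᵖ :=
  ModuleCat.of _ (Submodule.span (CyclicAlgebra k r)ᵐᵒᵖ {path k r i 1})

theorem mem_radical_iff {i : CyclicQuiver r} {x : CyclicAlgebra k r} :
    x ∈ Submodule.span (CyclicAlgebra k r)ᵐᵒᵖ {path k r i 1} ↔ ∃ y, path k r i 1 * y = x := by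
  rw [Submodule.mem_span_singleton]
  exact ⟨fun ⟨a, h⟩ => ⟨a.unop, h⟩, fun ⟨y, h⟩ => ⟨op y, h⟩⟩

theorem radical_le_proj (i : CyclicQuiver r) :
    Submodule.span (CyclicAlgebra k r)ᵐᵒᵖ {path k r i 1} ≤
      Submodule.span (CyclicAlgebra k r)ᵐᵒᵖ {idem k r i} := by
  rw [Submodule.span_singleton_le_iff_mem, mem_proj_iff, idem_mul_path]

/-- The inclusion of the radical of `P_i`. -/
def radicalι (i : CyclicQuiver r) : radical k r i ⟶ proj k r i :=
  ModuleCat.ofHom (Submodule.inclusion (radical_le_proj i))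

/-- The projection of `P_i` to its top `S_i`. -/
def projToSimple (i : CyclicQuiver r) : proj k r i ⟶ simple k r i :=
  projDesc i (N := simple k r i) (1 : k)

theorem projToSimple_apply (i : CyclicQuiver r) (x : proj k r i) :
    simpleEquiv i ((projToSimple i).hom x) = character k r i (projVal x) :=
  mul_one (character k r i (projVal x))

theorem projToSimple_surjective (i : CyclicQuiver r) :
    Function.Surjective (projToSimple (k := k) i).hom := by
  intro c
  refine ⟨op (algebraMap k (CyclicAlgebra k r) (simpleEquiv i c)) • projGen i,
    (simpleEquiv i).injective ?_⟩
  rw [projToSimple_apply, projVal_smul, projVal_projGen, map_mul, character_idem, one_mul,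
    AlgHom.commutes]
  rfl

theorem character_path_one (i : CyclicQuiver r) : character k r i (path k r i 1) = 0 := by
  rw [character_path, if_neg (by simp)]

/-- The extension of the top `S_i` of `P_i` by the radical. -/
def topSequence (i : CyclicQuiver r) : ShortComplex (ModuleCat.{u} (CyclicAlgebra k r)ᵐᵒᵖ) where
  X₁ := radical k r i
  X₂ := proj k r i
  X₃ := simple k r i
  f := radicalι i
  g := projToSimple i
  zero := by
    ext x
    obtain ⟨y, hy⟩ := mem_radical_iff.1 x.2
    apply (simpleEquiv i).injective
    refine (projToSimple_apply i _).trans ?_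
    change character k r i x.1 = 0
    rw [← hy, map_mul, character_path_one, zero_mul]

theorem topSequence_shortExact (i : CyclicQuiver r) : (topSequence (k := k) i).ShortExact := by
  refine ShortComplex.ShortExact.mk' ?_ ?_ ?_
  · rw [ShortComplex.ShortExact.moduleCat_exact_iff_function_exact]
    intro x
    constructor
    · intro hx
      have hx' : character k r i (projVal x) = 0 := (projToSimple_apply i x).symm.trans hx
      obtain ⟨y, hy⟩ := exists_idem_mul_eq i (projVal x)
      rw [hx', zero_smul, zero_add] at hy
      exact ⟨⟨_, mem_radical_iff.2 ⟨y, hy.symm.trans (idem_mul_projVal (i := i) x)⟩⟩, rfl⟩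
    · rintro ⟨y, rfl⟩
      exact LinearMap.congr_fun (ModuleCat.hom_ext_iff.1 (topSequence (k := k) i).zero) y
  · exact (ModuleCat.mono_iff_injective _).2 (Submodule.inclusion_injective (radical_le_proj i))
  · exact (ModuleCat.epi_iff_surjective _).2 (projToSimple_surjective i)

/-- The projective cover of the radical of `P_i`. -/
def projToRadical (i : CyclicQuiver r) : proj k r (i + 1) ⟶ radical k r i :=
  ModuleCat.ofHom (X := Submodule.span (CyclicAlgebra k r)ᵐᵒᵖ {idem k r (i + 1)})
    (Y := Submodule.span (CyclicAlgebra k r)ᵐᵒᵖ {path k r i 1})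
    { toFun := fun x => ⟨path k r i 1 * x.1, mem_radical_iff.2 ⟨x.1, rfl⟩⟩
      map_add' := fun _ _ => Subtype.ext (mul_add _ _ _)
      map_smul' := fun a x => Subtype.ext (mul_assoc _ x.1 a.unop).symm }

theorem projToRadical_surjective (i : CyclicQuiver r) :
    Function.Surjective (projToRadical (k := k) i).hom := by
  rintro ⟨x, hx⟩
  obtain ⟨y, rfl⟩ := mem_radical_iff.1 hx
  refine ⟨(⟨idem k r (i + 1) * y, mem_proj_iff.2 ?_⟩ :
    Submodule.span (CyclicAlgebra k r)ᵐᵒᵖ {idem k r (i + 1)}), Subtype.ext ?_⟩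
  · rw [← mul_assoc, idem_mul_idem]
  · change path k r i 1 * (idem k r (i + 1) * y) = path k r i 1 * y
    rw [← mul_assoc, path_mul_idem k r (by rw [Nat.cast_one])]

theorem projToRadical_apply (i : CyclicQuiver r) (x : proj k r (i + 1)) :
    (show Submodule.span (CyclicAlgebra k r)ᵐᵒᵖ {path k r i 1} from
      (projToRadical i).hom x).1 = path k r i 1 * projVal x := rfl

/-- The generator of the socle `S_i` of `P_{i+1}`. -/
def socleGen (i : CyclicQuiver r) : proj k r (i + 1) :=
  projMk (i + 1) (path k r (i + 1) (r - 1)) (idem_mul_path k r _ _)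

theorem projVal_smul_socleGen (i : CyclicQuiver r) (c : k) :
    projVal (op (algebraMap k (CyclicAlgebra k r) c) • socleGen i) =
      c • path k r (i + 1) (r - 1) := by
  rw [projVal_smul, ← Algebra.commutes, ← Algebra.smul_def]
  rfl

theorem smul_socleGen (i : CyclicQuiver r) (x : CyclicAlgebra k r) :
    op x • socleGen (k := k) i =
      op (algebraMap k (CyclicAlgebra k r) (character k r i x)) • socleGen i := by
  have hi := CyclicQuiver.add_one_add_natCast_pred i
  have hidem : op (idem k r i) • socleGen i = socleGen i :=
    projVal_injective (i + 1) ((projVal_smul (k := k) _ _).trans (path_mul_idem k r hi))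
  have hpath : op (path k r i 1) • socleGen (k := k) i = 0 := by
    have h := path_mul_path k r (i + 1) (r - 1) 1
    rw [hi] at h
    exact projVal_injective (i + 1)
      ((projVal_smul (k := k) _ _).trans (h.trans (path_eq_zero _ (by omega))))
  exact smul_eq_character_smul hidem hpath x

/-- The inclusion of the socle `S_i` of `P_{i+1}`. -/
def socleι (i : CyclicQuiver r) : simple k r i ⟶ proj k r (i + 1) :=
  simpleDesc i (socleGen i) (smul_socleGen i)

theorem projVal_socleι (i : CyclicQuiver r) (c : simple k r i) :
    projVal ((socleι i).hom c) = simpleEquiv i c • path k r (i + 1) (r - 1) :=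
  projVal_smul_socleGen i _

/-- The presentation of the radical of `P_i`. -/
def socleSequence (i : CyclicQuiver r) : ShortComplex (ModuleCat.{u} (CyclicAlgebra k r)ᵐᵒᵖ) where
  X₁ := simple k r i
  X₂ := proj k r (i + 1)
  X₃ := radical k r i
  f := socleι i
  g := projToRadical i
  zero := by
    ext c
    refine Subtype.ext ((projToRadical_apply i _).trans
      ((congrArg (path k r i 1 * ·) (projVal_socleι i c)).trans ?_))
    have := path_mul_path k r i 1 (r - 1)
    rw [Nat.cast_one] at this
    change path k r i 1 * (simpleEquiv i c • path k r (i + 1) (r - 1)) = 0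
    rw [mul_smul_comm, this, path_eq_zero _ (by omega), smul_zero]

theorem socleSequence_shortExact (i : CyclicQuiver r) :
    (socleSequence (k := k) i).ShortExact := by
  refine ShortComplex.ShortExact.mk' ?_ ?_ ?_
  · rw [ShortComplex.ShortExact.moduleCat_exact_iff_function_exact]
    intro x
    constructor
    · intro hx
      have hx' : path k r i 1 * projVal x = 0 := congrArg Subtype.val hx
      obtain ⟨c, hc⟩ := idem_mul_eq_of_path_mul_eq_zero hx'
      exact ⟨(simpleEquiv i).symm c, projVal_injective _ ((projVal_socleι i _).trans
        (hc.symm.trans (idem_mul_projVal (i := i + 1) x)))⟩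
    · rintro ⟨y, rfl⟩
      exact LinearMap.congr_fun (ModuleCat.hom_ext_iff.1 (socleSequence (k := k) i).zero) y
  · refine mono_simpleDesc i (smul_socleGen i) fun h => ?_
    exact path_ne_zero (k := k) (i + 1) (Nat.sub_lt (NeZero.pos r) one_pos) (congrArg projVal h)
  · exact (ModuleCat.epi_iff_surjective _).2 (projToRadical_surjective i)

theorem projToRadical_comp_radicalι (i : CyclicQuiver r)
    {N : ModuleCat.{u} (CyclicAlgebra k r)ᵐᵒᵖ} (f : proj k r i ⟶ N) :
    ((projToRadical i ≫ radicalι i) ≫ f).hom (projGen (i + 1)) =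
      op (path k r i 1) • f.hom (projGen i) := by
  refine (proj_hom_apply f ((projToRadical i ≫ radicalι i).hom (projGen (i + 1)))).trans ?_
  congr 2
  exact path_mul_idem k r (by rw [Nat.cast_one])

theorem exists_eq_add_natCast {i j : CyclicQuiver r} (h : j ≠ i) :
    ∃ l : ℕ, l + 1 < r ∧ j = i + 1 + (l : CyclicQuiver r) := by
  have exists_natCast_eq (m : CyclicQuiver r) : ∃ l : ℕ, l < r ∧ (l : CyclicQuiver r) = m :=
    ⟨ZMod.val (n := r) m, ZMod.val_lt (n := r) m, ZMod.natCast_zmod_val (n := r) m⟩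
  obtain ⟨l, hl, hj⟩ := exists_natCast_eq (j - (i + 1))
  refine ⟨l, ?_, by rw [hj]; ring⟩
  by_contra hlt
  have hl_eq : l + 1 = r := by omega
  have hcast : ((l + 1 : ℕ) : CyclicQuiver r) = 0 := by rw [hl_eq, CyclicQuiver.natCast_self]
  rw [Nat.cast_add, Nat.cast_one, hj] at hcast
  apply h
  linear_combination hcast

theorem projVal_projToRadical_comp_radicalι {i j : CyclicQuiver r} {n : ℕ} (hn : i + n = j)
    {f : proj k r j ⟶ proj k r i} {c : k}
    (hf : projVal (f.hom (projGen j)) = c • path k r i n) :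
    projVal (((projToRadical j ≫ radicalι j) ≫ f).hom (projGen (j + 1))) =
      c • path k r i (n + 1) := by
  subst hn
  rw [projToRadical_comp_radicalι, projVal_smul, hf, smul_mul_assoc, path_mul_path]

theorem injective_projToRadical_comp {i j : CyclicQuiver r} (h : j ≠ i) :
    Function.Injective fun f : proj k r j ⟶ proj k r (i + 1) =>
      (projToRadical j ≫ radicalι j) ≫ f := by
  obtain ⟨l, hl, hj⟩ := exists_eq_add_natCast h
  refine (injective_iff_map_eq_zero
    (Preadditive.leftComp (proj k r (i + 1)) (projToRadical j ≫ radicalι j))).2 fun f hf => ?_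
  obtain ⟨c, hc⟩ := exists_projVal_hom_projGen_eq_smul (by omega) hj.symm f
  have hc₀ : c • path k r (i + 1) (l + 1) = 0 :=
    (projVal_projToRadical_comp_radicalι hj.symm hc).symm.trans
      (congrArg (fun g : proj k r (j + 1) ⟶ proj k r (i + 1) => projVal (g.hom (projGen _))) hf)
  obtain rfl := (smul_eq_zero.1 hc₀).resolve_right (path_ne_zero _ hl)
  exact proj_hom_ext (projVal_injective _ (hc.trans (zero_smul _ _)))

theorem surjective_projToRadical_comp {i j : CyclicQuiver r} (h : j ≠ i) :
    Function.Surjective fun f : proj k r j ⟶ proj k r (i + 1) =>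
      (projToRadical j ≫ radicalι j) ≫ f := by
  intro g
  obtain ⟨l, hl, hj⟩ := exists_eq_add_natCast h
  obtain ⟨c, hc⟩ := exists_projVal_hom_projGen_eq_smul hl
    (by rw [Nat.cast_add, Nat.cast_one, ← add_assoc, ← hj]) g
  have hy : idem k r (i + 1) * (c • path k r (i + 1) l) = c • path k r (i + 1) l := by
    rw [mul_smul_comm, idem_mul_path]
  let f : proj k r j ⟶ proj k r (i + 1) := projDesc j (projMk (i + 1) _ hy)
  have hf : projVal (f.hom (projGen j)) = c • path k r (i + 1) l := by
    rw [projDesc_apply, projVal_smul, projVal_projMk, projVal_projGen, smul_mul_assoc,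
      path_mul_idem k r hj.symm]
  exact ⟨f, proj_hom_ext (projVal_injective _
    ((projVal_projToRadical_comp_radicalι hj.symm hf).trans hc.symm))⟩

end Radical

section Socle

variable {N : ModuleCat.{u} (CyclicAlgebra k r)ᵐᵒᵖ}

theorem exists_idem_smul_ne_zero {y : N} (hy : y ≠ 0) : ∃ a, op (idem k r a) • y ≠ 0 := by
  by_contra! h
  apply hy
  rw [← one_smul (CyclicAlgebra k r)ᵐᵒᵖ y, ← op_one, ← sum_idem, Finset.op_sum, Finset.sum_smul]
  exact Finset.sum_eq_zero fun a _ => h a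

theorem exists_path_smul_ne_zero {y : N} (hy : y ≠ 0) :
    ∃ a n, op (path k r a n) • y ≠ 0 ∧ op (path k r a (n + 1)) • y = 0 := by
  obtain ⟨a, ha⟩ := exists_idem_smul_ne_zero hy
  refine ⟨a, ?_⟩
  by_contra! h
  have hpath (n : ℕ) : op (path k r a n) • y ≠ 0 := by
    induction n with
    | zero => exact ha
    | succ n ih => exact h n ih
  exact hpath r (by rw [path_eq_zero a le_rfl, MulOpposite.op_zero, zero_smul])

theorem exists_mono_simple {y : N} (hy : y ≠ 0) :
    ∃ (j : CyclicQuiver r) (f : simple k r j ⟶ N), Mono f ∧ ∃ z : N, op (idem k r j) • z ≠ 0 := by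
  obtain ⟨a, n, hn, hn'⟩ := exists_path_smul_ne_zero hy
  let z := op (path k r a n) • y
  have hz : op (idem k r (a + n)) • z = z := by
    rw [← mul_smul, ← op_mul, path_mul_idem k r rfl]
  have hz' : op (path k r (a + n) 1) • z = 0 := by
    rw [← mul_smul, ← op_mul, path_mul_path, hn']
  exact ⟨a + n, simpleDesc _ z (smul_eq_character_smul hz hz'), mono_simpleDesc _ _ hn, z,
    hz.symm ▸ hn⟩

end Socle

end CyclicAlgebra

namespace BoundedDerived

variable {k : Type u} [Field k] {R : Type u} [Ring R] [Algebra k R]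
  [HasDerivedCategory.{w} (ModuleCat.{u} R)]

theorem eq_zero_of_forall_eq_zero {X Y : BoundedDerived k R} {n : ℤ}
    (h : ∀ f : X.obj ⟶ Y.obj⟦n⟧, f = 0) (f : X ⟶ Y⟦n⟧) : f = 0 := by
  apply (isBoundedFinDim k R).ι.map_injective
  rw [← cancel_mono (((isBoundedFinDim k R).ι.commShiftIso n).hom.app Y), Functor.map_zero,
    zero_comp]
  exact h _

variable {M N : ModuleCat.{u} R} {hM : isFinDim k R M} {hN : isFinDim k R N}

/-- The morphism of the bounded derived category that is given by a morphism of modules. -/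
def mapOf (hM : isFinDim k R M) (hN : isFinDim k R N) (f : M ⟶ N) : of k M hM ⟶ of k N hN :=
  ObjectProperty.homMk ((DerivedCategory.singleFunctor _ 0).map f)

theorem exists_eq_mapOf (f : of k M hM ⟶ of k N hN) : ∃ g, f = mapOf hM hN g := by
  obtain ⟨g, hg⟩ := (DerivedCategory.singleFunctor (ModuleCat.{u} R) 0).map_surjective f.hom
  exact ⟨g, ObjectProperty.hom_ext _ hg.symm⟩

theorem mapOf_injective : Function.Injective (mapOf hM hN) := fun _ _ h =>
  (DerivedCategory.singleFunctor (ModuleCat.{u} R) 0).map_injective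
    (congrArg (fun g => g.hom) h)

theorem mapOf_zero : mapOf hM hN 0 = 0 :=
  ObjectProperty.hom_ext _ ((DerivedCategory.singleFunctor (ModuleCat.{u} R) 0).map_zero M N)

theorem mapOf_id : mapOf hM hM (𝟙 M) = 𝟙 (of k M hM) :=
  ObjectProperty.hom_ext _ ((DerivedCategory.singleFunctor (ModuleCat.{u} R) 0).map_id M)

theorem mapOf_comp {L : ModuleCat.{u} R} {hL : isFinDim k R L} (f : L ⟶ M) (g : M ⟶ N) :
    mapOf hL hN (f ≫ g) = mapOf hL hM f ≫ mapOf hM hN g :=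
  ObjectProperty.hom_ext _ ((DerivedCategory.singleFunctor (ModuleCat.{u} R) 0).map_comp f g)

theorem mapOf_add (f g : M ⟶ N) : mapOf hM hN (f + g) = mapOf hM hN f + mapOf hM hN g :=
  ObjectProperty.hom_ext _ (DerivedCategory.singleFunctor (ModuleCat.{u} R) 0).map_add

theorem mapOf_smul (c : k) (f : M ⟶ N) : mapOf hM hN (c • f) = c • mapOf hM hN f :=
  ObjectProperty.hom_ext _
    ((DerivedCategory.singleFunctor (ModuleCat.{u} R) 0).map_smul c f)

theorem exists_distinguished {S : ShortComplex (ModuleCat.{u} R)} (hS : S.ShortExact)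
    (h₁ : isFinDim k R S.X₁) (h₂ : isFinDim k R S.X₂) (h₃ : isFinDim k R S.X₃) :
    ∃ δ : of k S.X₃ h₃ ⟶ (of k S.X₁ h₁)⟦(1 : ℤ)⟧,
      Triangle.mk (mapOf h₁ h₂ S.f) (mapOf h₂ h₃ S.g) δ ∈ distTriang (BoundedDerived k R) := by
  refine ⟨(isBoundedFinDim k R).fullyFaithfulι.preimage (hS.singleδ ≫
    ((isBoundedFinDim k R).ι.commShiftIso (1 : ℤ)).inv.app (of k S.X₁ h₁)), ?_⟩
  refine isomorphic_distinguished _ hS.singleTriangle_distinguished _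
    (Triangle.isoMk _ _ (Iso.refl _) (Iso.refl _) (Iso.refl _) ?_ ?_ ?_)
  · exact (Category.comp_id _).trans (Category.id_comp _).symm
  · exact (Category.comp_id _).trans (Category.id_comp _).symm
  · refine (congrArg (_ ≫ ·) ((shiftFunctor _ (1 : ℤ)).map_id _)).trans
      ((Category.comp_id _).trans (Eq.trans ?_ (Category.id_comp _).symm))
    refine (Category.assoc _ _ _).trans ((congrArg (hS.singleδ ≫ ·) (Iso.inv_hom_id_app
      ((isBoundedFinDim k R).ι.commShiftIso (1 : ℤ)) (of k S.X₁ h₁))).trans (Category.comp_id _))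

theorem hom_eq_zero_of_neg {n : ℤ} (hn : n < 0) (f : of k M hM ⟶ (of k N hN)⟦n⟧) : f = 0 := by
  refine eq_zero_of_forall_eq_zero (fun f => ?_) f
  have h₁ : DerivedCategory.TStructure.t.IsLE (of k M hM).obj 0 :=
    inferInstanceAs (((DerivedCategory.singleFunctor (ModuleCat.{u} R) 0).obj M).IsLE 0)
  have h₂ : DerivedCategory.TStructure.t.IsGE (of k N hN).obj 0 :=
    inferInstanceAs (((DerivedCategory.singleFunctor (ModuleCat.{u} R) 0).obj N).IsGE 0)
  have := DerivedCategory.TStructure.t.isGE_shift (of k N hN).obj 0 n (-n)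
  exact DerivedCategory.TStructure.t.zero f 0 (-n)

theorem hom_eq_zero_of_projective [Projective M] {n : ℤ} (hn : n ≠ 0)
    (f : of k M hM ⟶ (of k N hN)⟦n⟧) : f = 0 := by
  obtain hn | hn := lt_or_gt_of_ne hn
  · exact hom_eq_zero_of_neg hn f
  · refine eq_zero_of_forall_eq_zero (fun f => ?_) f
    obtain ⟨m, rfl⟩ : ∃ m : ℕ, n = ((m + 1 : ℕ) : ℤ) := ⟨(n - 1).toNat, by omega⟩
    have := HasExt.standard (ModuleCat.{u} R)
    obtain ⟨e, rfl⟩ := (Abelian.Ext.homEquiv (C := ModuleCat.{u} R) (X := M) (Y := N)).surjective f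
    rw [Abelian.Ext.eq_zero_of_projective e]
    exact Abelian.Ext.zero_hom _ _ _

theorem exists_eq_mk₀_mapOf (f : of k M hM ⟶ (of k N hN)⟦(0 : ℤ)⟧) :
    ∃ g, f = ShiftedHom.mk₀ (0 : ℤ) rfl (mapOf hM hN g) := by
  obtain ⟨f, rfl⟩ := (ShiftedHom.homEquiv (0 : ℤ) rfl).surjective f
  obtain ⟨g, rfl⟩ := exists_eq_mapOf f
  exact ⟨g, rfl⟩

theorem mapOf_comp_mk₀ {L : ModuleCat.{u} R} {hL : isFinDim k R L} (f : L ⟶ M) (g : M ⟶ N) :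
    mapOf hL hM f ≫ ShiftedHom.mk₀ (0 : ℤ) rfl (mapOf hM hN g) =
      ShiftedHom.mk₀ (0 : ℤ) rfl (mapOf hL hN (f ≫ g)) := by
  rw [mapOf_comp (hM := hM)]
  exact (Category.assoc _ _ _).symm

theorem hom_eq_zero_of_projective_of_forall [Projective M] (h : ∀ f : M ⟶ N, f = 0) (n : ℤ)
    (f : of k M hM ⟶ (of k N hN)⟦n⟧) : f = 0 := by
  by_cases hn : n = 0
  · subst hn
    obtain ⟨g, rfl⟩ := exists_eq_mk₀_mapOf f
    rw [h g, mapOf_zero, ShiftedHom.mk₀_zero]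
  · exact hom_eq_zero_of_projective hn f

theorem bijective_mapOf_comp {P P' : ModuleCat.{u} R} [Projective P] [Projective P']
    {hP : isFinDim k R P} {hP' : isFinDim k R P'} {d : P' ⟶ P}
    (h : Function.Bijective fun f : P ⟶ N => d ≫ f) (n : ℤ) :
    Function.Bijective fun f : of k P hP ⟶ (of k N hN)⟦n⟧ => mapOf hP' hP d ≫ f := by
  by_cases hn : n = 0
  · subst hn
    constructor
    · intro f f' hf
      obtain ⟨g, rfl⟩ := exists_eq_mk₀_mapOf f
      obtain ⟨g', rfl⟩ := exists_eq_mk₀_mapOf f'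
      dsimp only at hf
      rw [mapOf_comp_mk₀, mapOf_comp_mk₀] at hf
      rw [h.1 (mapOf_injective ((ShiftedHom.homEquiv (0 : ℤ) rfl).injective hf))]
    · intro f
      obtain ⟨g, rfl⟩ := exists_eq_mk₀_mapOf f
      obtain ⟨g', rfl⟩ := h.2 g
      exact ⟨ShiftedHom.mk₀ (0 : ℤ) rfl (mapOf hP hN g'), mapOf_comp_mk₀ _ _⟩
  · exact ⟨fun f f' _ => (hom_eq_zero_of_projective hn f).trans
      (hom_eq_zero_of_projective hn f').symm, fun f =>
        ⟨0, comp_zero.trans (hom_eq_zero_of_projective hn f).symm⟩⟩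

end BoundedDerived

namespace CyclicAlgebra

variable {k : Type u} [Field k] {r : ℕ} [NeZero r]

theorem isFinDim_radical (i : CyclicQuiver r) :
    isFinDim k (CyclicAlgebra k r)ᵐᵒᵖ (radical k r i) :=
  (isFinDim k (CyclicAlgebra k r)ᵐᵒᵖ).prop_X₁_of_shortExact (topSequence_shortExact i)
    (isFinDim_proj k r i)

variable [HasDerivedCategory.{w} (ModuleCat.{u} (CyclicAlgebra k r)ᵐᵒᵖ)]

open BoundedDerived

variable (k r) in
/-- The minimal projective resolution of `S_i`, whose first syzygy is the radical of `P_i`. -/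
def periodicResolution (i : CyclicQuiver r) :
    PeriodicResolution (simpleObj k r i) (projObj k r i) (projObj k r (i + 1)) where
  M := BoundedDerived.of k (radical k r i) (isFinDim_radical i)
  i := mapOf (isFinDim_radical i) (isFinDim_proj k r i) (radicalι i)
  p := mapOf (isFinDim_proj k r i) (isFinDim_simple k r i) (projToSimple i)
  α := (exists_distinguished (topSequence_shortExact i) (isFinDim_radical i)
    (isFinDim_proj k r i) (isFinDim_simple k r i)).choose
  j := mapOf (isFinDim_simple k r i) (isFinDim_proj k r (i + 1)) (socleι i)
  q := mapOf (isFinDim_proj k r (i + 1)) (isFinDim_radical i) (projToRadical i)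
  β := (exists_distinguished (socleSequence_shortExact i) (isFinDim_simple k r i)
    (isFinDim_proj k r (i + 1)) (isFinDim_radical i)).choose
  distinguished := (exists_distinguished (topSequence_shortExact i) _ _ _).choose_spec
  distinguished' := (exists_distinguished (socleSequence_shortExact i) _ _ _).choose_spec

theorem simpleObj_hom_simpleObj_eq_zero_of_neg (i j : CyclicQuiver r) {n : ℤ} (hn : n < 0)
    (f : simpleObj k r i ⟶ (simpleObj k r j)⟦n⟧) : f = 0 :=
  hom_eq_zero_of_neg hn f

theorem projObj_hom_simpleObj_eq_zero {i j : CyclicQuiver r} (h : i ≠ j) (n : ℤ)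
    (f : projObj k r i ⟶ (simpleObj k r j)⟦n⟧) : f = 0 :=
  hom_eq_zero_of_projective_of_forall (fun f => proj_hom_simple_eq_zero h f) n f

theorem simpleObj_hom_simpleObj_eq_zero {i j : CyclicQuiver r} (h : i ≠ j) (h' : i + 1 ≠ j)
    (n : ℤ) (f : simpleObj k r i ⟶ (simpleObj k r j)⟦n⟧) : f = 0 := by
  refine (periodicResolution k r i).hom_eq_zero (fun n => ⟨fun f f' _ => ?_, fun f => ⟨0, ?_⟩⟩)
    (fun n hn f => simpleObj_hom_simpleObj_eq_zero_of_neg i j hn f) n f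
  · rw [projObj_hom_simpleObj_eq_zero h n f, projObj_hom_simpleObj_eq_zero h n f']
  · exact comp_zero.trans (projObj_hom_simpleObj_eq_zero h' n f).symm

theorem simpleObj_hom_projObj_eq_zero {i j : CyclicQuiver r} (h : j ≠ i) (n : ℤ)
    (f : simpleObj k r j ⟶ (projObj k r (i + 1))⟦n⟧) : f = 0 := by
  refine (periodicResolution k r j).hom_eq_zero (fun n => ?_)
    (fun n hn f => hom_eq_zero_of_neg hn f) n f
  have := bijective_mapOf_comp (hP := isFinDim_proj k r j) (hP' := isFinDim_proj k r (j + 1))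
    (hN := isFinDim_proj k r (i + 1))
    ⟨injective_projToRadical_comp (k := k) h, surjective_projToRadical_comp h⟩ n
  rw [mapOf_comp (hM := isFinDim_radical j)] at this
  exact this

theorem isSemiorthogonal_simpleSeq (i : CyclicQuiver r) :
    IsSemiorthogonal (simpleSeq k r i) := by
  intro a b hab n f
  have hb : (b : ℕ) + 1 < r := by have := b.2; omega
  refine simpleObj_hom_simpleObj_eq_zero (fun h => ?_) (fun h => ?_) n f
  · exact (Fin.ne_of_lt hab).symm (Fin.ext (CyclicQuiver.natCast_injective_of_lt (by omega)
      (by omega) (add_left_cancel h)))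
  · have hba : (((b : ℕ) + 1 : ℕ) : CyclicQuiver r) = ((a : ℕ) : CyclicQuiver r) := by
      rw [Nat.cast_add, Nat.cast_one]
      rw [add_assoc] at h
      exact add_left_cancel h
    have := CyclicQuiver.natCast_injective_of_lt hb (by omega) hba
    exact absurd (Fin.lt_def.1 hab) (by omega)

theorem simpleObj_end_eq_smul (i : CyclicQuiver r) (φ : simpleObj k r i ⟶ simpleObj k r i) :
    ∃ c : k, φ = c • 𝟙 (simpleObj k r i) := by
  obtain ⟨g, rfl⟩ := exists_eq_mapOf φ
  obtain ⟨c, rfl⟩ := exists_simple_hom_eq_smul g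
  exact ⟨c, by rw [mapOf_smul, mapOf_id]; rfl⟩

theorem simpleObj_id_ne_zero (i : CyclicQuiver r) : 𝟙 (simpleObj k r i) ≠ 0 := fun h =>
  simple_id_ne_zero (k := k) i (mapOf_injective (hM := isFinDim_simple k r i)
    (hN := isFinDim_simple k r i) ((mapOf_id.trans h).trans mapOf_zero.symm))

theorem bijective_aeval_θ (i : CyclicQuiver r) (hr : 2 ≤ r) :
    Function.Bijective (Polynomial.aeval (R := k)
      (DirectSum.of (fun n : ℤ => ShiftedHom (simpleObj k r i) (simpleObj k r i) n) 2
        (periodicResolution k r i).θ : ExtAlgebra (simpleObj k r i))) := by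
  have hneg (n : ℤ) (hn : n < 0) (φ : simpleObj k r i ⟶ (simpleObj k r i)⟦n⟧) : φ = 0 :=
    simpleObj_hom_simpleObj_eq_zero_of_neg i i hn φ
  have hi : i + 1 ≠ i := by
    simpa only [Nat.cast_zero, add_zero] using
      CyclicQuiver.add_natCast_ne i ⟨0, by omega⟩
  have hP' : ∀ (n : ℤ) (φ : projObj k r (i + 1) ⟶ (simpleObj k r i)⟦n⟧), φ = 0 :=
    projObj_hom_simpleObj_eq_zero hi
  have hP : ∀ n : ℤ, n ≠ 0 → ∀ φ : projObj k r i ⟶ (simpleObj k r i)⟦n⟧, φ = 0 :=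
    fun n hn φ => hom_eq_zero_of_projective hn φ
  have hlow (n : ℤ) (hn : n < 2) (hn₀ : n ≠ 0)
      (φ : ShiftedHom (simpleObj k r i) (simpleObj k r i) n) : φ = 0 := by
    obtain ⟨χ, rfl⟩ := (periodicResolution k r i).exists_eq_θ_comp hP' hP (sub_add_cancel n 2) hn₀ φ
    rw [hneg (n - 2) (by omega) χ, ShiftedHom.comp_zero]
  exact ⟨ExtAlgebra.aeval_injective hneg k (simpleObj_id_ne_zero i) two_pos
      fun _ _ hmn hm φ => (periodicResolution k r i).eq_zero_of_θ_comp_eq_zero hP' hP hmn hm φ,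
    ExtAlgebra.aeval_surjective k two_pos hlow (simpleObj_end_eq_smul i)
      fun _ _ hmn hm φ => (periodicResolution k r i).exists_eq_θ_comp hP' hP hmn (by omega) φ⟩

end CyclicAlgebra

section Coproducts

variable {C : Type u} [Category.{v} C] [Abelian C] {ι : Type*} {K : ι → CochainComplex C ℤ}
  {L P : CochainComplex C ℤ} {i : ∀ m, K m ⟶ P}

/-- Homotopies to zero on the summands define a homotopy to zero on a degreewise coproduct. -/
def homotopyZeroOfCoproduct
    (hP : ∀ n : ℤ, IsColimit (Cofan.mk (P.X n) fun m => (i m).f n))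
    {f : P ⟶ L} (h : ∀ m, Homotopy (i m ≫ f) 0) : Homotopy f 0 where
  hom a b := Cofan.IsColimit.desc (hP a) fun m => (h m).hom a b
  zero a b hab := by
    refine Cofan.IsColimit.hom_ext (hP a) _ _ fun m => ?_
    rw [Cofan.IsColimit.fac, comp_zero, (h m).zero a b hab]
  comm a := by
    refine Cofan.IsColimit.hom_ext (hP a) _ _ fun m => ?_
    have hm := (h m).comm a
    have hfac (a b : ℤ) : (i m).f a ≫ Cofan.IsColimit.desc (hP a) (fun m => (h m).hom a b) =
        (h m).hom a b := Cofan.IsColimit.fac (hP a) (fun m => (h m).hom a b) m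
    rw [dNext_eq _ (show (ComplexShape.up ℤ).Rel a (a + 1) from rfl),
      prevD_eq _ (show (ComplexShape.up ℤ).Rel (a - 1) a from sub_add_cancel a 1)] at hm ⊢
    change (i m).f a ≫ f.f a = (i m).f a ≫ _
    rw [Preadditive.comp_add, Preadditive.comp_add, (i m).comm_assoc, hfac, ← Category.assoc,
      hfac]
    simpa using hm

theorem isKProjective_of_coproduct [∀ m, (K m).IsKProjective]
    (hP : ∀ n : ℤ, IsColimit (Cofan.mk (P.X n) fun m => (i m).f n)) : P.IsKProjective where
  nonempty_homotopy_zero f hL :=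
    ⟨homotopyZeroOfCoproduct hP fun m => CochainComplex.IsKProjective.homotopyZero (i m ≫ f) hL⟩

variable [HasDerivedCategory.{w} C]

open DerivedCategory

theorem exists_Q_map_eq [P.IsKProjective] (φ : Q.obj P ⟶ Q.obj L) : ∃ f : P ⟶ L, φ = Q.map f := by
  obtain ⟨g, hg⟩ := (CochainComplex.IsKProjective.Qh_map_bijective P _).2
    ((quotientCompQhIso C).hom.app P ≫ φ ≫ (quotientCompQhIso C).inv.app L)
  obtain ⟨f, rfl⟩ := (HomotopyCategory.quotient _ _).map_surjective g
  refine ⟨f, ?_⟩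
  rw [← cancel_mono ((quotientCompQhIso C).inv.app L), quotientCompQhIso_inv_naturality, hg]
  simp

theorem nonempty_homotopy_zero_of_Q_map_eq_zero [P.IsKProjective] {f : P ⟶ L}
    (hf : Q.map f = 0) : Nonempty (Homotopy f 0) := by
  refine ⟨HomotopyCategory.homotopyOfEq _ _ ?_⟩
  apply (CochainComplex.IsKProjective.Qh_map_bijective P _).1
  rw [← cancel_mono ((quotientCompQhIso C).hom.app L), quotientCompQhIso_hom_naturality,
    hf, Functor.map_zero, Functor.map_zero, zero_comp, comp_zero]

theorem Q_map_eq_zero_of_homotopy {f : P ⟶ L} (h : Homotopy f 0) : Q.map f = 0 := by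
  rw [← cancel_epi ((quotientCompQhIso C).hom.app P), ← quotientCompQhIso_hom_naturality,
    HomotopyCategory.eq_of_homotopy f 0 h, Functor.map_zero, Functor.map_zero, zero_comp, comp_zero]

theorem exists_forall_Q_map_comp_eq [∀ m, (K m).IsKProjective] (hP : IsColimit (Cofan.mk P i))
    {X : DerivedCategory C} (φ : ∀ m, Q.obj (K m) ⟶ X) :
    ∃ ψ : Q.obj P ⟶ X, ∀ m, Q.map (i m) ≫ ψ = φ m := by
  obtain ⟨L, ⟨e⟩⟩ : ∃ L, Nonempty (Q.obj L ≅ X) := ⟨_, ⟨Q.objObjPreimageIso X⟩⟩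
  choose f hf using fun m => exists_Q_map_eq (φ m ≫ e.inv)
  refine ⟨Q.map (Cofan.IsColimit.desc hP f) ≫ e.hom, fun m => ?_⟩
  have hm : i m ≫ Cofan.IsColimit.desc hP f = f m := Cofan.IsColimit.fac hP f m
  rw [← Category.assoc, ← Q.map_comp, hm, ← hf, Category.assoc, Iso.inv_hom_id,
    Category.comp_id]

theorem eq_zero_of_forall_Q_map_comp_eq_zero [∀ m, (K m).IsKProjective]
    (hP : ∀ n : ℤ, IsColimit (Cofan.mk (P.X n) fun m => (i m).f n))
    {X : DerivedCategory C} (ψ : Q.obj P ⟶ X) (h : ∀ m, Q.map (i m) ≫ ψ = 0) : ψ = 0 := by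
  have := isKProjective_of_coproduct hP
  obtain ⟨L, ⟨e⟩⟩ : ∃ L, Nonempty (Q.obj L ≅ X) := ⟨_, ⟨Q.objObjPreimageIso X⟩⟩
  obtain ⟨f, hf⟩ := exists_Q_map_eq (ψ ≫ e.inv)
  have hf' (m) : Q.map (i m ≫ f) = 0 := by
    rw [Q.map_comp, ← hf, ← Category.assoc, h, zero_comp]
  rw [← cancel_mono e.inv, zero_comp, hf]
  exact Q_map_eq_zero_of_homotopy (homotopyZeroOfCoproduct hP fun m =>
    (nonempty_homotopy_zero_of_Q_map_eq_zero (hf' m)).some)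

theorem nonempty_isColimit_Q [∀ m, (K m).IsKProjective] [HasColimitsOfShape (Discrete ι) C]
    (hP : IsColimit (Cofan.mk P i)) :
    Nonempty (IsColimit (Cofan.mk (Q.obj P) fun m => Q.map (i m))) := by
  have hP' (n : ℤ) : IsColimit (Cofan.mk (P.X n) fun m => (i m).f n) :=
    isColimitCofanMkObjOfIsColimit (HomologicalComplex.eval C (ComplexShape.up ℤ) n) _ _ hP
  choose desc hdesc using fun s : Cofan fun m => Q.obj (K m) =>
    exists_forall_Q_map_comp_eq hP s.inj
  refine ⟨Cofan.IsColimit.mk _ desc hdesc fun s ψ hψ => ?_⟩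
  rw [← sub_eq_zero]
  refine eq_zero_of_forall_Q_map_comp_eq_zero hP' _ fun m => ?_
  rw [Preadditive.comp_sub, sub_eq_zero, hdesc]
  exact hψ m

theorem hasCoproduct_of_iso_Q [∀ m, (K m).IsKProjective] [HasColimitsOfShape (Discrete ι) C]
    {X : ι → DerivedCategory C} (e : ∀ m, X m ≅ Q.obj (K m)) : HasCoproduct X := by
  obtain ⟨h⟩ := nonempty_isColimit_Q (K := K) (i := Sigma.ι K) (coproductIsCoproduct K)
  have : HasCoproduct fun m => Q.obj (K m) := ⟨⟨⟨_, h⟩⟩⟩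
  exact hasColimit_of_iso (Discrete.natIso fun ⟨m⟩ => e m :
    Discrete.functor X ≅ Discrete.functor fun m => Q.obj (K m))

theorem hasCoproduct_shift_singleFunctor [EnoughProjectives C] [HasColimitsOfShape (Discrete ι) C]
    (M : C) (a : ι → ℤ) :
    HasCoproduct fun m => ((singleFunctor C 0).obj M)⟦a m⟧ := by
  have := HasExt.standard C
  let R := ProjectiveResolution.of M
  have hR : IsIso (Q.map R.π') := by
    rw [isIso_Q_map_iff_quasiIso]
    infer_instance
  exact hasCoproduct_of_iso_Q (K := fun m => R.cochainComplex⟦a m⟧) fun m =>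
    (shiftFunctor _ (a m)).mapIso ((singleFunctorIsoCompQ C 0).app M ≪≫ (asIso (Q.map R.π')).symm)
      ≪≫ (Q.commShiftIso (a m)).symm.app R.cochainComplex

end Coproducts

section Hocolim

variable {C : Type u} [Category.{v} C] [Abelian C] [HasDerivedCategory.{w} C]

open DerivedCategory

theorem homologyFunctor_map_eq_zero_of_ι_comp {ι : Type*} {X : ι → DerivedCategory C}
    [HasCoproduct X] {Y : DerivedCategory C} {n : ℤ} {τ : ∐ X ⟶ Y}
    (hτ : ∀ m, Sigma.ι X m ≫ τ = 0 ∨ (X m).IsLE (n - 1)) : (homologyFunctor C n).map τ = 0 := by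
  obtain ⟨A, B, hA, hB, f, g, h, hT⟩ := TStructure.t.exists_triangle Y (n - 1) n (by omega)
  have hA' : A.IsLE (n - 1) := ⟨hA⟩
  have hB' : B.IsGE n := ⟨hB⟩
  have hτg : τ ≫ g = 0 := by
    refine Sigma.hom_ext _ _ fun m => ?_
    rw [comp_zero, ← Category.assoc]
    obtain hm | hm := hτ m
    · rw [hm, zero_comp]
    · exact TStructure.t.zero _ (n - 1) n
  obtain ⟨ψ, rfl⟩ : ∃ ψ : ∐ X ⟶ A, τ = ψ ≫ f := Triangle.coyoneda_exact₂ _ hT τ hτg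
  rw [Functor.map_comp, (isZero_of_isLE A (n - 1) n (by omega)).eq_of_src
    ((homologyFunctor C n).map f) 0, comp_zero]

/-- Cohomology need not commute with the coproduct, but the finitely many summands with cohomology
in degree `n` can be split off. -/
theorem homologyFunctor_map_eq_zero_of_forall_ι_comp {ι : Type*} {X : ι → DerivedCategory C}
    [HasCoproduct X] {Y : DerivedCategory C} {n : ℤ} (s : Finset ι)
    (hX : ∀ m ∉ s, (X m).IsLE (n - 1)) (σ : ∐ X ⟶ Y)
    (hσ : ∀ m, (homologyFunctor C n).map (Sigma.ι X m ≫ σ) = 0) :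
    (homologyFunctor C n).map σ = 0 := by
  classical
  let σ' := ∑ m ∈ s, Sigma.π X m ≫ Sigma.ι X m ≫ σ
  have hσ' : (homologyFunctor C n).map σ' = 0 := by
    rw [Functor.map_sum]
    exact Finset.sum_eq_zero fun m _ => by rw [Functor.map_comp, hσ, comp_zero]
  have hι (m : ι) (hm : m ∈ s) : Sigma.ι X m ≫ σ' = Sigma.ι X m ≫ σ := by
    rw [Preadditive.comp_sum, Finset.sum_eq_single_of_mem m hm fun j _ hj => by
      rw [Sigma.ι_π_of_ne_assoc _ hj.symm, zero_comp], Sigma.ι_π_eq_id_assoc]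
  have hsub : (homologyFunctor C n).map (σ - σ') = 0 := by
    refine homologyFunctor_map_eq_zero_of_ι_comp fun m => ?_
    by_cases hm : m ∈ s
    · exact Or.inl (by rw [Preadditive.comp_sub, hι m hm, sub_self])
    · exact Or.inr (hX m hm)
  rwa [Functor.map_sub, hσ', sub_zero] at hsub

theorem isHocolim_zero {X : ℕ → DerivedCategory C} [HasCoproduct X] (f : ∀ m, X m ⟶ X (m + 1))
    (hX : ∀ n : ℤ, ∃ N : ℕ, ∀ m, N ≤ m → (X m).IsLE n)
    (hf : ∀ (m : ℕ) (n : ℤ), (homologyFunctor C n).map (f m) = 0) :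
    ∃ Y, IsHocolim X f Y ∧ IsZero Y := by
  let σ : ∐ X ⟶ ∐ X :=
    Cofan.IsColimit.desc (coproductIsCoproduct X) fun n => f n ≫ Sigma.ι X (n + 1)
  have hισ (m : ℕ) : Sigma.ι X m ≫ σ = f m ≫ Sigma.ι X (m + 1) :=
    Cofan.IsColimit.fac (coproductIsCoproduct X) _ m
  have hσ (n : ℤ) : (homologyFunctor C n).map σ = 0 := by
    obtain ⟨N, hN⟩ := hX (n - 1)
    refine homologyFunctor_map_eq_zero_of_forall_ι_comp (Finset.range N)
      (fun m hm => hN m (by simpa using hm)) σ fun m => ?_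
    rw [hισ, Functor.map_comp, hf, zero_comp]
  have hiso : IsIso (𝟙 (∐ X) - σ) := by
    rw [DerivedCategory.isIso_iff]
    intro n
    rw [Functor.map_sub, hσ, sub_zero, CategoryTheory.Functor.map_id]
    infer_instance
  obtain ⟨Y, g, h, hT⟩ := distinguished_cocone_triangle (𝟙 (∐ X) - σ)
  exact ⟨Y, ⟨_, coproductIsCoproduct X, g, h, hT⟩, Triangle.isZero₃_of_isIso₁ _ hT hiso⟩

theorem isHocolim_zero_of_singleFunctor [EnoughProjectives C] [HasColimitsOfShape (Discrete ℕ) C]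
    (M : C) {q : ℤ} (hq : 0 < q)
    (θ : ShiftedHom ((singleFunctor C 0).obj M) ((singleFunctor C 0).obj M) q) :
    ∃ Y, IsHocolim (fun n : ℕ => ((singleFunctor C 0).obj M)⟦q * (n : ℤ)⟧)
      (fun n => shiftSequenceMap θ n) Y ∧ IsZero Y := by
  have := hasCoproduct_shift_singleFunctor M fun n : ℕ => q * (n : ℤ)
  have hLE (a : ℤ) : (((singleFunctor C 0).obj M)⟦a⟧).IsLE (-a) :=
    TStructure.t.isLE_shift _ 0 a (-a)
  have hGE (a : ℤ) : (((singleFunctor C 0).obj M)⟦a⟧).IsGE (-a) :=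
    TStructure.t.isGE_shift _ 0 a (-a)
  refine isHocolim_zero _ (fun n => ⟨n.natAbs, fun m hm => ?_⟩) (fun m n => ?_)
  · have : -(q * (m : ℤ)) ≤ n := by nlinarith [abs_le.1 (le_refl |n|), Int.natCast_natAbs n]
    exact TStructure.t.isLE_of_le _ _ n this
  · by_cases hn : n = -(q * (m : ℤ))
    · have : -(q * ((m + 1 : ℕ) : ℤ)) < n := by
        push_cast
        nlinarith
      exact (isZero_of_isLE _ _ n this).eq_of_tgt _ _
    · obtain hn | hn := lt_or_gt_of_ne hn
      · exact (isZero_of_isGE _ _ n hn).eq_of_src _ _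
      · exact (isZero_of_isLE _ _ n hn).eq_of_src _ _

end Hocolim

namespace CyclicAlgebra

variable {k : Type u} [Field k] {r : ℕ} [NeZero r]
  [HasDerivedCategory.{w} (ModuleCat.{u} (CyclicAlgebra k r)ᵐᵒᵖ)]

theorem isPInftyObject_simpleObj (i : CyclicQuiver r) (hr : 2 ≤ r) :
    IsPInftyObject k (isBoundedFinDim k (CyclicAlgebra k r)ᵐᵒᵖ).ι 2 (simpleObj k r i) :=
  ⟨AlgEquiv.ofBijective _ (bijective_aeval_θ i hr), (periodicResolution k r i).θ,
    Polynomial.aeval_X _, isHocolim_zero_of_singleFunctor (simple k r i) two_pos _⟩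

end CyclicAlgebra

section Generation

variable {k : Type u} [Field k] {R : Type u} [Ring R] [Algebra k R]

theorem finrank_cokernel_lt {M N : ModuleCat.{u} R} (hN : isFinDim k R N) {f : M ⟶ N}
    (hf : f ≠ 0) :
    Module.finrank k ((ModuleCat.restrictScalars (algebraMap k R)).obj (cokernel f)) <
      Module.finrank k ((ModuleCat.restrictScalars (algebraMap k R)).obj N) := by
  let π := ((ModuleCat.restrictScalars (algebraMap k R)).map (cokernel.π f)).hom
  have : Module.Finite k ((ModuleCat.restrictScalars (algebraMap k R)).obj N) := hN
  have : Module.Finite k ((ModuleCat.restrictScalars (algebraMap k R)).obj (cokernel f)) :=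
    (isFinDim k R).prop_of_epi (cokernel.π f) hN
  have hπ : Function.Surjective π := (ModuleCat.epi_iff_surjective (cokernel.π f)).1 inferInstance
  refine lt_of_le_of_ne (LinearMap.finrank_le_finrank_of_surjective hπ) fun heq => hf ?_
  have : Mono (cokernel.π f) := (ModuleCat.mono_iff_injective _).2
    ((LinearMap.injective_iff_surjective_of_finrank_eq_finrank heq.symm).2 hπ)
  rw [← cancel_mono (cokernel.π f), cokernel.condition, zero_comp]

variable [HasDerivedCategory.{w} (ModuleCat.{u} R)]

open DerivedCategory

theorem hasFinDimHomology_truncGE {X : DerivedCategory (ModuleCat.{u} R)}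
    (hX : hasFinDimHomology k R X) (b : ℤ) :
    hasFinDimHomology k R ((TStructure.t.truncGE b).obj X) := by
  intro n
  obtain hn | hn := lt_or_ge n b
  · exact (isFinDim k R).prop_of_isZero (isZero_of_isGE _ b n hn)
  · have : (((TStructure.t.truncLT b).obj X)⟦(1 : ℤ)⟧).IsLE (b - 2) :=
      TStructure.t.isLE_shift _ (b - 1) 1 (b - 2)
    exact (isFinDim k R).prop_X₂_of_exact
      ((homologyFunctor (ModuleCat.{u} R) n).map_distinguished_exact _
        (rot_of_distTriang _ (TStructure.t.triangleLTGE_distinguished b X)))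
      (hX n) ((isFinDim k R).prop_of_isZero
        (isZero_of_isLE (((TStructure.t.truncLT b).obj X)⟦(1 : ℤ)⟧) (b - 2) n (by omega)))

theorem exists_iso_singleFunctor_shift {X : DerivedCategory (ModuleCat.{u} R)}
    (hX : hasFinDimHomology k R X) (n : ℤ) [X.IsGE n] [X.IsLE n] :
    ∃ M, isFinDim k R M ∧ Nonempty (X ≅ ((singleFunctor _ 0).obj M)⟦-n⟧) := by
  obtain ⟨M, ⟨e⟩⟩ := exists_iso_singleFunctor_obj_of_isGE_of_isLE X n
  exact ⟨M, (isFinDim k R).prop_of_iso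
      ((homologyFunctor _ n).mapIso e ≪≫ (singleFunctorCompHomologyFunctorIso _ n).app M) (hX n),
    ⟨e ≪≫ (((singleFunctors (ModuleCat.{u} R)).shiftIso (-n) n 0 (by omega)).app M).symm⟩⟩

theorem prop_of_isGE_of_isLE {Q : ObjectProperty (DerivedCategory (ModuleCat.{u} R))}
    [Q.IsTriangulated] [Q.IsClosedUnderIsomorphisms]
    (hQ : ∀ M, isFinDim k R M → Q ((singleFunctor _ 0).obj M))
    {X : DerivedCategory (ModuleCat.{u} R)} (hX : hasFinDimHomology k R X) (a b : ℤ) [X.IsGE a]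
    [X.IsLE b] : Q X := by
  obtain ⟨n, hn⟩ : ∃ n : ℕ, b < a + n := ⟨(b - a + 1).toNat, by omega⟩
  induction n generalizing X b with
  | zero => exact Q.prop_of_isZero (TStructure.t.isZero X b a (by omega))
  | succ n ih =>
    have hT := TStructure.t.triangleLTGE_distinguished b X
    have hGE := hasFinDimHomology_truncGE hX b
    have hLT : hasFinDimHomology k R ((TStructure.t.truncLT b).obj X) :=
      (hasFinDimHomology k R).ext_of_isTriangulatedClosed₁ _ hT hX hGE
    obtain ⟨M, hM, ⟨e⟩⟩ := exists_iso_singleFunctor_shift hGE b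
    have hQLT : Q ((TStructure.t.truncLT b).obj X) :=
      ih hLT (b - 1) (by push_cast at hn; omega)
    exact Q.ext_of_isTriangulatedClosed₂ _ hT hQLT
      (Q.prop_of_iso e.symm (Q.le_shift (-b) _ (hQ M hM)))

theorem BoundedDerived.eq_top {Q : ObjectProperty (BoundedDerived k R)} [Q.IsTriangulated]
    [Q.IsClosedUnderIsomorphisms] (hQ : ∀ M hM, Q (BoundedDerived.of k M hM)) : Q = ⊤ := by
  rw [eq_top_iff]
  rintro X -
  obtain ⟨⟨⟨a, ha⟩, ⟨b, hb⟩⟩, hX⟩ := X.property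
  obtain ⟨Y, hY, ⟨e⟩⟩ := prop_of_isGE_of_isLE (Q := Q.map (isBoundedFinDim k R).ι)
    (fun M hM => Q.prop_map_obj _ (hQ M hM)) hX a b
  exact Q.prop_of_iso ((isBoundedFinDim k R).isoMk e) hY

end Generation

namespace CyclicAlgebra

open MulOpposite

variable {k : Type u} [Field k] {r : ℕ} [NeZero r]

theorem path_one_mul_mul_idem (i : CyclicQuiver r) (y : CyclicAlgebra k r) :
    path k r i 1 * y * idem k r i = 0 := by
  have hr : r - 1 < r := Nat.sub_lt (NeZero.pos r) one_pos
  have hy := idem_mul_mul_idem (i + 1) hr y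
  rw [CyclicQuiver.add_one_add_natCast_pred] at hy
  have hidem : path k r i 1 * idem k r (i + 1) = path k r i 1 :=
    path_mul_idem k r (by rw [Nat.cast_one])
  calc path k r i 1 * y * idem k r i
      = path k r i 1 * (idem k r (i + 1) * y * idem k r i) := by
        rw [← mul_assoc, ← mul_assoc, hidem]
    _ = coeff k r (i + 1) ⟨r - 1, hr⟩ y • path k r i (r - 1 + 1) := by
        rw [hy, mul_smul_comm, path_one_mul_path]
    _ = 0 := by rw [path_eq_zero _ (by omega), smul_zero]

variable [HasDerivedCategory.{w} (ModuleCat.{u} (CyclicAlgebra k r)ᵐᵒᵖ)]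

theorem prop_of_forall_simpleObj {Q : ObjectProperty (BoundedDerived k (CyclicAlgebra k r)ᵐᵒᵖ)}
    [Q.IsTriangulated] [Q.IsClosedUnderIsomorphisms]
    (N : ModuleCat.{u} (CyclicAlgebra k r)ᵐᵒᵖ) (hN : isFinDim k (CyclicAlgebra k r)ᵐᵒᵖ N)
    (hQ : ∀ j, (∃ z : N, op (idem k r j) • z ≠ 0) → Q (simpleObj k r j)) :
    Q (BoundedDerived.of k N hN) := by
  induction hd : Module.finrank k ((ModuleCat.restrictScalars
    (algebraMap k (CyclicAlgebra k r)ᵐᵒᵖ)).obj N) using Nat.strong_induction_on generalizing N with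
  | _ d ih =>
    subst hd
    by_cases h₀ : ∀ y : N, y = 0
    · have hid : 𝟙 N = 0 := by
        ext y
        exact h₀ y
      refine Q.prop_of_isZero ((IsZero.iff_id_eq_zero _).2 ?_)
      rw [← BoundedDerived.mapOf_id, hid, BoundedDerived.mapOf_zero]
    push Not at h₀
    obtain ⟨y, hy⟩ := h₀
    obtain ⟨j, f, hf, hj⟩ := exists_mono_simple hy
    have hf₀ : f ≠ 0 := by
      rintro rfl
      exact simple_id_ne_zero (k := k) j
        (by rw [← cancel_mono (0 : simple k r j ⟶ N), comp_zero, comp_zero])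
    have hS : (ShortComplex.mk f (cokernel.π f) (cokernel.condition f)).ShortExact :=
      ShortComplex.ShortExact.mk' (ShortComplex.exact_cokernel f) hf inferInstance
    have hC : isFinDim k (CyclicAlgebra k r)ᵐᵒᵖ (cokernel f) :=
      (isFinDim k (CyclicAlgebra k r)ᵐᵒᵖ).prop_of_epi (cokernel.π f) hN
    obtain ⟨δ, hT⟩ := BoundedDerived.exists_distinguished hS (isFinDim_simple k r j) hN hC
    refine Q.ext_of_isTriangulatedClosed₂ _ hT (hQ j hj)
      (ih _ (finrank_cokernel_lt hN hf₀) _ hC ?_ rfl)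
    rintro l ⟨z, hz⟩
    obtain ⟨z, rfl⟩ := (ModuleCat.epi_iff_surjective (cokernel.π f)).1 inferInstance z
    exact hQ l ⟨z, fun h => hz (by rw [← map_smul, h, map_zero])⟩

theorem absorbing_simpleObj {i j : CyclicQuiver r} (h : j ≠ i) :
    absorbing k r i (simpleObj k r j) := by
  obtain ⟨l, hl, rfl⟩ := exists_eq_add_natCast h
  exact le_generatedBy _ _ (ObjectProperty.ofObj_apply (simpleSeq k r i) ⟨l, by omega⟩)

instance (i : CyclicQuiver r) : (absorbing k r i).IsTriangulated :=
  generatedBy_isTriangulated _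

instance (i : CyclicQuiver r) : (absorbing k r i).IsClosedUnderIsomorphisms :=
  generatedBy_isClosedUnderIsomorphisms _

/-- The composition factors of the radical of `P_i` are the `S_j` for `j ≠ i`, since the only
multiple of `e_i` among the paths that start at `i` is the lazy one. -/
theorem absorbing_periodicResolution_M (i : CyclicQuiver r) :
    absorbing k r i (periodicResolution k r i).M := by
  refine prop_of_forall_simpleObj (radical k r i) (isFinDim_radical i) fun j hj =>
    absorbing_simpleObj ?_
  rintro rfl
  obtain ⟨⟨z, hz⟩, hj⟩ := hj
  obtain ⟨y, rfl⟩ := mem_radical_iff.1 hz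
  exact hj (Subtype.ext (path_one_mul_mul_idem j y))

section EqTop

variable {Q : ObjectProperty (BoundedDerived k (CyclicAlgebra k r)ᵐᵒᵖ)}
  [Q.IsTriangulated] [Q.IsClosedUnderIsomorphisms] {i : CyclicQuiver r}

theorem eq_top_of_absorbing_le (hQ : absorbing k r i ≤ Q) (h : Q (simpleObj k r i)) : Q = ⊤ := by
  refine BoundedDerived.eq_top fun M hM => prop_of_forall_simpleObj M hM fun j _ => ?_
  obtain rfl | hj := eq_or_ne j i
  · exact h
  · exact hQ _ (absorbing_simpleObj hj)

theorem eq_top_of_projObj (hQ : absorbing k r i ≤ Q) (h : Q (projObj k r i)) : Q = ⊤ :=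
  eq_top_of_absorbing_le hQ (Q.ext_of_isTriangulatedClosed₃ _
    (periodicResolution k r i).distinguished (hQ _ (absorbing_periodicResolution_M i)) h)

theorem eq_top_of_projObj_add_one (hQ : absorbing k r i ≤ Q) (h : Q (projObj k r (i + 1))) :
    Q = ⊤ :=
  eq_top_of_absorbing_le hQ (Q.ext_of_isTriangulatedClosed₁ _
    (periodicResolution k r i).distinguished' h (hQ _ (absorbing_periodicResolution_M i)))

end EqTop

theorem isSemiorthogonalDecomposition (i : CyclicQuiver r) :
    IsSemiorthogonalDecomposition ![absorbing k r i,
      generatedBy (ObjectProperty.singleton (projObj k r i))] := by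
  refine .of_generators ?_ (eq_top_of_projObj (i := i) ?_ ?_)
  · rintro _ _ ⟨⟩ ⟨a⟩ n f
    exact projObj_hom_simpleObj_eq_zero (CyclicQuiver.add_natCast_ne i a).symm n f
  · exact generatedBy_le (le_sup_right.trans (le_generatedBy _))
  · exact le_generatedBy _ _ (Or.inl (by simp))

theorem isSemiorthogonalDecomposition' (i : CyclicQuiver r) :
    IsSemiorthogonalDecomposition
      ![generatedBy (ObjectProperty.singleton (projObj k r (i + 1))), absorbing k r i] := by
  refine .of_generators ?_ (eq_top_of_projObj_add_one (i := i) ?_ ?_)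
  · rintro _ _ ⟨a⟩ ⟨⟩ n f
    exact simpleObj_hom_projObj_eq_zero (CyclicQuiver.add_natCast_ne i a) n f
  · exact generatedBy_le (le_sup_left.trans (le_generatedBy _))
  · exact le_generatedBy _ _ (Or.inr (by simp))

theorem isAdmissible_absorbing (i : CyclicQuiver r) : IsAdmissible (absorbing k r i) where
  isTriangulated := inferInstance
  rightAdmissible := (isSemiorthogonalDecomposition' i).isLeftAdjoint_ι
  leftAdmissible := (isSemiorthogonalDecomposition i).isRightAdjoint_ι

theorem leftOrthogonal_absorbing (i : CyclicQuiver r) : (absorbing k r i).leftOrthogonal =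
    generatedBy (ObjectProperty.singleton (projObj k r i)) :=
  (isSemiorthogonalDecomposition i).leftOrthogonal_eq

theorem rightOrthogonal_absorbing (i : CyclicQuiver r) : (absorbing k r i).rightOrthogonal =
    generatedBy (ObjectProperty.singleton (projObj k r (i + 1))) :=
  (isSemiorthogonalDecomposition' i).rightOrthogonal_eq

end CyclicAlgebra

section Smooth

theorem bijective_of_apply_tmul {k : Type u} {A : Type v} [CommSemiring k] [Semiring A]
    [Algebra k A] (h : Function.Bijective (algebraMap k A)) {φ : TensorProduct k A A →ₗ[k] A}
    (hφ : ∀ a b : A, φ (TensorProduct.tmul k a b) = a * b) : Function.Bijective φ := by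
  let e : k ≃ₐ[k] A := AlgEquiv.ofBijective (Algebra.ofId k A) h
  let μ : TensorProduct k A A ≃ₗ[k] A :=
    TensorProduct.congr e.symm.toLinearEquiv (.refl k A) ≪≫ₗ TensorProduct.lid k A
  have hμ : φ = μ.toLinearMap := TensorProduct.ext' fun a b => by
    obtain ⟨c, rfl⟩ := e.surjective a
    change φ _ = e.symm (e c) • b
    rw [hφ, e.symm_apply_apply, Algebra.smul_def]
    rfl
  rw [hμ]
  exact μ.bijective

theorem DGAlgebra.d_one {k : Type u} [Field k] (E : DGAlgebra.{u, v} k) : E.d 1 = 0 := by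
  have h := E.d_mul 1 E.one_mem
  rwa [mul_one, mul_one, one_mul, Int.negOnePow_zero, one_smul, left_eq_add] at h

theorem DGAlgebra.isSmooth_of_bijective {k : Type u} [Field k] (E : DGAlgebra.{u, v} k)
    (h : Function.Bijective (algebraMap k E.carrier)) : E.IsSmooth :=
  DGBimodule.IsPerfect.free ⟨0, (1 : E.carrier), E.one_mem, E.d_one,
    bijective_of_apply_tmul h fun a b => congrArg (a * ·) (one_mul b)⟩

section DGEnd

open CochainComplex.HomComplex

variable {C : Type w} [Category.{v} C] [Preadditive C] {K : CochainComplex C ℤ}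

theorem cochain_eq_zero (hK : ∀ p : ℤ, p ≠ 0 → IsZero (K.X p)) {n : ℤ} (hn : n ≠ 0)
    (f : Cochain K K n) : f = 0 := by
  ext p q hpq
  by_cases hp : p = 0
  · exact (hK q (by omega)).eq_of_tgt _ _
  · exact (hK p hp).eq_of_src _ _

theorem exists_cochain_eq_smul {k : Type u} [Ring k] [Linear k C]
    (hK : ∀ p : ℤ, p ≠ 0 → IsZero (K.X p)) (hEnd : ∀ f : K.X 0 ⟶ K.X 0, ∃ c : k, f = c • 𝟙 (K.X 0))
    (f : Cochain K K 0) : ∃ c : k, f = c • Cochain.ofHom (𝟙 K) := by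
  obtain ⟨c, hc⟩ := hEnd (f.v 0 0 (add_zero 0))
  refine ⟨c, Cochain.ext _ _ fun p q hpq => ?_⟩
  by_cases hp : p = 0
  · obtain rfl : q = p := by omega
    subst hp
    rw [hc, Cochain.smul_v, Cochain.ofHom_v]
    rfl
  · exact (hK p hp).eq_of_src _ _

theorem directSum_cochain_one : (1 : ⨁ n : ℤ, Cochain K K n) =
    DirectSum.of (fun n : ℤ => Cochain K K n) 0 (Cochain.ofHom (𝟙 K)) := rfl

variable {k : Type u} [Field k] [Linear k C]

theorem nontrivial_dgEnd {p : ℤ} (h : 𝟙 (K.X p) ≠ 0) : Nontrivial (dgEnd k K).carrier := by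
  refine ⟨1, 0, fun h₁ => h ?_⟩
  have hid : Cochain.ofHom (𝟙 K) = 0 :=
    DirectSum.of_injective (β := fun n : ℤ => Cochain K K n) 0
      ((directSum_cochain_one.symm.trans h₁).trans (map_zero _).symm)
  exact (Cochain.ofHom_v (𝟙 K) p).symm.trans
    (congrArg (fun z : Cochain K K 0 => z.v p p (add_zero p)) hid)

theorem bijective_algebraMap_dgEnd (hK : ∀ p : ℤ, p ≠ 0 → IsZero (K.X p)) (h₀ : 𝟙 (K.X 0) ≠ 0)
    (hEnd : ∀ f : K.X 0 ⟶ K.X 0, ∃ c : k, f = c • 𝟙 (K.X 0)) :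
    Function.Bijective (algebraMap k (dgEnd k K).carrier) := by
  have := nontrivial_dgEnd (k := k) h₀
  refine ⟨(algebraMap k (dgEnd k K).carrier).injective, ?_⟩
  change Function.Surjective (algebraMap k (⨁ n : ℤ, Cochain K K n))
  intro x
  induction x using DirectSum.induction_on with
  | zero => exact ⟨0, map_zero _⟩
  | add x y hx hy =>
    obtain ⟨a, rfl⟩ := hx
    obtain ⟨b, rfl⟩ := hy
    exact ⟨a + b, map_add _ _ _⟩
  | of n f =>
    by_cases hn : n = 0
    · subst hn
      obtain ⟨c, rfl⟩ := exists_cochain_eq_smul hK hEnd f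
      refine ⟨c, ?_⟩
      rw [Algebra.algebraMap_eq_smul_one, directSum_cochain_one, ← DirectSum.of_smul]
    · exact ⟨0, by rw [cochain_eq_zero hK hn f, map_zero, map_zero]⟩

end DGEnd

variable {k : Type u} [Field k] {R : Type u} [Ring R] [Algebra k R]
  [HasDerivedCategory.{w} (ModuleCat.{u} R)]

theorem isSmoothSubcategory_generatedBy {P : ModuleCat.{u} R} [Projective P]
    (hP : isFinDim k R P) (hid : 𝟙 P ≠ 0) (hEnd : ∀ f : P ⟶ P, ∃ c : k, f = c • 𝟙 P)
    [(generatedBy (ObjectProperty.singleton (BoundedDerived.of k P hP))).IsStableUnderRetracts] :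
    IsSmoothSubcategory k
      (generatedBy (ObjectProperty.singleton (BoundedDerived.of k P hP))) := by
  let K : CochainComplex (ModuleCat.{u} R) ℤ := (CochainComplex.singleFunctor _ 0).obj P
  let e : K.X 0 ≅ P := HomologicalComplex.singleObjXSelf (ComplexShape.up ℤ) 0 P
  have hK (p : ℤ) (hp : p ≠ 0) : IsZero (K.X p) :=
    HomologicalComplex.isZero_single_obj_X (ComplexShape.up ℤ) 0 P p hp
  have hproj (n : ℤ) : Projective (K.X n) := by
    by_cases hn : n = 0
    · subst hn
      exact Projective.of_iso e.symm inferInstance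
    · exact (hK n hn).projective
  refine ⟨K, BoundedDerived.of k P hP, CochainComplex.isKProjective_of_projective K 0,
    ⟨(DerivedCategory.singleFunctorIsoCompQ (ModuleCat.{u} R) 0).app P⟩,
    generatedBy_eq_triangEnvelope _,
    DGAlgebra.isSmooth_of_bijective _ (bijective_algebraMap_dgEnd hK ?_ fun f => ?_)⟩
  · intro h
    refine hid ?_
    rw [← e.inv_hom_id, ← Category.id_comp e.hom, h, zero_comp, comp_zero]
  · obtain ⟨c, hc⟩ := hEnd (e.inv ≫ f ≫ e.hom)
    refine ⟨c, ?_⟩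
    rw [← cancel_epi e.inv, ← cancel_mono e.hom, Category.assoc, hc, Linear.comp_smul,
      Linear.smul_comp, Category.comp_id, e.inv_hom_id]

theorem BoundedDerived.hasFiniteTotalHom_of_projective {M N : ModuleCat.{u} R} [Projective M]
    [Module.Finite k (M ⟶ N)] {hM : isFinDim k R M} {hN : isFinDim k R N} :
    HasFiniteTotalHom k (of k M hM) (of k N hN) := by
  refine ⟨fun n => ?_, 0, fun n hn f => hom_eq_zero_of_projective (by rintro rfl; simp at hn) f⟩
  by_cases hn : n = 0
  · subst hn
    let φ : (M ⟶ N) →ₗ[k] (of k M hM ⟶ (of k N hN)⟦(0 : ℤ)⟧) :=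
      { toFun f := ShiftedHom.mk₀ (0 : ℤ) rfl (mapOf hM hN f)
        map_add' f g := by rw [mapOf_add, ShiftedHom.mk₀_add]
        map_smul' c f := by rw [mapOf_smul, ShiftedHom.mk₀_smul, RingHom.id_apply] }
    refine Module.Finite.of_surjective φ fun f => ?_
    obtain ⟨g, rfl⟩ := exists_eq_mk₀_mapOf f
    exact ⟨g, rfl⟩
  · have : Subsingleton (of k M hM ⟶ (of k N hN)⟦n⟧) :=
      subsingleton_of_forall_eq 0 (hom_eq_zero_of_projective hn)
    infer_instance

end Smooth

namespace CyclicAlgebra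

variable {k : Type u} [Field k] {r : ℕ} [NeZero r]
  [HasDerivedCategory.{w} (ModuleCat.{u} (CyclicAlgebra k r)ᵐᵒᵖ)]

theorem isProperSubcategory_projObj (j : CyclicQuiver r) :
    IsProperSubcategory k (generatedBy (ObjectProperty.singleton (projObj k r j))) := by
  have : Module.Finite k (proj k r j ⟶ proj k r j) :=
    Module.Finite.of_surjective (LinearMap.toSpanSingleton k _ (𝟙 (proj k r j))) fun f =>
      (exists_proj_hom_eq_smul f).imp fun c hc => hc.symm
  refine HasFiniteTotalHom.isProperSubcategory_generatedBy ?_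
  rintro _ _ ⟨⟩ ⟨⟩
  exact BoundedDerived.hasFiniteTotalHom_of_projective

theorem isSmoothSubcategory_projObj (j : CyclicQuiver r) :
    IsSmoothSubcategory k (generatedBy (ObjectProperty.singleton (projObj k r j))) := by
  have : (generatedBy (ObjectProperty.singleton (BoundedDerived.of k _
      (isFinDim_proj k r j)))).IsStableUnderRetracts := by
    change (generatedBy (ObjectProperty.singleton (projObj k r j))).IsStableUnderRetracts
    rw [← leftOrthogonal_absorbing]
    infer_instance
  exact isSmoothSubcategory_generatedBy (isFinDim_proj k r j) (proj_id_ne_zero j)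
    exists_proj_hom_eq_smul

theorem absorbsSingularities_absorbing (i : CyclicQuiver r) :
    AbsorbsSingularities k (absorbing k r i) where
  isAdmissible := isAdmissible_absorbing i
  smooth_right := by
    rw [rightOrthogonal_absorbing]
    exact isSmoothSubcategory_projObj (i + 1)
  proper_right := by
    rw [rightOrthogonal_absorbing]
    exact isProperSubcategory_projObj (i + 1)
  smooth_left := by
    rw [leftOrthogonal_absorbing]
    exact isSmoothSubcategory_projObj i
  proper_left := by
    rw [leftOrthogonal_absorbing]
    exact isProperSubcategory_projObj i

end CyclicAlgebra

end

theorem theoremA (k : Type u) [Field k] (r : ℕ) [NeZero r]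
    [HasDerivedCategory.{w} (ModuleCat.{u} (CyclicAlgebra k r)ᵐᵒᵖ)] (i : CyclicQuiver r) :
    (IsSemiorthogonal (CyclicAlgebra.simpleSeq k r i) ∧
      ∀ a, IsPInftyObject k (isBoundedFinDim k (CyclicAlgebra k r)ᵐᵒᵖ).ι 2
        (CyclicAlgebra.simpleSeq k r i a)) ∧
    IsSemiorthogonalDecomposition ![CyclicAlgebra.absorbing k r i,
      generatedBy (ObjectProperty.singleton (CyclicAlgebra.projObj k r i))] ∧
    AbsorbsSingularities k (CyclicAlgebra.absorbing k r i) :=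
  ⟨⟨CyclicAlgebra.isSemiorthogonal_simpleSeq i, fun a =>
      CyclicAlgebra.isPInftyObject_simpleObj _ (by have := a.2; omega)⟩,
    CyclicAlgebra.isSemiorthogonalDecomposition i,
    CyclicAlgebra.absorbsSingularities_absorbing i⟩
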